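/- Let $D_2=\{(\zeta_1,\zeta_2)\in\mathbb{C}^2 : \operatorname{Im}\zeta_2-|\zeta_1|^2>0\}$ be the two-dimensional Siegel domain with Lebesgue measure, and let $n\ge 1$ be an integer. Let $\mathcal{A}^2_{(1,n)}(D_2)$ be the closed subspace of $L^2(D_2)$ consisting of all square-integrable $f\in C^\infty(D_2)$ with $$\left(\frac{\partial}{\partial\overline{\zeta}_1}-2i\zeta_1\frac{\partial}{\partial\overline{\zeta}_2}\right)f=0,\qquad \left(\frac{\partial}{\partial\overline{\zeta}_2}\right)^{n}f=0 \quad\text{on } D_2,$$ and let $B_{(1,n)}$ be the orthogonal projection of $L^2(D_2)$ onto $\mathcal{A}^2_{(1,n)}(D_2)$. Let $\overline{\mathbb{R}}=[-\infty,+\infty]$ and $\overline{\mathbb{R}}_+=[0,+\infty]$ be the two-point compactifications of $\mathbb{R}$ and $(0,+\infty)$, let $\overline{\Pi}=\overline{\mathbb{R}}\times\overline{\mathbb{R}}_+$, and let $\triangle=\overline{\Pi}/(\overline{\mathbb{R}}\times\{+\infty\})$ be the quotient space obtained by identifying $\overline{\mathbb{R}}\times\{+\infty\}$ to a point. Let $PC(\overline{\mathbb{R}},\{0\})$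 be the set of all functions $a:\overline{\mathbb{R}}\to\mathbb{C}$ that are continuous on $\overline{\mathbb{R}}\setminus\{0\}$ and have one-sided limits at $0$. For $a\in PC(\overline{\mathbb{R}},\{0\})$ let $T_a$ be the Toeplitz operator on $\mathcal{A}^2_{(1,n)}(D_2)$ with symbol $\tilde a(\zeta)=a(\operatorname{Im}\zeta_1)$, that is, $T_af=B_{(1,n)}(\tilde a f)$. Then the $C^*$-algebra generated by all Toeplitz operators $T_a$ with $a\in C(\overline{\mathbb{R}})$ is isomorphic and isometric to the $C^*$-algebra $C(\triangle)$ (that is, there is an isometric $*$-isomorphism between them). Furthermore, the $C^*$-algebra generated by all Toeplitz operators $T_a$ with $a\in PC(\overline{\mathbb{R}},\{0\})$ is $*$-isomorphic to the $C^*$-algebra $C(\overline{\Pi})$. -/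

import Mathlib

open MeasureTheory Set Filter Topology
open scoped ENNReal ContDiff

namespace SiegelToeplitz

/-- The Siegel domain `D₂ = {(ζ₁, ζ₂) ∈ ℂ² : Im ζ₂ - |ζ₁|² > 0}`. -/
def siegelDomain : Set (ℂ × ℂ) := {ζ | 0 < ζ.2.im - ‖ζ.1‖ ^ 2}

theorem isOpen_siegelDomain : IsOpen siegelDomain := by
  have h : Continuous fun ζ : ℂ × ℂ => ζ.2.im - ‖ζ.1‖ ^ 2 := by fun_prop
  exact isOpen_lt continuous_const h

/-- Lebesgue measure on the Siegel domain. -/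
noncomputable def siegelMeasure : Measure (ℂ × ℂ) := volume.restrict siegelDomain

/-- The Hilbert space `L²(D₂)`. -/
abbrev L2Siegel : Type := Lp ℂ 2 siegelMeasure

/-- The Wirtinger derivative `∂/∂ζ̄₁ = (∂/∂x₁ + i ∂/∂y₁) / 2`. -/
noncomputable def dbar₁ (f : ℂ × ℂ → ℂ) (ζ : ℂ × ℂ) : ℂ :=
  (fderiv ℝ f ζ (1, 0) + Complex.I * fderiv ℝ f ζ (Complex.I, 0)) / 2

/-- The Wirtinger derivative `∂/∂ζ̄₂ = (∂/∂x₂ + i ∂/∂y₂) / 2`. -/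
noncomputable def dbar₂ (f : ℂ × ℂ → ℂ) (ζ : ℂ × ℂ) : ℂ :=
  (fderiv ℝ f ζ (0, 1) + Complex.I * fderiv ℝ f ζ (0, Complex.I)) / 2

/-- The operator `∂/∂ζ̄₁ - 2 i ζ₁ ∂/∂ζ̄₂`. -/
noncomputable def dbarTwisted (f : ℂ × ℂ → ℂ) (ζ : ℂ × ℂ) : ℂ :=
  dbar₁ f ζ - 2 * Complex.I * ζ.1 * dbar₂ f ζ

/-- `f` is `L`-analytic on `D₂` for `L = (l₁, l₂)`: it is `C^∞` there (in the real sense) and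
`(∂/∂ζ̄₁ - 2 i ζ₁ ∂/∂ζ̄₂)^{l₁} f = 0`, `(∂/∂ζ̄₂)^{l₂} f = 0` on `D₂`. -/
structure IsPolyanalytic (l₁ l₂ : ℕ) (f : ℂ × ℂ → ℂ) : Prop where
  smooth : ContDiffOn ℝ ∞ f siegelDomain
  eq₁ : ∀ ζ ∈ siegelDomain, (dbarTwisted^[l₁] f) ζ = 0
  eq₂ : ∀ ζ ∈ siegelDomain, (dbar₂^[l₂] f) ζ = 0

/-- The elementary properties of linear differential operators on `D₂` that are needed to see that
the `L`-analytic functions form a vector space. -/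
structure IsLinearLocal (D : (ℂ × ℂ → ℂ) → ℂ × ℂ → ℂ) : Prop where
  smooth : ∀ f, ContDiffOn ℝ ∞ f siegelDomain → ContDiffOn ℝ ∞ (D f) siegelDomain
  congr : ∀ f g, EqOn f g siegelDomain → EqOn (D f) (D g) siegelDomain
  add : ∀ f g, ContDiffOn ℝ ∞ f siegelDomain → ContDiffOn ℝ ∞ g siegelDomain →
    EqOn (D (f + g)) (D f + D g) siegelDomain
  smul : ∀ (c : ℂ) f, ContDiffOn ℝ ∞ f siegelDomain → EqOn (D (c • f)) (c • D f) siegelDomain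

theorem contDiffOn_fderiv_apply {f : ℂ × ℂ → ℂ} (hf : ContDiffOn ℝ ∞ f siegelDomain)
    (v : ℂ × ℂ) : ContDiffOn ℝ ∞ (fun ζ => fderiv ℝ f ζ v) siegelDomain :=
  (hf.fderiv_of_isOpen isOpen_siegelDomain (by simp)).clm_apply contDiffOn_const

theorem fderiv_congr_siegel {f g : ℂ × ℂ → ℂ} (h : EqOn f g siegelDomain) {ζ : ℂ × ℂ}
    (hζ : ζ ∈ siegelDomain) : fderiv ℝ f ζ = fderiv ℝ g ζ :=
  (h.eventuallyEq_of_mem (isOpen_siegelDomain.mem_nhds hζ)).fderiv_eq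

theorem differentiableAt_siegel {f : ℂ × ℂ → ℂ} (hf : ContDiffOn ℝ ∞ f siegelDomain) {ζ : ℂ × ℂ}
    (hζ : ζ ∈ siegelDomain) : DifferentiableAt ℝ f ζ :=
  (hf.differentiableOn (by simp)).differentiableAt (isOpen_siegelDomain.mem_nhds hζ)

theorem isLinearLocal_dbar₁ : IsLinearLocal dbar₁ where
  smooth f hf := ((contDiffOn_fderiv_apply hf _).add
    (contDiffOn_const.mul (contDiffOn_fderiv_apply hf _))).div_const 2
  congr f g h ζ hζ := by simp only [dbar₁, fderiv_congr_siegel h hζ]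
  add f g hf hg ζ hζ := by
    simp only [dbar₁, Pi.add_apply,
      fderiv_add (differentiableAt_siegel hf hζ) (differentiableAt_siegel hg hζ),
      add_apply]
    ring
  smul c f hf ζ hζ := by
    simp only [dbar₁, Pi.smul_apply, fderiv_const_smul (differentiableAt_siegel hf hζ),
      smul_apply, smul_eq_mul]
    ring

theorem isLinearLocal_dbar₂ : IsLinearLocal dbar₂ where
  smooth f hf := ((contDiffOn_fderiv_apply hf _).add
    (contDiffOn_const.mul (contDiffOn_fderiv_apply hf _))).div_const 2
  congr f g h ζ hζ := by simp only [dbar₂, fderiv_congr_siegel h hζ]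
  add f g hf hg ζ hζ := by
    simp only [dbar₂, Pi.add_apply,
      fderiv_add (differentiableAt_siegel hf hζ) (differentiableAt_siegel hg hζ),
      add_apply]
    ring
  smul c f hf ζ hζ := by
    simp only [dbar₂, Pi.smul_apply, fderiv_const_smul (differentiableAt_siegel hf hζ),
      smul_apply, smul_eq_mul]
    ring

theorem isLinearLocal_dbarTwisted : IsLinearLocal dbarTwisted where
  smooth f hf := (isLinearLocal_dbar₁.smooth f hf).sub
    ((contDiffOn_const.mul contDiff_fst.contDiffOn).mul (isLinearLocal_dbar₂.smooth f hf))
  congr f g h ζ hζ := by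
    simp only [dbarTwisted, isLinearLocal_dbar₁.congr f g h hζ, isLinearLocal_dbar₂.congr f g h hζ]
  add f g hf hg ζ hζ := by
    simp only [dbarTwisted, Pi.add_apply, isLinearLocal_dbar₁.add f g hf hg hζ,
      isLinearLocal_dbar₂.add f g hf hg hζ]
    ring
  smul c f hf ζ hζ := by
    simp only [dbarTwisted, Pi.smul_apply, isLinearLocal_dbar₁.smul c f hf hζ,
      isLinearLocal_dbar₂.smul c f hf hζ, smul_eq_mul]
    ring

theorem isLinearLocal_id : IsLinearLocal id where
  smooth _ hf := hf
  congr _ _ h := h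
  add _ _ _ _ _ _ := rfl
  smul _ _ _ _ _ := rfl

theorem IsLinearLocal.iterate {D : (ℂ × ℂ → ℂ) → ℂ × ℂ → ℂ} (hD : IsLinearLocal D) (k : ℕ) :
    IsLinearLocal D^[k] := by
  induction k with
  | zero => exact isLinearLocal_id
  | succ k ih =>
    rw [Function.iterate_succ']
    exact
      { smooth := fun f hf => hD.smooth _ (ih.smooth f hf)
        congr := fun f g h => hD.congr _ _ (ih.congr f g h)
        add := fun f g hf hg => (hD.congr _ _ (ih.add f g hf hg)).trans
          (hD.add _ _ (ih.smooth f hf) (ih.smooth g hg))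
        smul := fun c f hf => (hD.congr _ _ (ih.smul c f hf)).trans
          (hD.smul c _ (ih.smooth f hf)) }

theorem IsPolyanalytic.add {l₁ l₂ : ℕ} {f g : ℂ × ℂ → ℂ} (hf : IsPolyanalytic l₁ l₂ f)
    (hg : IsPolyanalytic l₁ l₂ g) : IsPolyanalytic l₁ l₂ (f + g) where
  smooth := hf.smooth.add hg.smooth
  eq₁ ζ hζ := by
    rw [(isLinearLocal_dbarTwisted.iterate l₁).add f g hf.smooth hg.smooth hζ, Pi.add_apply,
      hf.eq₁ ζ hζ, hg.eq₁ ζ hζ, add_zero]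
  eq₂ ζ hζ := by
    rw [(isLinearLocal_dbar₂.iterate l₂).add f g hf.smooth hg.smooth hζ, Pi.add_apply,
      hf.eq₂ ζ hζ, hg.eq₂ ζ hζ, add_zero]

theorem IsPolyanalytic.smul {l₁ l₂ : ℕ} {f : ℂ × ℂ → ℂ} (c : ℂ) (hf : IsPolyanalytic l₁ l₂ f) :
    IsPolyanalytic l₁ l₂ (c • f) where
  smooth := contDiffOn_const.smul hf.smooth
  eq₁ ζ hζ := by
    rw [(isLinearLocal_dbarTwisted.iterate l₁).smul c f hf.smooth hζ, Pi.smul_apply,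
      hf.eq₁ ζ hζ, smul_zero]
  eq₂ ζ hζ := by
    rw [(isLinearLocal_dbar₂.iterate l₂).smul c f hf.smooth hζ, Pi.smul_apply,
      hf.eq₂ ζ hζ, smul_zero]

theorem isPolyanalytic_zero (l₁ l₂ : ℕ) : IsPolyanalytic l₁ l₂ 0 where
  smooth := contDiffOn_const
  eq₁ ζ hζ := by
    simpa using (isLinearLocal_dbarTwisted.iterate l₁).smul 0 0 contDiffOn_const hζ
  eq₂ ζ hζ := by
    simpa using (isLinearLocal_dbar₂.iterate l₂).smul 0 0 contDiffOn_const hζ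

/-- The space of all square-integrable `L`-analytic functions on `D₂`, `L = (l₁, l₂)`, as a
subspace of `L²(D₂)`. -/
noncomputable def polyBergmanFunctions (l₁ l₂ : ℕ) : Submodule ℂ L2Siegel where
  carrier := {f | ∃ F : ℂ × ℂ → ℂ, IsPolyanalytic l₁ l₂ F ∧ f =ᵐ[siegelMeasure] F}
  zero_mem' := ⟨0, isPolyanalytic_zero l₁ l₂, Lp.coeFn_zero _ _ _⟩
  add_mem' := by
    rintro f g ⟨F, hF, hfF⟩ ⟨G, hG, hgG⟩
    exact ⟨F + G, hF.add hG, (Lp.coeFn_add f g).trans (hfF.add hgG)⟩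
  smul_mem' := by
    rintro c f ⟨F, hF, hfF⟩
    exact ⟨c • F, hF.smul c, (Lp.coeFn_smul c f).trans (hfF.const_smul c)⟩

/-- The poly-Bergman-type space `A²_{(l₁, l₂)}(D₂)`, a closed subspace of `L²(D₂)`. The
square-integrable `L`-analytic functions already form a closed subspace (an `L²`-limit of such
functions is again `L`-analytic, by interior estimates), so that the closure adds no element; it is
there only to make completeness, hence the orthogonal projection, available by definition. -/
noncomputable def polyBergman (l₁ l₂ : ℕ) : Submodule ℂ L2Siegel :=
  (polyBergmanFunctions l₁ l₂).topologicalClosure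

instance (l₁ l₂ : ℕ) : CompleteSpace (polyBergman l₁ l₂) :=
  Submodule.topologicalClosure.completeSpace _

/-- The multiplication operator `M_c : g ↦ c g` on `L²(D₂)`, for `c ∈ L^∞(D₂)`. -/
noncomputable def mulOperator (c : Lp ℂ ∞ siegelMeasure) : L2Siegel →L[ℂ] L2Siegel :=
  (ContinuousLinearMap.mul ℂ ℂ).holderL siegelMeasure ∞ 2 2 c

/-- The Toeplitz operator `f ↦ B (c f)` on `A²_{(l₁, l₂)}(D₂)`, where `B` is the orthogonal
projection from `L²(D₂)` onto `A²_{(l₁, l₂)}(D₂)` and `c ∈ L^∞(D₂)`. -/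
noncomputable def toeplitz (l₁ l₂ : ℕ) (c : Lp ℂ ∞ siegelMeasure) :
    polyBergman l₁ l₂ →L[ℂ] polyBergman l₁ l₂ :=
  (polyBergman l₁ l₂).orthogonalProjectionOnto ∘L mulOperator c ∘L (polyBergman l₁ l₂).subtypeL

/-- `PC(ℝ̄, {0})`: functions on `ℝ̄ = [-∞, +∞]` that are continuous on `ℝ̄ ∖ {0}` and have
one-sided limits at `0`. -/
structure IsPC (a : EReal → ℂ) : Prop where
  continuousOn : ContinuousOn a {0}ᶜ
  left : ∃ l : ℂ, Tendsto a (𝓝[<] 0) (𝓝 l)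
  right : ∃ r : ℂ, Tendsto a (𝓝[>] 0) (𝓝 r)

/-- The symbol `ã(ζ) = a(Im ζ₁)`. -/
def imSymbol (a : EReal → ℂ) (ζ : ℂ × ℂ) : ℂ := a (ζ.1.im : EReal)

theorem isPC_continuousMap (a : C(EReal, ℂ)) : IsPC a where
  continuousOn := a.continuous.continuousOn
  left := ⟨a 0, a.continuous.continuousWithinAt⟩
  right := ⟨a 0, a.continuous.continuousWithinAt⟩

theorem IsPC.measurable {a : EReal → ℂ} (ha : IsPC a) : Measurable a :=
  measurable_of_continuousOn_compl_singleton 0 ha.continuousOn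

theorem IsPC.bounded {a : EReal → ℂ} (ha : IsPC a) : ∃ C : ℝ, ∀ x, ‖a x‖ ≤ C := by
  have key : ∀ {l : Filter EReal} {z : ℂ}, Tendsto a l (𝓝 z) → ∃ C : ℝ, ∀ᶠ y in l, ‖a y‖ ≤ C :=
    fun {l z} h => ⟨‖z‖ + 1, (h.norm.eventually_lt_const (lt_add_one ‖z‖)).mono fun _ hy => hy.le⟩
  have loc : ∀ x : EReal, ∃ C : ℝ, ∀ᶠ y in 𝓝 x, ‖a y‖ ≤ C := by
    intro x
    by_cases hx : x = 0
    · subst hx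
      obtain ⟨l, hl⟩ := ha.left
      obtain ⟨r, hr⟩ := ha.right
      obtain ⟨C₁, h₁⟩ := key hl
      obtain ⟨C₂, h₂⟩ := key hr
      rw [eventually_nhdsWithin_iff] at h₁ h₂
      refine ⟨max (max C₁ C₂) ‖a 0‖, ?_⟩
      filter_upwards [h₁, h₂] with y hy₁ hy₂
      rcases lt_trichotomy y 0 with h | h | h
      · exact (hy₁ h).trans ((le_max_left _ _).trans (le_max_left _ _))
      · rw [h]; exact le_max_right _ _
      · exact (hy₂ h).trans ((le_max_right _ _).trans (le_max_left _ _))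
    · exact key (ha.continuousOn.continuousAt (isOpen_compl_singleton.mem_nhds hx))
  have h : ∃ C : ℝ, ∀ x ∈ (univ : Set EReal), ‖a x‖ ≤ C := by
    refine isCompact_univ.induction_on (p := fun s => ∃ C : ℝ, ∀ x ∈ s, ‖a x‖ ≤ C)
      ⟨0, by simp⟩ (fun s t hst ⟨C, hC⟩ => ⟨C, fun x hx => hC x (hst hx)⟩) ?_ ?_
    · rintro s t ⟨C, hC⟩ ⟨C', hC'⟩
      refine ⟨max C C', fun x hx => hx.elim (fun h => (hC x h).trans (le_max_left _ _))
        (fun h => (hC' x h).trans (le_max_right _ _))⟩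
    · intro x _
      obtain ⟨C, hC⟩ := loc x
      exact ⟨_, mem_nhdsWithin_of_mem_nhds hC, C, fun _ hy => hy⟩
  obtain ⟨C, hC⟩ := h
  exact ⟨C, fun x => hC x (mem_univ x)⟩

theorem IsPC.memLp_imSymbol {a : EReal → ℂ} (ha : IsPC a) :
    MemLp (imSymbol a) ∞ siegelMeasure := by
  obtain ⟨C, hC⟩ := ha.bounded
  refine memLp_top_of_bound ?_ C (Eventually.of_forall fun ζ => hC _)
  exact (ha.measurable.comp (measurable_coe_real_ereal.comp
    (Complex.measurable_im.comp measurable_fst))).aestronglyMeasurable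

/-- The Toeplitz operator `T_a` on `A²_{(1, n)}(D₂)` with symbol `ã(ζ) = a(Im ζ₁)`. -/
noncomputable def toeplitzIm (n : ℕ) (a : EReal → ℂ) (ha : IsPC a) :
    polyBergman 1 n →L[ℂ] polyBergman 1 n :=
  toeplitz 1 n (ha.memLp_imSymbol.toLp (imSymbol a))

/-- The C*-algebra generated by a set `S` of bounded operators on a Hilbert space, together with
the identity. For the sets used below the identity makes no difference: they contain `T_1 = I`. -/
noncomputable def generatedAlgebra {H : Type*} [NormedAddCommGroup H] [InnerProductSpace ℂ H] [CompleteSpace H]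
    (S : Set (H →L[ℂ] H)) : StarSubalgebra ℂ (H →L[ℂ] H) :=
  (StarAlgebra.adjoin ℂ S).topologicalClosure

/-- The C*-algebra generated by all `T_a` with `a ∈ C(ℝ̄)`. -/
noncomputable def toeplitzAlgebraC (n : ℕ) :
    StarSubalgebra ℂ (polyBergman 1 n →L[ℂ] polyBergman 1 n) :=
  generatedAlgebra {T | ∃ a : C(EReal, ℂ), T = toeplitzIm n a (isPC_continuousMap a)}

/-- The C*-algebra generated by all `T_a` with `a ∈ PC(ℝ̄, {0})`. -/
noncomputable def toeplitzAlgebraPC (n : ℕ) :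
    StarSubalgebra ℂ (polyBergman 1 n →L[ℂ] polyBergman 1 n) :=
  generatedAlgebra {T | ∃ (a : EReal → ℂ) (ha : IsPC a), T = toeplitzIm n a ha}

/-- `Π̄ = [-∞, +∞] × [0, +∞]`. -/
abbrev PiBar : Type := EReal × ℝ≥0∞

/-- The equivalence relation on `Π̄` that identifies all points of `ℝ̄ × {+∞}` with each other and
no other distinct points. -/
def collapseTop : Setoid PiBar where
  r p q := p = q ∨ (p.2 = ⊤ ∧ q.2 = ⊤)
  iseqv :=
    { refl := fun _ => Or.inl rfl
      symm := by
        rintro p q (h | ⟨h, h'⟩)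
        · exact Or.inl h.symm
        · exact Or.inr ⟨h', h⟩
      trans := by
        rintro p q r (rfl | ⟨h, h'⟩) (rfl | ⟨k, k'⟩)
        · exact Or.inl rfl
        · exact Or.inr ⟨k, k'⟩
        · exact Or.inr ⟨h, h'⟩
        · exact Or.inr ⟨h, k'⟩ }

/-- The quotient space `△ = Π̄ / (ℝ̄ × {+∞})`, with the quotient topology. -/
abbrev Triangle : Type := Quotient collapseTop

end SiegelToeplitz

/-! Write `ζ₁ = x + iy` and `ζ₂ = p - 2xy + i(v + x² + y²)`. In these coordinates the domain is `{v
> 0}`, Lebesgue measure is unchanged, and the Heisenberg automorphisms become the translations of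
`(x, p)`. The symbols `a(Im ζ₁) = a(y)` are invariant under them, so a Fourier transform in `(x,
p)`, with dual variable `κ = η + iξ`, diagonalises the Toeplitz operators.

The first differential equation becomes `(∂ₓ + i∂_y + 4y∂_p)φ = 0`. On the Fourier side it forces
the form `exp(-2π(ηy + 2ξy²)) C(κ, v)` (`siegelFourier_structure`), which is square-integrable in
`y` only if `ξ > 0` (`siegelFourier_ae_eq_zero`). Whatever `C` is, the squared modulus is, in `y`, a
multiple of the normal density with mean `m = -η/(4ξ)` and variance `σ² = 1/(16πξ)`. Hence
compressing multiplication by `a(y)` gives multiplication by the Gaussian average of `a(m + σc)`, a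
function of `κ` alone (`integral_symbol_siegelFourier`). The second equation matters only in that it
is translation invariant and is satisfied by holomorphic functions.

Translation invariance also makes the transformed space a module over the bounded measurable
functions of `κ` (`mulL2_mem_image`). So symbols act by a `*`-homomorphism `symbolHom`. It is
faithful because the transform of `(ζ₂ + i)⁻⁸` vanishes almost nowhere on `ξ > 0`
(`exists_siegelFourier_ne_zero`).

It remains to compactify the half-plane of pairs `(m, σ)`. With `r = |m| + σ` and `u = m/r` one has
`m + σc = r(u + (1 - |u|)c)`. The pair formed by `u ∈ (-1, 1)`, relabelled by `ℝ`, and `ρ = 1/r`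
runs over the interior of `Π̄`. By dominated convergence the averages extend continuously to `Π̄`,
also for symbols with a jump at `0`, if `0·c` is read as `0⁺` or `0⁻`
(`IsPC.continuous_gaussSymbol`). At `ρ = ∞` a continuous `a` gives `a(0)`, so these symbols live on
`△`, whereas a jump gives a mixture of `a(0±)` that depends on `u`. The symbol `slope |t|` separates
values of `ρ`, the indicator of `(0, ∞]` (or, when `ρ < ∞`, continuous ramps tending to it)
separates values of `u`, and Stone–Weierstrass finishes the proof. -/

namespace SiegelToeplitz

set_option linter.unusedSectionVars false

/-! ### The `L²` Fourier transform in one group of variables. -/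

section PartialFourier

open FourierTransform RealInnerProductSpace SchwartzMap

variable {E : Type*} [NormedAddCommGroup E] [InnerProductSpace ℝ E] [FiniteDimensional ℝ E]
  [MeasurableSpace E] [BorelSpace E] {Y : Type*} [MeasurableSpace Y] {ρ : Measure Y}

/-- On `L¹ ∩ L²` the `L²` Fourier transform is given by the Fourier integral. -/
theorem fourier_toLp_ae_eq {f : E → ℂ} (h1 : Integrable f) (h2 : MemLp f 2) :
    (𝓕 (h2.toLp f) : Lp (α := E) ℂ 2) =ᵐ[volume] 𝓕 f := by
  have hcont : Continuous (𝓕 f) :=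
    VectorFourier.fourierIntegral_continuous Real.continuous_fourierChar
      (L := innerₗ E) continuous_inner h1
  refine ae_eq_of_integral_contDiff_smul_eq ((Lp.memLp _).locallyIntegrable (by norm_num))
    hcont.locallyIntegrable fun g hg hgc => ?_
  have hgc' : HasCompactSupport (Complex.ofRealCLM ∘ g) := hgc.comp_left rfl
  let G : 𝓢(E, ℂ) := hgc'.toSchwartzMap (Complex.ofRealCLM.contDiff.comp hg)
  have hG : ∀ x, G x = (g x : ℂ) := fun x => rfl
  -- The `L²` transform agrees with the one on tempered distributions, where pairing with `G` moves
  -- the transform onto `G`. The same transposition holds for Fourier integrals of `L¹` functions.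
  have key := congrArg (fun T : 𝓢'(E, ℂ) => T G)
    (Lp.fourier_toTemperedDistribution_eq (h2.toLp f))
  simp only [TemperedDistribution.fourier_apply, Lp.toTemperedDistribution_apply] at key
  have e1 : ∀ φ : E → ℂ, ∫ x, g x • φ x = ∫ x, G x • φ x := fun φ => by simp [hG]
  rw [e1, ← key]
  have e2 : ∫ x, (𝓕 G : 𝓢(E, ℂ)) x • (h2.toLp f) x = ∫ x, (𝓕 (G : E → ℂ)) x • f x := by
    refine integral_congr_ae ?_
    filter_upwards [h2.coeFn_toLp] with x hx
    rw [hx, SchwartzMap.fourier_coe]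
  rw [e2]
  have := VectorFourier.integral_fourierIntegral_smul_eq_flip (μ := volume) (ν := volume)
    (L := innerₗ E) Real.continuous_fourierChar continuous_inner G.integrable h1
  rw [flip_innerₗ] at this
  refine this.trans (integral_congr_ae (.of_forall fun x => ?_))
  simp only [hG, Complex.real_smul, smul_eq_mul]; rfl

theorem lintegral_enorm_sq_fourier {f : E → ℂ} (h1 : Integrable f) (h2 : MemLp f 2) :
    ∫⁻ κ, ‖𝓕 f κ‖ₑ ^ 2 = ∫⁻ q, ‖f q‖ₑ ^ 2 := by
  have h := Lp.norm_fourier_eq (h2.toLp f)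
  have h' : eLpNorm (𝓕 f) 2 volume = eLpNorm f 2 volume := by
    rw [← eLpNorm_congr_ae (fourier_toLp_ae_eq h1 h2), ← eLpNorm_congr_ae h2.coeFn_toLp]
    rwa [Lp.norm_def, Lp.norm_def, ENNReal.toReal_eq_toReal_iff' (Lp.eLpNorm_ne_top _)
      (Lp.eLpNorm_ne_top _)] at h
  have := congrArg (fun t : ℝ≥0∞ => t ^ (2 : ℝ)) h'
  simp only [eLpNorm_eq_lintegral_rpow_enorm_toReal two_ne_zero ENNReal.ofNat_ne_top,
    ENNReal.toReal_ofNat] at this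
  rw [← ENNReal.rpow_mul, ← ENNReal.rpow_mul] at this
  simpa using this

/-- The Fourier transform in the first variable. -/
noncomputable def partialFourier (f : E × Y → ℂ) (p : E × Y) : ℂ := 𝓕 (fun q => f (q, p.2)) p.1

theorem partialFourier_eq (f : E × Y → ℂ) (p : E × Y) : partialFourier f p =
    ∫ q, (Real.fourierChar (-inner ℝ q p.1) : ℂ) * f (q, p.2) := by
  rw [partialFourier, Real.fourier_eq]; rfl

variable [SFinite ρ]

theorem eLpNorm_two_sq {α : Type*} [MeasurableSpace α] (μ : Measure α) (f : α → ℂ) :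
    eLpNorm f 2 μ = (∫⁻ x, ‖f x‖ₑ ^ 2 ∂μ) ^ (1 / 2 : ℝ) := by
  rw [eLpNorm_eq_lintegral_rpow_enorm_toReal two_ne_zero ENNReal.ofNat_ne_top]
  simp

theorem aestronglyMeasurable_partialFourier {f : E × Y → ℂ}
    (hf : AEStronglyMeasurable f ((volume : Measure E).prod ρ)) :
    AEStronglyMeasurable (partialFourier f) ((volume : Measure E).prod ρ) := by
  have key : ∀ g : E × Y → ℂ, StronglyMeasurable g → StronglyMeasurable (partialFourier g) := by
    intro g hg
    have : partialFourier g = fun p : E × Y =>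
        ∫ q, (Real.fourierChar (-inner ℝ q p.1) : ℂ) * g (q, p.2) := by
      ext p; exact partialFourier_eq g p
    rw [this]
    refine StronglyMeasurable.integral_prod_right
      (f := fun p : E × Y => fun q : E => (Real.fourierChar (-inner ℝ q p.1) : ℂ) * g (q, p.2)) ?_
    refine StronglyMeasurable.mul ?_ ?_
    · refine Continuous.comp_stronglyMeasurable
        (g := fun t : E × E => (Real.fourierChar (-inner ℝ t.1 t.2) : ℂ))
        (f := fun z : (E × Y) × E => (z.2, z.1.1)) ?_ ?_
      · exact continuous_subtype_val.comp (Real.continuous_fourierChar.comp continuous_inner.neg)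
      · exact (measurable_snd.prodMk (measurable_fst.comp measurable_fst)).stronglyMeasurable
    · exact hg.comp_measurable (measurable_snd.prodMk (measurable_snd.comp measurable_fst))
  refine ⟨partialFourier (hf.mk f), key _ hf.stronglyMeasurable_mk, ?_⟩
  have h1 : ∀ᵐ w ∂ρ, ∀ᵐ q : E, f (q, w) = hf.mk f (q, w) := by
    have := hf.ae_eq_mk
    have h2 := (Measure.measurePreserving_swap (μ := ρ) (ν :=
      (volume : Measure E))).quasiMeasurePreserving.ae this
    exact Measure.ae_ae_of_ae_prod h2
  have h3 : ∀ᵐ p ∂((volume : Measure E).prod ρ), ∀ᵐ q : E, f (q, p.2) = hf.mk f (q, p.2) :=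
    Measure.quasiMeasurePreserving_snd.ae h1
  filter_upwards [h3] with p hp
  rw [partialFourier_eq, partialFourier_eq]
  refine integral_congr_ae ?_
  filter_upwards [hp] with q hq
  rw [hq]

theorem ae_memLp_two_slice {α β : Type*} [MeasurableSpace α] [MeasurableSpace β] {μ : Measure α}
    {ν : Measure β} [SFinite μ] [SFinite ν] {f : α × β → ℂ} (hf : MemLp f 2 (μ.prod ν)) :
    ∀ᵐ w ∂ν, MemLp (fun q => f (q, w)) 2 μ := by
  have h1 := (memLp_two_iff_integrable_sq_norm hf.1).1 hf
  have h3 := hf.1.prod_swap.prodMk_left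
  filter_upwards [h1.prod_left_ae, h3] with w hw hm
  exact (memLp_two_iff_integrable_sq_norm hm).2 hw

/-- Plancherel on almost every slice, followed by Tonelli. -/
theorem lintegral_enorm_sq_partialFourier {f : E × Y → ℂ}
    (h1 : Integrable f ((volume : Measure E).prod ρ))
    (h2 : MemLp f 2 ((volume : Measure E).prod ρ)) :
    ∫⁻ p, ‖partialFourier f p‖ₑ ^ 2 ∂((volume : Measure E).prod ρ) =
      ∫⁻ p, ‖f p‖ₑ ^ 2 ∂((volume : Measure E).prod ρ) := by
  have e1 := lintegral_prod_symm (μ := (volume : Measure E)) (ν := ρ)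
    (fun p => ‖partialFourier f p‖ₑ ^ 2)
    ((aestronglyMeasurable_partialFourier h1.1).enorm.pow_const 2)
  have e2 := lintegral_prod_symm (μ := (volume : Measure E)) (ν := ρ)
    (fun p => ‖f p‖ₑ ^ 2) (h1.1.enorm.pow_const 2)
  rw [e1, e2]
  refine lintegral_congr_ae ?_
  have h3 := h1.prod_left_ae
  filter_upwards [h3, ae_memLp_two_slice h2] with w hw1 hw2
  simp only [partialFourier]
  exact lintegral_enorm_sq_fourier hw1 hw2

theorem eLpNorm_partialFourier {f : E × Y → ℂ} (h1 : Integrable f ((volume : Measure E).prod ρ))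
    (h2 : MemLp f 2 ((volume : Measure E).prod ρ)) :
    eLpNorm (partialFourier f) 2 ((volume : Measure E).prod ρ) =
      eLpNorm f 2 ((volume : Measure E).prod ρ) := by
  rw [eLpNorm_two_sq, eLpNorm_two_sq, lintegral_enorm_sq_partialFourier h1 h2]

theorem memLp_partialFourier {f : E × Y → ℂ} (h1 : Integrable f ((volume : Measure E).prod ρ))
    (h2 : MemLp f 2 ((volume : Measure E).prod ρ)) : MemLp (partialFourier f) 2 ((volume : Measure E).prod ρ) :=
  ⟨aestronglyMeasurable_partialFourier h1.1, by rw [eLpNorm_partialFourier h1 h2]; exact h2.2⟩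

theorem partialFourier_congr {f g : E × Y → ℂ} (h : f =ᵐ[(volume : Measure E).prod ρ] g) :
    partialFourier f =ᵐ[(volume : Measure E).prod ρ] partialFourier g := by
  have h2 := (Measure.measurePreserving_swap (μ := ρ) (ν :=
      (volume : Measure E))).quasiMeasurePreserving.ae h
  have h3 : ∀ᵐ p ∂((volume : Measure E).prod ρ), ∀ᵐ q : E, f (q, p.2) = g (q, p.2) :=
    Measure.quasiMeasurePreserving_snd.ae (Measure.ae_ae_of_ae_prod h2)
  filter_upwards [h3] with p hp
  rw [partialFourier_eq, partialFourier_eq]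
  refine integral_congr_ae ?_
  filter_upwards [hp] with q hq
  rw [hq]

theorem integrable_fourierChar_mul {f : E → ℂ} (hf : Integrable f) (κ : E) :
    Integrable fun q => (Real.fourierChar (-inner ℝ q κ) : ℂ) * f q :=
  (VectorFourier.fourierIntegral_convergent_iff Real.continuous_fourierChar (L := innerₗ E)
    continuous_inner κ).2 hf

theorem partialFourier_add {f g : E × Y → ℂ} (hf : Integrable f ((volume : Measure E).prod ρ))
    (hg : Integrable g ((volume : Measure E).prod ρ)) :
    partialFourier (f + g) =ᵐ[(volume : Measure E).prod ρ] partialFourier f + partialFourier g := by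
  filter_upwards [Measure.quasiMeasurePreserving_snd.ae hf.prod_left_ae,
    Measure.quasiMeasurePreserving_snd.ae hg.prod_left_ae] with p hfp hgp
  rw [Pi.add_apply, partialFourier_eq, partialFourier_eq, partialFourier_eq,
    ← integral_add (integrable_fourierChar_mul hfp _) (integrable_fourierChar_mul hgp _)]
  simp [mul_add]

theorem partialFourier_smul (c : ℂ) (f : E × Y → ℂ) :
    partialFourier (c • f) = c • partialFourier f := by
  ext p
  rw [Pi.smul_apply, partialFourier_eq, partialFourier_eq, ← integral_smul]
  simp [mul_left_comm]

variable (E ρ) in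
/-- The elements of `L²` that are integrable. -/
noncomputable def integrableL2 : Submodule ℂ (Lp ℂ 2 ((volume : Measure E).prod ρ)) where
  carrier := {f | Integrable f ((volume : Measure E).prod ρ)}
  zero_mem' := (integrable_zero _ _ _).congr (Lp.coeFn_zero _ _ _).symm
  add_mem' {f g} hf hg := (Integrable.add hf hg).congr (Lp.coeFn_add f g).symm
  smul_mem' c f hf := (Integrable.smul c hf).congr (Lp.coeFn_smul c f).symm

theorem dense_integrableL2 : Dense (integrableL2 E ρ : Set (Lp ℂ 2 ((volume : Measure E).prod ρ))) := by
  have h := Lp.simpleFunc.dense (E := ℂ) (μ := (volume : Measure E).prod ρ) (p := 2)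
    ENNReal.ofNat_ne_top
  refine h.mono fun f hf => ?_
  have hi := (SimpleFunc.memLp_iff_integrable two_ne_zero ENNReal.ofNat_ne_top).1
    (Lp.simpleFunc.memLp ⟨f, hf⟩)
  exact hi.congr (Lp.simpleFunc.toSimpleFunc_eq_toFun ⟨f, hf⟩)

variable (E ρ) in
/-- The Fourier transform in the first variable on `L¹ ∩ L²`. -/
noncomputable def partialFourierDense :
    integrableL2 E ρ →ₗ[ℂ] Lp ℂ 2 ((volume : Measure E).prod ρ) where
  toFun f := (memLp_partialFourier f.2 (Lp.memLp f.1)).toLp _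
  map_add' f g := by
    rw [← MemLp.toLp_add]
    refine MemLp.toLp_congr _ _ ?_
    exact (partialFourier_congr (Lp.coeFn_add f.1 g.1)).trans (partialFourier_add f.2 g.2)
  map_smul' c f := by
    rw [RingHom.id_apply, ← MemLp.toLp_const_smul]
    refine MemLp.toLp_congr _ _ ?_
    rw [← partialFourier_smul]
    exact partialFourier_congr (Lp.coeFn_smul c f.1)

theorem norm_partialFourierDense (f : integrableL2 E ρ) : ‖partialFourierDense E ρ f‖ = ‖f‖ := by
  change ‖(memLp_partialFourier f.2 (Lp.memLp f.1)).toLp _‖ = ‖f.1‖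
  rw [Lp.norm_toLp, eLpNorm_partialFourier f.2 (Lp.memLp f.1), Lp.norm_def]

variable (E ρ) in
/-- The Fourier transform in the first variable on `L²`. -/
noncomputable def partialFourierL2 :
    Lp ℂ 2 ((volume : Measure E).prod ρ) →ₗᵢ[ℂ] Lp ℂ 2 ((volume : Measure E).prod ρ) where
  toLinearMap := ((partialFourierDense E ρ).extendOfNorm (integrableL2 E ρ).subtype).toLinearMap
  norm_map' f := by
    have hd : DenseRange (integrableL2 E ρ).subtype := by
      simpa [DenseRange] using dense_integrableL2 (E := E) (ρ := ρ)
    refine hd.induction_on (p := fun f => ‖((partialFourierDense E ρ).extendOfNorm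
      (integrableL2 E ρ).subtype) f‖ = ‖f‖) f (isClosed_eq (by fun_prop) (by fun_prop)) fun g => ?_
    rw [LinearMap.extendOfNorm_eq hd ⟨1, fun x => by
      rw [one_mul, norm_partialFourierDense]; rfl⟩, norm_partialFourierDense]
    rfl

theorem partialFourierL2_toLp {f : E × Y → ℂ} (h1 : Integrable f ((volume : Measure E).prod ρ))
    (h2 : MemLp f 2 ((volume : Measure E).prod ρ)) :
    partialFourierL2 E ρ (h2.toLp f) =ᵐ[(volume : Measure E).prod ρ] partialFourier f := by
  have hd : DenseRange (integrableL2 E ρ).subtype := by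
    simpa [DenseRange] using dense_integrableL2 (E := E) (ρ := ρ)
  have hmem : h2.toLp f ∈ integrableL2 E ρ := h1.congr h2.coeFn_toLp.symm
  have e : partialFourierL2 E ρ (h2.toLp f) = partialFourierDense E ρ ⟨_, hmem⟩ :=
    LinearMap.extendOfNorm_eq (e := (integrableL2 E ρ).subtype) hd ⟨1, fun x => by
      rw [one_mul, norm_partialFourierDense]; rfl⟩ ⟨h2.toLp f, hmem⟩
  rw [e]
  exact (memLp_partialFourier hmem (Lp.memLp _)).coeFn_toLp.trans (partialFourier_congr h2.coeFn_toLp)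

/-- The multiplication operator on `L²(μ)` by an element of `L^∞(μ)`. -/
noncomputable def mulL2 {α : Type*} [MeasurableSpace α] {μ : Measure α} (c : Lp ℂ ∞ μ) :
    Lp ℂ 2 μ →L[ℂ] Lp ℂ 2 μ :=
  (ContinuousLinearMap.mul ℂ ℂ).holderL μ ∞ 2 2 c

theorem coeFn_mulL2 {α : Type*} [MeasurableSpace α] {μ : Measure α} (c : Lp ℂ ∞ μ)
    (f : Lp ℂ 2 μ) : mulL2 c f =ᵐ[μ] fun x => c x * f x :=
  ContinuousLinearMap.coeFn_holder _ _ _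

theorem partialFourierL2_of_mem {f : Lp ℂ 2 ((volume : Measure E).prod ρ)}
    (h : f ∈ integrableL2 E ρ) :
    partialFourierL2 E ρ f =ᵐ[(volume : Measure E).prod ρ] partialFourier f := by
  have := partialFourierL2_toLp (f := f) h (Lp.memLp f)
  rwa [Lp.toLp_coeFn] at this

/-- The partial Fourier transform commutes with multiplications in the other variable. -/
theorem partialFourierL2_mulL2 (c : Lp ℂ ∞ ((volume : Measure E).prod ρ)) (b : Y → ℂ)
    (hc : c =ᵐ[(volume : Measure E).prod ρ] fun p => b p.2)
    (f : Lp ℂ 2 ((volume : Measure E).prod ρ)) :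
    partialFourierL2 E ρ (mulL2 c f) = mulL2 c (partialFourierL2 E ρ f) := by
  refine dense_integrableL2.induction (P := fun f => partialFourierL2 E ρ (mulL2 c f) =
    mulL2 c (partialFourierL2 E ρ f)) (fun f hf => ?_)
    (isClosed_eq (by fun_prop) (by fun_prop)) f
  have hmem : mulL2 c f ∈ integrableL2 E ρ := by
    have : Integrable (fun x => c x * f x) ((volume : Measure E).prod ρ) :=
      Integrable.mul_of_top_right hf (Lp.memLp c)
    exact this.congr (coeFn_mulL2 c f).symm
  refine Lp.ext ?_
  have h1 : (mulL2 c f : E × Y → ℂ) =ᵐ[(volume : Measure E).prod ρ] fun p => b p.2 * f p := by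
    filter_upwards [coeFn_mulL2 c f, hc] with p h1 h2
    rw [h1, h2]
  filter_upwards [partialFourierL2_of_mem hmem, partialFourierL2_of_mem hf,
    coeFn_mulL2 c (partialFourierL2 E ρ f), hc, partialFourier_congr h1] with p h2 h3 h4 h5 h6
  rw [h2, h4, h3, h5, h6, partialFourier_eq, partialFourier_eq, ← integral_const_mul]
  simp only [mul_left_comm]

variable (Y) in
/-- Translation in the first variable. -/
def shiftFst (s : E) (p : E × Y) : E × Y := (p.1 + s, p.2)

theorem measurePreserving_shiftFst (s : E) :
    MeasurePreserving (shiftFst Y s) ((volume : Measure E).prod ρ) ((volume : Measure E).prod ρ) :=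
  (measurePreserving_add_right volume s).prod (MeasurePreserving.id ρ)

/-- The partial Fourier transform turns translations into multiplications by characters. -/
theorem partialFourierL2_shiftFst (s : E) (f : Lp ℂ 2 ((volume : Measure E).prod ρ)) :
    partialFourierL2 E ρ (Lp.compMeasurePreserving _ (measurePreserving_shiftFst s) f)
      =ᵐ[(volume : Measure E).prod ρ]
        fun p => (Real.fourierChar (inner ℝ s p.1) : ℂ) * partialFourierL2 E ρ f p := by
  have hm : MemLp (fun p : E × Y => (Real.fourierChar (inner ℝ s p.1) : ℂ)) ∞
      ((volume : Measure E).prod ρ) := by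
    refine memLp_top_of_bound ?_ 1 (.of_forall fun p => (Circle.norm_coe _).le)
    exact (continuous_subtype_val.comp (Real.continuous_fourierChar.comp
      (continuous_const.inner continuous_id))).comp_aestronglyMeasurable
        measurable_fst.aestronglyMeasurable
  have key : partialFourierL2 E ρ (Lp.compMeasurePreservingₗᵢ ℂ _ (measurePreserving_shiftFst s) f)
      = mulL2 (hm.toLp _) (partialFourierL2 E ρ f) := by
    refine dense_integrableL2.induction (P := fun f => partialFourierL2 E ρ
      (Lp.compMeasurePreservingₗᵢ ℂ _ (measurePreserving_shiftFst s) f) =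
      mulL2 (hm.toLp _) (partialFourierL2 E ρ f)) (fun f hf => ?_)
      (isClosed_eq (by fun_prop) (by fun_prop)) f
    have h1 := Lp.coeFn_compMeasurePreserving f (measurePreserving_shiftFst (ρ := ρ) s)
    have hmem : Lp.compMeasurePreservingₗᵢ ℂ _ (measurePreserving_shiftFst s) f ∈
        integrableL2 E ρ :=
      ((measurePreserving_shiftFst s).integrable_comp_of_integrable hf).congr h1.symm
    refine Lp.ext ?_
    filter_upwards [partialFourierL2_of_mem hmem, partialFourierL2_of_mem hf,
      coeFn_mulL2 (hm.toLp _) (partialFourierL2 E ρ f), hm.coeFn_toLp,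
      partialFourier_congr h1] with p h2 h3 h4 h5 h6
    rw [h2, h4, h3, h5]
    refine h6.trans ?_
    rw [partialFourier_eq, partialFourier_eq, ← integral_const_mul]
    -- The substitution `q ↦ q + s` in the Fourier integral produces the character.
    refine Eq.trans (integral_congr_ae (.of_forall fun q => ?_)) (integral_add_right_eq_self
      (fun q => (Real.fourierChar (inner ℝ s p.1) : ℂ) *
        ((Real.fourierChar (-inner ℝ q p.1) : ℂ) * f (q, p.2))) s)
    simp only [inner_add_left, neg_add, AddChar.map_add_eq_mul, Circle.coe_mul, ← mul_assoc]
    rw [mul_comm (Real.fourierChar (inner ℝ s p.1) : ℂ), mul_assoc (Real.fourierChar _ : ℂ),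
      ← Circle.coe_mul, ← AddChar.map_add_eq_mul,
      add_neg_cancel, AddChar.map_zero_eq_one, Circle.coe_one, mul_one]
    rfl
  filter_upwards [coeFn_mulL2 (hm.toLp _) (partialFourierL2 E ρ f), hm.coeFn_toLp] with p h1 h2
  rw [← h2, ← h1, ← key]
  rfl

end PartialFourier

/-! ### Tube coordinates, Heisenberg translations and the unitary picture. -/

section Coordinates

/-- The measure on the space `ℂ × (ℝ × ℝ)` of coordinates `(x + i p, (y, v))`. -/
noncomputable def coordMeasure : Measure (ℂ × (ℝ × ℝ)) :=
  (volume : Measure ℂ).prod ((volume : Measure ℝ).prod ((volume : Measure ℝ).restrict (Ioi 0)))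

/-- Coordinates on the Siegel domain that turn it into a tube domain:
`ζ₁ = x + i y` and `ζ₂ = p - 2 x y + i (v + x² + y²)`. -/
def siegelCoord (p : ℂ × (ℝ × ℝ)) : ℂ × ℂ :=
  (⟨p.1.re, p.2.1⟩, ⟨p.1.im - 2 * p.1.re * p.2.1, p.2.2 + p.1.re ^ 2 + p.2.1 ^ 2⟩)

theorem siegelCoord_mem_iff (p : ℂ × (ℝ × ℝ)) : siegelCoord p ∈ siegelDomain ↔ 0 < p.2.2 := by
  have : (siegelCoord p).2.im - ‖(siegelCoord p).1‖ ^ 2 = p.2.2 := by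
    rw [← Complex.normSq_eq_norm_sq, Complex.normSq_apply]
    simp only [siegelCoord]; ring
  rw [siegelDomain, mem_ofPred_eq, this]

theorem measurePreserving_prodProdProdComm {α β γ δ : Type*} [MeasureSpace α] [MeasureSpace β]
    [MeasureSpace γ] [MeasureSpace δ] [SFinite (volume : Measure α)] [SFinite (volume : Measure β)]
    [SFinite (volume : Measure γ)] [SFinite (volume : Measure δ)] :
    MeasurePreserving (fun p : (α × β) × (γ × δ) => ((p.1.1, p.2.1), (p.1.2, p.2.2))) := by
  have h1 := measurePreserving_prodAssoc (volume : Measure α) (volume : Measure β)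
    (volume : Measure (γ × δ))
  have h2 := (measurePreserving_prodAssoc (volume : Measure β) (volume : Measure γ)
    (volume : Measure δ)).symm
  have h3 := (Measure.measurePreserving_swap (μ := (volume : Measure β))
    (ν := (volume : Measure γ))).prod (MeasurePreserving.id (volume : Measure δ))
  have h4 := measurePreserving_prodAssoc (volume : Measure γ) (volume : Measure β)
    (volume : Measure δ)
  have h5 := (measurePreserving_prodAssoc (volume : Measure α) (volume : Measure γ)
    (volume : Measure (β × δ))).symm
  exact h5.comp (((MeasurePreserving.id (volume : Measure α)).prod (h4.comp (h3.comp h2))).comp h1)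

theorem measurePreserving_shear {τ : ℂ → ℂ} {g : ℂ → ℂ} (hτ : MeasurePreserving τ)
    (hg : Measurable g) : MeasurePreserving (fun ζ : ℂ × ℂ => (τ ζ.1, ζ.2 + g ζ.1)) :=
  hτ.skew_product (g := fun z w => w + g z) (by fun_prop)
    (.of_forall fun z => (measurePreserving_add_right volume (g z)).map_eq)

/-- The map is a regrouping of real coordinates followed by the shear `ζ₂ ↦ ζ₂ + g(ζ₁)` with `g =
-2xy + i(x² + y²)`, so its Jacobian is `1`. -/
theorem measurePreserving_siegelCoord :
    MeasurePreserving siegelCoord coordMeasure siegelMeasure := by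
  have hR := Complex.volume_preserving_equiv_real_prod
  have h1 : MeasurePreserving (fun p : ℂ × (ℝ × ℝ) => ((p.1.re, p.1.im), p.2)) :=
    hR.prod (MeasurePreserving.id volume)
  have h2 : MeasurePreserving (fun p : (ℝ × ℝ) × (ℝ × ℝ) =>
      ((⟨p.1.1, p.1.2⟩, ⟨p.2.1, p.2.2⟩) : ℂ × ℂ)) := hR.symm.prod hR.symm
  have h3 := measurePreserving_shear (τ := id) (g := fun z => ⟨-2 * z.re * z.im, z.re ^ 2 + z.im ^ 2⟩)
    (MeasurePreserving.id volume)
    (Complex.measurableEquivRealProd.symm.measurable.comp (by fun_prop :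
      Measurable fun z : ℂ => (-2 * z.re * z.im, z.re ^ 2 + z.im ^ 2)))
  have h4 : MeasurePreserving siegelCoord := by
    have := h3.comp (h2.comp (measurePreserving_prodProdProdComm.comp h1))
    convert! this using 1
    ext p : 1
    apply Prod.ext <;> apply Complex.ext <;> simp [siegelCoord] <;> ring
  have h5 := h4.restrict_preimage isOpen_siegelDomain.measurableSet
  have h6 : siegelCoord ⁻¹' siegelDomain = univ ×ˢ (univ ×ˢ Ioi 0) := by
    ext p; simp [siegelCoord_mem_iff]
  have h7 : coordMeasure = volume.restrict (univ ×ˢ (univ ×ˢ Ioi 0)) := by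
    rw [coordMeasure, Measure.volume_eq_prod ℂ, Measure.volume_eq_prod ℝ, ← Measure.prod_restrict,
      ← Measure.prod_restrict, Measure.restrict_univ, Measure.restrict_univ]
  rw [h7, ← h6]
  exact h5

/-- The Heisenberg translations by `s = t + i s'`, automorphisms of the Siegel domain. -/
def heisenberg (s : ℂ) (ζ : ℂ × ℂ) : ℂ × ℂ :=
  (ζ.1 + s.re, ζ.2 + (2 * Complex.I * s.re * ζ.1 + Complex.I * s.re ^ 2 + s.im))

theorem heisenberg_mem_iff (s : ℂ) (ζ : ℂ × ℂ) :
    heisenberg s ζ ∈ siegelDomain ↔ ζ ∈ siegelDomain := by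
  have : (heisenberg s ζ).2.im - ‖(heisenberg s ζ).1‖ ^ 2 = ζ.2.im - ‖ζ.1‖ ^ 2 := by
    rw [← Complex.normSq_eq_norm_sq, Complex.normSq_apply, ← Complex.normSq_eq_norm_sq,
      Complex.normSq_apply]
    simp [heisenberg, pow_two]; ring
  rw [siegelDomain, mem_ofPred_eq, mem_ofPred_eq, this]

theorem heisenberg_siegelCoord (s : ℂ) (p : ℂ × (ℝ × ℝ)) :
    heisenberg s (siegelCoord p) = siegelCoord (shiftFst (ℝ × ℝ) s p) := by
  apply Prod.ext <;> apply Complex.ext <;>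
    simp [heisenberg, siegelCoord, shiftFst, pow_two] <;> ring

theorem measurePreserving_heisenberg (s : ℂ) :
    MeasurePreserving (heisenberg s) siegelMeasure siegelMeasure := by
  have h := measurePreserving_shear (τ := fun z => z + s.re)
    (g := fun z => 2 * Complex.I * s.re * z + Complex.I * s.re ^ 2 + s.im)
    (measurePreserving_add_right volume _) (by fun_prop)
  have h5 := h.restrict_preimage isOpen_siegelDomain.measurableSet
  have h6 : (fun ζ : ℂ × ℂ => (ζ.1 + (s.re : ℂ), ζ.2 + (2 * Complex.I * s.re * ζ.1 +
      Complex.I * s.re ^ 2 + s.im))) ⁻¹' siegelDomain = siegelDomain := by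
    ext ζ; exact heisenberg_mem_iff s ζ
  rw [h6] at h5
  exact h5

/-- The derivative of `heisenberg s`. -/
noncomputable def heisenbergDeriv (s : ℂ) : ℂ × ℂ →L[ℝ] ℂ × ℂ :=
  (ContinuousLinearMap.fst ℝ ℂ ℂ).prod (ContinuousLinearMap.snd ℝ ℂ ℂ +
    (2 * Complex.I * s.re : ℂ) • ContinuousLinearMap.fst ℝ ℂ ℂ)

theorem hasFDerivAt_heisenberg (s : ℂ) (ζ : ℂ × ℂ) :
    HasFDerivAt (heisenberg s) (heisenbergDeriv s) ζ := by
  refine HasFDerivAt.prodMk (hasFDerivAt_fst.add_const _) ?_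
  refine hasFDerivAt_snd.add ?_
  refine HasFDerivAt.add_const _ (HasFDerivAt.add_const _ ?_)
  exact hasFDerivAt_fst.const_mul _

theorem contDiff_heisenberg (s : ℂ) : ContDiff ℝ ∞ (heisenberg s) := by
  unfold heisenberg; fun_prop

theorem fderiv_comp_heisenberg (s : ℂ) {f : ℂ × ℂ → ℂ} (hf : ContDiffOn ℝ ∞ f siegelDomain)
    {ζ : ℂ × ℂ} (hζ : ζ ∈ siegelDomain) (w : ℂ × ℂ) :
    fderiv ℝ (f ∘ heisenberg s) ζ w =
      fderiv ℝ f (heisenberg s ζ) (w.1, w.2 + 2 * Complex.I * s.re * w.1) := by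
  rw [((differentiableAt_siegel hf ((heisenberg_mem_iff s ζ).2 hζ)).hasFDerivAt.comp ζ
    (hasFDerivAt_heisenberg s ζ)).fderiv]
  simp [heisenbergDeriv]

theorem contDiffOn_comp_heisenberg (s : ℂ) {f : ℂ × ℂ → ℂ} (hf : ContDiffOn ℝ ∞ f siegelDomain) :
    ContDiffOn ℝ ∞ (f ∘ heisenberg s) siegelDomain :=
  hf.comp (contDiff_heisenberg s).contDiffOn fun ζ hζ => (heisenberg_mem_iff s ζ).2 hζ

theorem dbar₂_comp_heisenberg (s : ℂ) {f : ℂ × ℂ → ℂ} (hf : ContDiffOn ℝ ∞ f siegelDomain) :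
    EqOn (dbar₂ (f ∘ heisenberg s)) (dbar₂ f ∘ heisenberg s) siegelDomain := by
  intro ζ hζ
  simp [dbar₂, fderiv_comp_heisenberg s hf hζ]

/-- The derivative of the translation adds a multiple of `∂/∂ζ̄₂` to `∂/∂ζ̄₁`. It is compensated by
the change of the coefficient `ζ₁` to `ζ₁ + Re s`. -/
theorem dbarTwisted_comp_heisenberg (s : ℂ) {f : ℂ × ℂ → ℂ} (hf : ContDiffOn ℝ ∞ f siegelDomain) :
    EqOn (dbarTwisted (f ∘ heisenberg s)) (dbarTwisted f ∘ heisenberg s) siegelDomain := by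
  intro ζ hζ
  have e1 : ((1, 2 * Complex.I * s.re) : ℂ × ℂ) = (1, 0) + (2 * s.re) • (0, Complex.I) := by
    ext <;> simp; ring
  have e2 : ((Complex.I, 2 * Complex.I * s.re * Complex.I) : ℂ × ℂ)
      = (Complex.I, 0) + (-2 * s.re) • (0, 1) := by
    ext <;> simp; linear_combination 2 * (s.re : ℂ) * Complex.I_sq
  simp only [dbarTwisted, dbar₁, dbar₂_comp_heisenberg s hf hζ, fderiv_comp_heisenberg s hf hζ,
    Function.comp_apply, zero_add, mul_one, e1, e2, map_add, map_smul]
  have e3 : (heisenberg s ζ).1 = ζ.1 + s.re := rfl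
  simp only [dbar₂, e3, Complex.real_smul]
  push_cast
  linear_combination (s.re * fderiv ℝ f (heisenberg s ζ) (0, Complex.I)) * Complex.I_sq

theorem iterate_dbar₂_comp_heisenberg (s : ℂ) {f : ℂ × ℂ → ℂ}
    (hf : ContDiffOn ℝ ∞ f siegelDomain) (k : ℕ) :
    EqOn (dbar₂^[k] (f ∘ heisenberg s)) (dbar₂^[k] f ∘ heisenberg s) siegelDomain := by
  induction k with
  | zero => exact fun _ _ => rfl
  | succ k ih =>
    rw [Function.iterate_succ_apply', Function.iterate_succ_apply']
    exact (isLinearLocal_dbar₂.congr _ _ ih).trans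
      (dbar₂_comp_heisenberg s ((isLinearLocal_dbar₂.iterate k).smooth f hf))

theorem IsPolyanalytic.comp_heisenberg {n : ℕ} {f : ℂ × ℂ → ℂ} (hf : IsPolyanalytic 1 n f)
    (s : ℂ) : IsPolyanalytic 1 n (f ∘ heisenberg s) where
  smooth := contDiffOn_comp_heisenberg s hf.smooth
  eq₁ ζ hζ := (dbarTwisted_comp_heisenberg s hf.smooth hζ).trans
    (hf.eq₁ _ ((heisenberg_mem_iff s ζ).2 hζ))
  eq₂ ζ hζ := (iterate_dbar₂_comp_heisenberg s hf.smooth n hζ).trans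
    (hf.eq₂ _ ((heisenberg_mem_iff s ζ).2 hζ))

theorem compMeasurePreserving_heisenberg_mem {n : ℕ} (s : ℂ) {f : L2Siegel}
    (hf : f ∈ polyBergman 1 n) :
    Lp.compMeasurePreservingₗᵢ ℂ _ (measurePreserving_heisenberg s) f ∈ polyBergman 1 n := by
  refine map_mem_closure (LinearIsometry.continuous _) hf fun g hg => ?_
  obtain ⟨F, hF, hgF⟩ := hg
  exact ⟨_, hF.comp_heisenberg s, (Lp.coeFn_compMeasurePreserving g _).trans
    ((measurePreserving_heisenberg s).quasiMeasurePreserving.ae_eq_comp hgF)⟩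

instance : SFinite ((volume : Measure ℝ).prod ((volume : Measure ℝ).restrict (Ioi 0))) :=
  inferInstance

/-- The unitary change of coordinates followed by the Fourier transform in `(x, p)`. -/
noncomputable def siegelFourier : L2Siegel →ₗᵢ[ℂ] Lp ℂ 2 coordMeasure :=
  (partialFourierL2 ℂ ((volume : Measure ℝ).prod ((volume : Measure ℝ).restrict (Ioi 0)))).comp
    (Lp.compMeasurePreservingₗᵢ ℂ _ measurePreserving_siegelCoord)

theorem siegelFourier_toLp {f : ℂ × ℂ → ℂ} (h1 : Integrable f siegelMeasure)
    (h2 : MemLp f 2 siegelMeasure) :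
    siegelFourier (h2.toLp f) =ᵐ[coordMeasure] partialFourier (f ∘ siegelCoord) :=
  partialFourierL2_toLp (measurePreserving_siegelCoord.integrable_comp_of_integrable h1)
    (h2.comp_measurePreserving measurePreserving_siegelCoord)

theorem siegelFourier_heisenberg (s : ℂ) (f : L2Siegel) :
    siegelFourier (Lp.compMeasurePreservingₗᵢ ℂ _ (measurePreserving_heisenberg s) f)
      =ᵐ[coordMeasure] fun p => (Real.fourierChar (inner ℝ s p.1) : ℂ) * siegelFourier f p := by
  have h := partialFourierL2_shiftFst (ρ := (volume : Measure ℝ).prod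
    ((volume : Measure ℝ).restrict (Ioi 0))) s
    (Lp.compMeasurePreservingₗᵢ ℂ _ measurePreserving_siegelCoord f)
  refine EventuallyEq.trans (.of_eq ?_) h
  refine congrArg (fun g => (partialFourierL2 ℂ ((volume : Measure ℝ).prod
    ((volume : Measure ℝ).restrict (Ioi 0))) g : ℂ × (ℝ × ℝ) → ℂ)) (Lp.ext ?_)
  have a1 := Lp.coeFn_compMeasurePreserving (Lp.compMeasurePreservingₗᵢ ℂ _
    (measurePreserving_heisenberg s) f) measurePreserving_siegelCoord
  have a2 := measurePreserving_siegelCoord.quasiMeasurePreserving.ae_eq_comp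
    (Lp.coeFn_compMeasurePreserving f (measurePreserving_heisenberg s))
  have hs : MeasurePreserving (shiftFst (ℝ × ℝ) s) coordMeasure coordMeasure :=
    measurePreserving_shiftFst s
  have a3 := Lp.coeFn_compMeasurePreserving (Lp.compMeasurePreservingₗᵢ ℂ _
    measurePreserving_siegelCoord f) hs
  have a4 := hs.quasiMeasurePreserving.ae_eq_comp
    (Lp.coeFn_compMeasurePreserving f measurePreserving_siegelCoord)
  refine (a1.trans a2).trans (EventuallyEq.trans (.of_eq ?_) (a3.trans a4).symm)
  ext p
  simp [heisenberg_siegelCoord]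

/-- The factor `a(y)` does not involve the variables `(x, p)` in which the transform is taken. -/
theorem siegelFourier_mulOperator (c : Lp ℂ ∞ siegelMeasure) (a : ℝ → ℂ)
    (hc : c =ᵐ[siegelMeasure] fun ζ => a ζ.1.im) (f : L2Siegel) :
    siegelFourier (mulOperator c f) =ᵐ[coordMeasure] fun p => a p.2.1 * siegelFourier f p := by
  have hΨ := measurePreserving_siegelCoord
  let c' : Lp ℂ ∞ coordMeasure := Lp.compMeasurePreserving _ hΨ c
  have hc' : c' =ᵐ[coordMeasure] fun p => a p.2.1 :=
    (Lp.coeFn_compMeasurePreserving c hΨ).trans (hΨ.quasiMeasurePreserving.ae_eq_comp hc)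
  have h := partialFourierL2_mulL2 (ρ := (volume : Measure ℝ).prod
    ((volume : Measure ℝ).restrict (Ioi 0))) c' (fun w => a w.1) hc'
    (Lp.compMeasurePreservingₗᵢ ℂ _ hΨ f)
  have e : Lp.compMeasurePreservingₗᵢ ℂ _ hΨ (mulOperator c f) =
      mulL2 c' (Lp.compMeasurePreservingₗᵢ ℂ _ hΨ f) := by
    refine Lp.ext ?_
    have a1 := Lp.coeFn_compMeasurePreserving (mulOperator c f) hΨ
    have a2 := hΨ.quasiMeasurePreserving.ae_eq_comp (coeFn_mulL2 c f)
    filter_upwards [a1, a2, coeFn_mulL2 c' (Lp.compMeasurePreservingₗᵢ ℂ _ hΨ f),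
      Lp.coeFn_compMeasurePreserving c hΨ, Lp.coeFn_compMeasurePreserving f hΨ] with p h1 h2 h3 h4 h5
    refine h1.trans (h2.trans ?_)
    rw [h3, h4]
    exact congrArg _ h5.symm
  have h' : siegelFourier (mulOperator c f) = mulL2 c' (siegelFourier f) :=
    (congrArg (partialFourierL2 ℂ _) e).trans h
  rw [h']
  filter_upwards [coeFn_mulL2 c' (siegelFourier f), hc'] with p h1 h2
  rw [h1, h2]

end Coordinates

/-! ### The first differential equation in tube coordinates. -/

section TubeEquation

open Complex

/-- The operator `∂ₓ + i ∂_y + 4 y ∂_p` on functions of `(x + i p, y)`. -/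
noncomputable def tubeOp (φ : ℂ × ℝ → ℂ) (z : ℂ × ℝ) : ℂ :=
  fderiv ℝ φ z (1, 0) + I * fderiv ℝ φ z (0, 1) + 4 * z.2 * fderiv ℝ φ z (I, 0)

theorem tubeOp_mul {f g : ℂ × ℝ → ℂ} {z : ℂ × ℝ} (hf : DifferentiableAt ℝ f z)
    (hg : DifferentiableAt ℝ g z) :
    tubeOp (fun z => f z * g z) z = f z * tubeOp g z + g z * tubeOp f z := by
  simp only [tubeOp]
  rw [fderiv_fun_mul hf hg]
  simp only [add_apply, smul_apply, smul_eq_mul]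
  ring

instance : (volume : Measure (ℂ × ℝ)).IsAddHaarMeasure :=
  Measure.prod.instIsAddHaarMeasure _ _

/-- Integration by parts in each direction. The coefficient `4y` is constant along `∂_p`, so
`tubeOp` is minus its own transpose, with no zeroth-order term. -/
theorem integral_mul_tubeOp {f g : ℂ × ℝ → ℂ} (hf : ContDiff ℝ 1 f) (hg : ContDiff ℝ 1 g)
    (hc : HasCompactSupport g) : ∫ z, f z * tubeOp g z = -∫ z, tubeOp f z * g z := by
  have hfd : ∀ v, Continuous fun z => fderiv ℝ f z v := fun v =>
    (hf.continuous_fderiv one_ne_zero).clm_apply continuous_const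
  have hgd : ∀ v, Continuous fun z => fderiv ℝ g z v := fun v =>
    (hg.continuous_fderiv one_ne_zero).clm_apply continuous_const
  have hgc : ∀ v, HasCompactSupport fun z => fderiv ℝ g z v := fun v => hc.fderiv_apply (𝕜 := ℝ) v
  have hz : Continuous fun z : ℂ × ℝ => (4 * z.2 : ℂ) := by fun_prop
  have i1 : ∀ v, Integrable fun z => fderiv ℝ f z v * g z := fun v =>
    ((hfd v).mul hg.continuous).integrable_of_hasCompactSupport hc.mul_left
  have i2 : ∀ v, Integrable fun z => f z * fderiv ℝ g z v := fun v =>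
    (hf.continuous.mul (hgd v)).integrable_of_hasCompactSupport (hgc v).mul_left
  have i3 : Integrable fun z => f z * g z :=
    (hf.continuous.mul hg.continuous).integrable_of_hasCompactSupport hc.mul_left
  have ibp : ∀ v, ∫ z, f z * fderiv ℝ g z v = -∫ z, fderiv ℝ f z v * g z := fun v =>
    integral_mul_fderiv_eq_neg_fderiv_mul_of_integrable (i1 v) (i2 v) i3
      (fun z _ => hf.contDiffAt.differentiableAt one_ne_zero)
      (fun z _ => hg.contDiffAt.differentiableAt one_ne_zero)
  have hz1 : ContDiff ℝ 1 fun z : ℂ × ℝ => (4 * z.2 : ℂ) := by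
    have : ContDiff ℝ 1 fun z : ℂ × ℝ => (z.2 : ℂ) :=
      Complex.ofRealCLM.contDiff.comp contDiff_snd
    fun_prop
  have hd : ∀ z : ℂ × ℝ, fderiv ℝ (fun z : ℂ × ℝ => (4 * z.2 : ℂ)) z (I, 0) = 0 := by
    intro z
    have : HasFDerivAt (fun z : ℂ × ℝ => (4 * z.2 : ℂ))
        ((4 : ℂ) • (Complex.ofRealCLM.comp (ContinuousLinearMap.snd ℝ ℂ ℝ))) z :=
      (Complex.ofRealCLM.comp (ContinuousLinearMap.snd ℝ ℂ ℝ)).hasFDerivAt.const_mul (4 : ℂ)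
    rw [this.fderiv]; simp
  have hg4 : ∀ z, fderiv ℝ (fun z : ℂ × ℝ => (4 * z.2 : ℂ) * g z) z (I, 0)
      = 4 * z.2 * fderiv ℝ g z (I, 0) := by
    intro z
    rw [fderiv_fun_mul (hz1.contDiffAt.differentiableAt one_ne_zero)
      (hg.contDiffAt.differentiableAt one_ne_zero)]
    simp only [add_apply, smul_apply, smul_eq_mul, hd, mul_zero, add_zero]
  have j1 : Integrable fun z : ℂ × ℝ => fderiv ℝ f z (I, 0) * ((4 * z.2 : ℂ) * g z) :=
    ((hfd _).mul (hz.mul hg.continuous)).integrable_of_hasCompactSupport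
      (HasCompactSupport.mul_left (HasCompactSupport.mul_left hc))
  have j2 : Integrable fun z : ℂ × ℝ => f z * (4 * z.2 * fderiv ℝ g z (I, 0)) :=
    (hf.continuous.mul (hz.mul (hgd _))).integrable_of_hasCompactSupport
      (HasCompactSupport.mul_left (HasCompactSupport.mul_left (hgc _)))
  have ibp4 : ∫ z : ℂ × ℝ, f z * (4 * z.2 * fderiv ℝ g z (I, 0))
      = -∫ z : ℂ × ℝ, fderiv ℝ f z (I, 0) * ((4 * z.2 : ℂ) * g z) := by
    have := integral_mul_fderiv_eq_neg_fderiv_mul_of_integrable (μ := volume) (𝕜 := ℂ)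
      (f := f) (g := fun z : ℂ × ℝ => (4 * z.2 : ℂ) * g z) (v := (I, 0)) j1
      (by simp only [hg4]; exact j2)
      ((hf.continuous.mul (hz.mul hg.continuous)).integrable_of_hasCompactSupport
        (HasCompactSupport.mul_left (HasCompactSupport.mul_left hc)))
      (fun z _ => hf.contDiffAt.differentiableAt one_ne_zero)
      (fun z _ => (hz1.mul hg).contDiffAt.differentiableAt one_ne_zero)
    simpa only [hg4] using this
  have e1 : ∀ z, f z * tubeOp g z = (f z * fderiv ℝ g z (1, 0) + I * (f z * fderiv ℝ g z (0, 1)))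
      + f z * (4 * z.2 * fderiv ℝ g z (I, 0)) := fun z => by rw [tubeOp]; ring
  have e2 : ∀ z, tubeOp f z * g z = (fderiv ℝ f z (1, 0) * g z + I * (fderiv ℝ f z (0, 1) * g z))
      + fderiv ℝ f z (I, 0) * ((4 * z.2 : ℂ) * g z) := fun z => by rw [tubeOp]; ring
  simp only [e1, e2]
  have k : ∀ u₁ u₂ u₃ : ℂ × ℝ → ℂ, Integrable u₁ → Integrable u₂ → Integrable u₃ →
      ∫ z, (u₁ z + I * u₂ z) + u₃ z = (∫ z, u₁ z) + I * (∫ z, u₂ z) + ∫ z, u₃ z := by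
    intro u₁ u₂ u₃ h₁ h₂ h₃
    rw [← integral_const_mul, ← integral_add h₁ (h₂.const_mul I)]
    exact integral_add (h₁.add (h₂.const_mul I)) h₃
  rw [k _ _ _ (i2 _) (i2 _) j2, k _ _ _ (i1 _) (i1 _) j1, ibp, ibp, ibp4]
  ring

/-- A Gaussian in `(x, p)`, holomorphically shifted so that it solves the tube equation. -/
noncomputable def shiftedGaussian (z : ℂ × ℝ) : ℂ :=
  cexp (-Real.pi * ((z.1.re + I * z.2) ^ 2 + (z.1.im + 2 * I * z.2 ^ 2) ^ 2))

theorem hasFDerivAt_re_add (z : ℂ × ℝ) : HasFDerivAt (fun z : ℂ × ℝ => (z.1.re + I * z.2 : ℂ))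
    (ofRealCLM.comp (reCLM.comp (ContinuousLinearMap.fst ℝ ℂ ℝ)) +
      I • ofRealCLM.comp (ContinuousLinearMap.snd ℝ ℂ ℝ)) z :=
  (ofRealCLM.comp (reCLM.comp (ContinuousLinearMap.fst ℝ ℂ ℝ))).hasFDerivAt.add
    ((ofRealCLM.comp (ContinuousLinearMap.snd ℝ ℂ ℝ)).hasFDerivAt.const_mul I)

theorem hasFDerivAt_im_add (z : ℂ × ℝ) :
    HasFDerivAt (fun z : ℂ × ℝ => (z.1.im + 2 * I * z.2 ^ 2 : ℂ))
    (ofRealCLM.comp (imCLM.comp (ContinuousLinearMap.fst ℝ ℂ ℝ)) +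
      (2 * I) • ((2 * z.2 : ℂ) • ofRealCLM.comp (ContinuousLinearMap.snd ℝ ℂ ℝ))) z := by
  refine (ofRealCLM.comp (imCLM.comp (ContinuousLinearMap.fst ℝ ℂ ℝ))).hasFDerivAt.add
    (HasFDerivAt.const_mul ?_ (2 * I))
  have := ((ofRealCLM.comp (ContinuousLinearMap.snd ℝ ℂ ℝ)).hasFDerivAt (x := z)).pow 2
  simpa using this

theorem contDiff_shiftedGaussian : ContDiff ℝ 1 shiftedGaussian := by
  have h1 : ContDiff ℝ 1 fun z : ℂ × ℝ => (z.1.re : ℂ) :=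
    (ofRealCLM.comp (reCLM.comp (ContinuousLinearMap.fst ℝ ℂ ℝ))).contDiff
  have h2 : ContDiff ℝ 1 fun z : ℂ × ℝ => (z.1.im : ℂ) :=
    (ofRealCLM.comp (imCLM.comp (ContinuousLinearMap.fst ℝ ℂ ℝ))).contDiff
  have h3 : ContDiff ℝ 1 fun z : ℂ × ℝ => (z.2 : ℂ) :=
    (ofRealCLM.comp (ContinuousLinearMap.snd ℝ ℂ ℝ)).contDiff
  unfold shiftedGaussian
  fun_prop

/-- Both `x + iy` and `p + 2iy²` are annihilated by `∂ₓ + i∂_y + 4y∂_p`, hence so is any holomorphic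
function of them. -/
theorem tubeOp_shiftedGaussian (z : ℂ × ℝ) : tubeOp shiftedGaussian z = 0 := by
  have h := (((hasFDerivAt_re_add z).pow 2).add ((hasFDerivAt_im_add z).pow 2)).const_mul
    (-Real.pi : ℂ) |>.cexp
  have h' : fderiv ℝ shiftedGaussian z = _ := h.fderiv
  rw [tubeOp, h']
  simp
  ring_nf
  simp
  ring_nf

/-- The coordinates on the slice with fixed `v`. -/
noncomputable def sliceCoord (v : ℝ) (z : ℂ × ℝ) : ℂ × ℂ := siegelCoord (z.1, (z.2, v))

theorem hasFDerivAt_sliceCoord (v : ℝ) (z : ℂ × ℝ) :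
    ∃ L : ℂ × ℝ →L[ℝ] ℂ × ℂ, HasFDerivAt (sliceCoord v) L z ∧
      L (1, 0) = (1, -2 * z.2 + 2 * I * z.1.re) ∧ L (0, 1) = (I, -2 * z.1.re + 2 * I * z.2) ∧
      L (I, 0) = (0, 1) := by
  have e : sliceCoord v = fun z : ℂ × ℝ => ((z.1.re + I * z.2 : ℂ),
      ((z.1.im - 2 * (z.1.re * z.2) : ℝ) : ℂ) + I * ((v + z.1.re ^ 2 + z.2 ^ 2 : ℝ) : ℂ)) := by
    ext z : 1
    apply Prod.ext <;> apply Complex.ext <;> simp [sliceCoord, siegelCoord, pow_two] ; ring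
  have hx := (reCLM.comp (ContinuousLinearMap.fst ℝ ℂ ℝ)).hasFDerivAt (x := z)
  have hp := (imCLM.comp (ContinuousLinearMap.fst ℝ ℂ ℝ)).hasFDerivAt (x := z)
  have hy := (ContinuousLinearMap.snd ℝ ℂ ℝ).hasFDerivAt (x := z)
  have h1 := ofRealCLM.hasFDerivAt.comp z (hp.sub ((hx.mul hy).const_mul 2))
  have h2 := ofRealCLM.hasFDerivAt.comp z (((hx.pow 2).const_add v).add (hy.pow 2))
  have hL := (hasFDerivAt_re_add z).prodMk (h1.add (h2.const_mul I))
  refine ⟨_, hL.congr_of_eventuallyEq (.of_eq e), ?_⟩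
  simp
  refine ⟨by ring, by ring⟩

theorem contDiff_sliceCoord (v : ℝ) : ContDiff ℝ ∞ (sliceCoord v) := by
  have e : sliceCoord v = fun z : ℂ × ℝ => ((z.1.re + I * z.2 : ℂ),
      ((z.1.im - 2 * (z.1.re * z.2) : ℝ) : ℂ) + I * ((v + z.1.re ^ 2 + z.2 ^ 2 : ℝ) : ℂ)) := by
    ext z : 1
    apply Prod.ext <;> apply Complex.ext <;> simp [sliceCoord, siegelCoord, pow_two] ; ring
  rw [e]
  have h1 : ContDiff ℝ ∞ fun z : ℂ × ℝ => z.1.re :=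
    (reCLM.comp (ContinuousLinearMap.fst ℝ ℂ ℝ)).contDiff
  have h2 : ContDiff ℝ ∞ fun z : ℂ × ℝ => z.1.im :=
    (imCLM.comp (ContinuousLinearMap.fst ℝ ℂ ℝ)).contDiff
  have h3 : ContDiff ℝ ∞ fun z : ℂ × ℝ => z.2 := contDiff_snd
  have h4 : ∀ g : ℂ × ℝ → ℝ, ContDiff ℝ ∞ g → ContDiff ℝ ∞ fun z => (g z : ℂ) :=
    fun g hg => ofRealCLM.contDiff.comp hg
  exact ((h4 _ h1).add (contDiff_const.mul (h4 _ h3))).prodMk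
    ((h4 _ (by fun_prop)).add (contDiff_const.mul (h4 _ (by fun_prop))))

theorem sliceCoord_mem {v : ℝ} (hv : 0 < v) (z : ℂ × ℝ) : sliceCoord v z ∈ siegelDomain :=
  (siegelCoord_mem_iff _).2 hv

/-- By the chain rule `tubeOp` is twice `dbarTwisted` read on the slice; `v` is only a parameter. -/
theorem tubeOp_comp_sliceCoord {n : ℕ} {F : ℂ × ℂ → ℂ} (hF : IsPolyanalytic 1 n F) {v : ℝ}
    (hv : 0 < v) (z : ℂ × ℝ) : tubeOp (F ∘ sliceCoord v) z = 0 := by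
  obtain ⟨L, hL, h1, h2, h3⟩ := hasFDerivAt_sliceCoord v z
  have hm := sliceCoord_mem hv z
  have hd := (differentiableAt_siegel hF.smooth hm).hasFDerivAt.comp z hL
  have ht := hF.eq₁ _ hm
  have e0 : (sliceCoord v z).1 = z.1.re + I * z.2 := by
    apply Complex.ext <;> simp [sliceCoord, siegelCoord]
  simp only [Function.iterate_one, dbarTwisted, dbar₁, dbar₂, e0] at ht
  rw [tubeOp, hd.fderiv]
  simp only [ContinuousLinearMap.comp_apply, h1, h2, h3]
  set D := fderiv ℝ F (sliceCoord v z)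
  have d1 : D (1, -2 * z.2 + 2 * I * z.1.re) =
      D (1, 0) + (-2 * z.2) * D (0, 1) + (2 * z.1.re) * D (0, I) := by
    have : ((1, -2 * z.2 + 2 * I * z.1.re) : ℂ × ℂ) =
        (1, 0) + (-2 * z.2 : ℝ) • (0, 1) + (2 * z.1.re : ℝ) • (0, I) := by
      ext <;> simp; ring
    rw [this, map_add, map_add, map_smul, map_smul, real_smul, real_smul]; push_cast; rfl
  have d2 : D (I, -2 * z.1.re + 2 * I * z.2) =
      D (I, 0) + (-2 * z.1.re) * D (0, 1) + (2 * z.2) * D (0, I) := by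
    have : ((I, -2 * z.1.re + 2 * I * z.2) : ℂ × ℂ) =
        (I, 0) + (-2 * z.1.re : ℝ) • (0, 1) + (2 * z.2 : ℝ) • (0, I) := by
      ext <;> simp; ring
    rw [this, map_add, map_add, map_smul, map_smul, real_smul, real_smul]; push_cast; rfl
  rw [d1, d2]
  linear_combination 2 * ht + (2 * z.1.re * D (0, I) + 2 * z.2 * I * D (0, I) + 2 * z.2 * D (0, 1)) * I_sq

end TubeEquation

/-! ### The tube equation tested against shifted Gaussians. -/

section WeakEquation

open Complex

theorem memLp_two_mul_prod {α β : Type*} [MeasurableSpace α] [MeasurableSpace β] {μ : Measure α}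
    {ν : Measure β} [SFinite μ] [SFinite ν] {f : α → ℂ} {g : β → ℂ} (hf : MemLp f 2 μ)
    (hg : MemLp g 2 ν) : MemLp (fun z : α × β => f z.1 * g z.2) 2 (μ.prod ν) := by
  refine (memLp_two_iff_integrable_sq_norm (hf.1.comp_fst.mul hg.1.comp_snd)).2 ?_
  have := ((memLp_two_iff_integrable_sq_norm hf.1).1 hf).mul_prod
    ((memLp_two_iff_integrable_sq_norm hg.1).1 hg)
  refine this.congr (.of_forall fun z => ?_)
  simp [mul_pow]

theorem norm_shiftedGaussian (z : ℂ × ℝ) : ‖shiftedGaussian z‖ =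
    Real.exp (-Real.pi * ‖z.1‖ ^ 2) * Real.exp (Real.pi * (z.2 ^ 2 + 4 * z.2 ^ 4)) := by
  rw [shiftedGaussian, norm_exp, ← Real.exp_add, ← normSq_eq_norm_sq, normSq_apply]
  congr 1
  simp [pow_two]
  ring

theorem memLp_gaussian : MemLp (fun q : ℂ => ((Real.exp (-Real.pi * ‖q‖ ^ 2) : ℝ) : ℂ)) 2 := by
  rw [memLp_two_iff_integrable_sq_norm (by fun_prop)]
  have := (GaussianFourier.integrable_cexp_neg_mul_sq_norm_add (V := ℂ) (b := 2 * Real.pi)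
    (by simp [Real.pi_pos]) 0 0).norm
  refine this.congr (.of_forall fun q => ?_)
  simp only [norm_real, Real.norm_eq_abs, Real.abs_exp, ← Real.exp_nat_mul, norm_exp]
  congr 1
  simp [← ofReal_pow]
  ring

theorem memLp_gaussian_mul {g : ℝ → ℝ} (hg : Continuous g) (hc : HasCompactSupport g) :
    MemLp (fun z : ℂ × ℝ => Real.exp (-Real.pi * ‖z.1‖ ^ 2) * g z.2) 2 := by
  have h1 : MemLp (fun y => (g y : ℂ)) 2 :=
    (continuous_ofReal.comp hg).memLp_of_hasCompactSupport (hc.comp_left ofReal_zero)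
  have := (memLp_two_mul_prod memLp_gaussian h1).norm
  refine (memLp_norm_iff ?_).1 (this.congr_norm ?_ ?_)
  · fun_prop
  · fun_prop
  · exact .of_forall fun z => by simp only [norm_norm, norm_mul, norm_real]

theorem tubeOp_fst {c : ℂ → ℝ} {z : ℂ × ℝ} (hc : DifferentiableAt ℝ c z.1) :
    tubeOp (fun z => (c z.1 : ℂ)) z = fderiv ℝ c z.1 1 + 4 * z.2 * fderiv ℝ c z.1 I := by
  have h := ofRealCLM.hasFDerivAt.comp z (hc.hasFDerivAt.comp z hasFDerivAt_fst)
  have h' : fderiv ℝ (fun z : ℂ × ℝ => (c z.1 : ℂ)) z = _ := h.fderiv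
  rw [tubeOp, h']
  simp

theorem tubeOp_snd {β : ℝ → ℝ} {z : ℂ × ℝ} (hβ : DifferentiableAt ℝ β z.2) :
    tubeOp (fun z => (β z.2 : ℂ)) z = I * deriv β z.2 := by
  have h := ofRealCLM.hasFDerivAt.comp z (hβ.hasFDerivAt.comp z hasFDerivAt_snd)
  have h' : fderiv ℝ (fun z : ℂ × ℝ => (β z.2 : ℂ)) z = _ := h.fderiv
  rw [tubeOp, h']
  simp

/-- Since the Gaussian solves the tube equation, `tubeOp` applied to Gaussian times `β(y)` is
`iβ'(y)` times the Gaussian. Integrating by parts against the solution `φ` then gives zero. The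
Gaussian is not compactly supported in `(x, p)`, so a cut-off is inserted and removed by dominated
convergence. -/
theorem integral_mul_shiftedGaussian {φ : ℂ × ℝ → ℂ} (hφ : ContDiff ℝ 1 φ)
    (h : ∀ z, tubeOp φ z = 0) (h2 : MemLp φ 2) {β : ℝ → ℝ} (hβ : ContDiff ℝ 1 β)
    (hβc : HasCompactSupport β) :
    ∫ z, φ z * (shiftedGaussian z * deriv β z.2) = 0 := by
  let c : ContDiffBump (0 : ℂ) := ⟨1, 2, one_pos, one_lt_two⟩
  have hcd : ContDiff ℝ 1 c := c.contDiff
  have hcc : HasCompactSupport c := c.hasCompactSupport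
  obtain ⟨C, hC⟩ := (hcc.fderiv (𝕜 := ℝ)).exists_bound_of_continuous
    (hcd.continuous_fderiv one_ne_zero)
  have hC0 : 0 ≤ C := (norm_nonneg _).trans (hC 0)
  -- Dilating the bump by `1/r k` makes its gradient `O(r k)`, so the terms that differentiate the
  -- cut-off vanish in the limit.
  let r : ℕ → ℝ := fun k => ((k : ℝ) + 1)⁻¹
  have hr0 : ∀ k, 0 < r k := fun k => by positivity
  have hr1 : ∀ k, r k ≤ 1 := fun k => inv_le_one_of_one_le₀ (by simp)
  have hr : Tendsto r atTop (𝓝 0) := tendsto_inv_atTop_zero.comp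
    (tendsto_atTop_add_const_right _ _ tendsto_natCast_atTop_atTop)
  let ck : ℕ → ℂ → ℝ := fun k q => c (r k • q)
  have hck : ∀ k, ContDiff ℝ 1 (ck k) := fun k => hcd.comp (contDiff_const_smul (r k))
  have hcks : ∀ k, HasCompactSupport (ck k) := fun k => hcc.comp_smul (hr0 k).ne'
  have hckd : ∀ k q w, fderiv ℝ (ck k) q w = r k * fderiv ℝ c (r k • q) w := by
    intro k q w
    have h1 : HasFDerivAt (fun q : ℂ => r k • q) (r k • ContinuousLinearMap.id ℝ ℂ) q :=
      (hasFDerivAt_id q).const_smul (r k)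
    have h2 := (hcd.contDiffAt.differentiableAt one_ne_zero (x := r k • q)).hasFDerivAt.comp q h1
    have h3 : fderiv ℝ (ck k) q = _ := h2.fderiv
    rw [h3]; simp
  have hckb : ∀ k q w, |fderiv ℝ (ck k) q w| ≤ r k * (C * ‖w‖) := by
    intro k q w
    rw [hckd, abs_mul, abs_of_pos (hr0 k)]
    exact mul_le_mul_of_nonneg_left (((fderiv ℝ c (r k • q)).le_opNorm w).trans
      (mul_le_mul_of_nonneg_right (hC _) (norm_nonneg _))) (hr0 k).le
  have hβ' : ContDiff ℝ 1 fun z : ℂ × ℝ => (β z.2 : ℂ) :=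
    ofRealCLM.contDiff.comp (hβ.comp contDiff_snd)
  have hck' : ∀ k, ContDiff ℝ 1 fun z : ℂ × ℝ => (ck k z.1 : ℂ) := fun k =>
    ofRealCLM.contDiff.comp ((hck k).comp contDiff_fst)
  let X : ℕ → ℂ × ℝ → ℂ := fun k z => shiftedGaussian z * ((β z.2 : ℂ) * (ck k z.1 : ℂ))
  have hX : ∀ k, ContDiff ℝ 1 (X k) := fun k => contDiff_shiftedGaussian.mul (hβ'.mul (hck' k))
  have hXc : ∀ k, HasCompactSupport (X k) := by
    intro k
    refine HasCompactSupport.mul_left (HasCompactSupport.intro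
      ((hcks k).isCompact.prod hβc.isCompact) fun z hz => ?_)
    rw [mem_prod, not_and_or] at hz
    rcases hz with hz | hz
    · simp [image_eq_zero_of_notMem_tsupport hz]
    · simp [image_eq_zero_of_notMem_tsupport hz]
  have hXt : ∀ k z, tubeOp (X k) z = shiftedGaussian z * ((β z.2 : ℂ) *
      (fderiv ℝ (ck k) z.1 1 + 4 * z.2 * fderiv ℝ (ck k) z.1 I) +
        (ck k z.1 : ℂ) * (I * deriv β z.2)) := by
    intro k z
    have d1 : DifferentiableAt ℝ (fun z : ℂ × ℝ => (β z.2 : ℂ)) z :=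
      hβ'.contDiffAt.differentiableAt one_ne_zero
    have d2 : DifferentiableAt ℝ (fun z : ℂ × ℝ => (ck k z.1 : ℂ)) z :=
      (hck' k).contDiffAt.differentiableAt one_ne_zero
    have e := tubeOp_mul (contDiff_shiftedGaussian.contDiffAt.differentiableAt one_ne_zero
      (x := z)) (d1.fun_mul d2)
    rw [tubeOp_shiftedGaussian, mul_zero, add_zero, tubeOp_mul d1 d2,
      tubeOp_fst ((hck k).contDiffAt.differentiableAt one_ne_zero),
      tubeOp_snd (hβ.contDiffAt.differentiableAt one_ne_zero)] at e
    exact e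
  have hzero : ∀ k, ∫ z, φ z * tubeOp (X k) z = 0 := by
    intro k
    rw [integral_mul_tubeOp hφ (hX k) (hXc k)]
    simp [h]
  -- The modulus of the shifted Gaussian is `exp(-π|q|²)` times this growing exponential in `y`,
  -- which is harmless on the support of `β`. The majorant is therefore a product of two `L²`
  -- functions.
  let g : ℝ → ℝ := fun y => Real.exp (Real.pi * (y ^ 2 + 4 * y ^ 4)) *
    (|β y| * (C + 4 * |y| * C) + |deriv β y|)
  have hdβ : Continuous (deriv β) := hβ.continuous_deriv le_rfl
  have hg : Continuous g := by
    have := hβ.continuous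
    fun_prop
  have hgc : HasCompactSupport g :=
    HasCompactSupport.mul_left ((HasCompactSupport.mul_right (hβc.comp_left abs_zero)).add
      (hβc.deriv.comp_left abs_zero))
  have hcb : ∀ k q, |ck k q| ≤ 1 := fun k q => by
    rw [abs_of_nonneg c.nonneg]; exact c.le_one
  have hlim : Tendsto (fun k => ∫ z, φ z * tubeOp (X k) z) atTop
      (𝓝 (∫ z, φ z * (shiftedGaussian z * (I * deriv β z.2)))) := by
    refine tendsto_integral_of_dominated_convergence
      (fun z => ‖φ z‖ * ‖Real.exp (-Real.pi * ‖z.1‖ ^ 2) * g z.2‖) ?_ ?_ ?_ ?_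
    · intro k
      simp only [hXt]
      have c1 := fun w => ((hck k).continuous_fderiv one_ne_zero).clm_apply
        (continuous_const (y := w))
      have c0 := (hck k).continuous
      have cβ := hβ.continuous
      have cg := contDiff_shiftedGaussian.continuous
      refine hφ.continuous.aestronglyMeasurable.mul (Continuous.aestronglyMeasurable ?_)
      refine cg.mul (((continuous_ofReal.comp (cβ.comp continuous_snd)).mul ?_).add ?_)
      · exact (continuous_ofReal.comp ((c1 1).comp continuous_fst)).add
          ((by fun_prop : Continuous fun z : ℂ × ℝ => (4 * z.2 : ℂ)).mul
            (continuous_ofReal.comp ((c1 I).comp continuous_fst)))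
      · exact (continuous_ofReal.comp (c0.comp continuous_fst)).mul (continuous_const.mul
          (continuous_ofReal.comp (hdβ.comp continuous_snd)))
    · exact h2.norm.integrable_mul (memLp_gaussian_mul hg hgc).norm
    · intro k
      refine .of_forall fun z => ?_
      rw [norm_mul, hXt, norm_mul, norm_shiftedGaussian, Real.norm_of_nonneg (by positivity)]
      refine mul_le_mul_of_nonneg_left ?_ (norm_nonneg _)
      simp only [g]
      rw [mul_assoc (Real.exp _)]
      refine mul_le_mul_of_nonneg_left (mul_le_mul_of_nonneg_left ?_ (Real.exp_nonneg _))
        (Real.exp_nonneg _)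
      have b1 : ∀ w : ℂ, ‖w‖ = 1 → |fderiv ℝ (ck k) z.1 w| ≤ C := fun w hw => by
        refine (hckb k z.1 w).trans ?_
        rw [hw, mul_one]
        exact mul_le_of_le_one_left hC0 (hr1 k)
      refine (norm_add_le _ _).trans (add_le_add ?_ ?_)
      · rw [norm_mul, norm_real, Real.norm_eq_abs]
        refine mul_le_mul_of_nonneg_left ((norm_add_le _ _).trans (add_le_add ?_ ?_))
          (abs_nonneg _)
        · rw [norm_real]; exact b1 1 (by simp)
        · rw [norm_mul, norm_mul, norm_real, norm_real, Complex.norm_ofNat]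
          exact mul_le_mul_of_nonneg_left (b1 I (by simp)) (by positivity)
      · rw [norm_mul, norm_mul, norm_real, norm_real, norm_I, one_mul]
        exact mul_le_of_le_one_left (abs_nonneg _) (hcb k _)
    · refine .of_forall fun z => ?_
      simp only [hXt]
      refine Tendsto.const_mul _ (Tendsto.const_mul _ ?_)
      have t1 : ∀ w, Tendsto (fun k => fderiv ℝ (ck k) z.1 w) atTop (𝓝 0) := fun w => by
        refine squeeze_zero_norm (fun k => hckb k z.1 w) ?_
        simpa using hr.mul_const (C * ‖w‖)
      have t1' : ∀ w, Tendsto (fun k => (fderiv ℝ (ck k) z.1 w : ℂ)) atTop (𝓝 0) := fun w => by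
        have := (continuous_ofReal.tendsto 0).comp (t1 w)
        rwa [ofReal_zero] at this
      have t2 : Tendsto (fun k => (ck k z.1 : ℂ)) atTop (𝓝 1) := by
        have : Tendsto (fun k => ck k z.1) atTop (𝓝 (c ((0 : ℝ) • z.1))) :=
          (hcd.continuous.tendsto _).comp (hr.smul_const z.1)
        rw [zero_smul, c.one_of_mem_closedBall (by simp [c])] at this
        have := (continuous_ofReal.tendsto 1).comp this
        rwa [ofReal_one] at this
      simpa using (((t1' 1).add ((t1' I).const_mul (4 * z.2 : ℂ))).const_mul (β z.2 : ℂ)).add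
        (t2.mul_const (I * deriv β z.2))
  simp only [hzero] at hlim
  have h0 := tendsto_nhds_unique hlim tendsto_const_nhds
  have e : ∀ z : ℂ × ℝ, φ z * (shiftedGaussian z * (I * deriv β z.2)) =
      I * (φ z * (shiftedGaussian z * deriv β z.2)) := fun z => by ring
  simp only [e, integral_const_mul] at h0
  exact (mul_eq_zero.1 h0).resolve_left I_ne_zero

end WeakEquation

/-! ### The weak equation after the partial Fourier transform. -/

section WeakFourierEquation

open Complex

theorem conj_shiftedGaussian (z : ℂ × ℝ) : starRingEnd ℂ (shiftedGaussian z) =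
    cexp (Real.pi * (z.2 ^ 2 + 4 * z.2 ^ 4)) *
      cexp (-Real.pi * ‖z.1‖ ^ 2 + 2 * Real.pi * I * (inner ℝ (⟨z.2, 2 * z.2 ^ 2⟩ : ℂ) z.1 : ℝ)) := by
  have h : (‖z.1‖ ^ 2 : ℂ) = z.1.re ^ 2 + z.1.im ^ 2 := by
    rw [← ofReal_pow, ← normSq_eq_norm_sq, normSq_apply]; push_cast; ring
  have h2 : (inner ℝ (⟨z.2, 2 * z.2 ^ 2⟩ : ℂ) z.1 : ℝ) = z.2 * z.1.re + 2 * z.2 ^ 2 * z.1.im := by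
    simp [Complex.inner]; ring
  rw [shiftedGaussian, ← exp_conj, ← Complex.exp_add, h, h2]
  congr 1
  have h3 : starRingEnd ℂ 2 = 2 := conj_ofNat 2
  simp only [map_mul, map_neg, map_add, map_pow, conj_ofReal, conj_I, h3]
  push_cast
  linear_combination (-Real.pi * (z.2 ^ 2 + 4 * z.2 ^ 4)) * I_sq

/-- The conjugate is `exp(π|w|²)` times a Gaussian modulated with frequency `w = y + 2iy²`. Its
transform is a Gaussian centred at `w`, and `π|w|² - π|w - κ|² = 2π⟨w, κ⟩ - π|κ|²`. The term `2π⟨w,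
κ⟩` is the exponent that the later structure theorem has to cancel. -/
theorem fourier_conj_shiftedGaussian (y : ℝ) (κ : ℂ) :
    ∫ q : ℂ, (Real.fourierChar (-inner ℝ q κ) : ℂ) * starRingEnd ℂ (shiftedGaussian (q, y)) =
      Real.exp (2 * Real.pi * (y * κ.re + 2 * y ^ 2 * κ.im) - Real.pi * ‖κ‖ ^ 2) := by
  have h := fourier_gaussian_innerProductSpace' (V := ℂ) (b := Real.pi) (by simp [Real.pi_pos])
    (⟨y, 2 * y ^ 2⟩ : ℂ) κ
  rw [Real.fourier_eq] at h
  have e : ∀ q : ℂ, (Real.fourierChar (-inner ℝ q κ) : ℂ) * starRingEnd ℂ (shiftedGaussian (q, y))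
      = cexp (Real.pi * (y ^ 2 + 4 * y ^ 4)) * (Real.fourierChar (-inner ℝ q κ) •
        cexp (-Real.pi * ‖q‖ ^ 2 + 2 * Real.pi * I * (inner ℝ (⟨y, 2 * y ^ 2⟩ : ℂ) q : ℝ))) := by
    intro q
    rw [conj_shiftedGaussian, Circle.smul_def, smul_eq_mul]
    ring
  simp only [e]
  rw [integral_const_mul, h, div_self (by exact_mod_cast Real.pi_ne_zero), one_cpow, one_mul,
    ← Complex.exp_add, ofReal_exp]
  congr 1
  have h1 : ((‖(⟨y, 2 * y ^ 2⟩ : ℂ) - κ‖ : ℂ) ^ 2) = (y - κ.re) ^ 2 + (2 * y ^ 2 - κ.im) ^ 2 := by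
    rw [← ofReal_pow, ← normSq_eq_norm_sq, normSq_apply]; simp; ring
  have h2 : ((‖κ‖ : ℂ) ^ 2) = κ.re ^ 2 + κ.im ^ 2 := by
    rw [← ofReal_pow, ← normSq_eq_norm_sq, normSq_apply]; push_cast; ring
  rw [h1]
  push_cast
  rw [h2]
  have : (Real.pi : ℂ) ≠ 0 := by exact_mod_cast Real.pi_ne_zero
  field_simp
  ring

/-- The test functions for the tube equation. -/
noncomputable def tubeTest (b wt : ℝ → ℝ) (p : ℂ × (ℝ × ℝ)) : ℂ :=
  starRingEnd ℂ (shiftedGaussian (p.1, p.2.1)) * ((b p.2.1 : ℂ) * wt p.2.2)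

/-- The Fourier transforms of the test functions for the tube equation. -/
noncomputable def tubeTestFourier (b wt : ℝ → ℝ) (p : ℂ × (ℝ × ℝ)) : ℂ :=
  (Real.exp (2 * Real.pi * (p.2.1 * p.1.re + 2 * p.2.1 ^ 2 * p.1.im) - Real.pi * ‖p.1‖ ^ 2) : ℝ) *
    ((b p.2.1 : ℂ) * wt p.2.2)

theorem partialFourier_tubeTest (b wt : ℝ → ℝ) :
    partialFourier (tubeTest b wt) = tubeTestFourier b wt := by
  ext p
  rw [partialFourier_eq, tubeTestFourier, ← fourier_conj_shiftedGaussian, ← integral_mul_const]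
  simp only [tubeTest, mul_assoc]

theorem aestronglyMeasurable_tubeTest {b : ℝ → ℝ} (hb : Continuous b) {wt : ℝ → ℝ}
    (hwt : Measurable wt) : AEStronglyMeasurable (tubeTest b wt) coordMeasure := by
  have h1 : Measurable fun p : ℂ × (ℝ × ℝ) => starRingEnd ℂ (shiftedGaussian (p.1, p.2.1)) := by
    have := contDiff_shiftedGaussian.continuous
    exact Continuous.measurable (by fun_prop)
  have h2 : Measurable fun p : ℂ × (ℝ × ℝ) => (b p.2.1 : ℂ) := Continuous.measurable (by fun_prop)
  have h3 : Measurable fun p : ℂ × (ℝ × ℝ) => (wt p.2.2 : ℂ) :=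
    measurable_ofReal.comp (hwt.comp (measurable_snd.comp measurable_snd))
  exact (h1.mul (h2.mul h3)).aestronglyMeasurable

theorem norm_tubeTest (b wt : ℝ → ℝ) (p : ℂ × (ℝ × ℝ)) : ‖tubeTest b wt p‖ =
    ‖((Real.exp (-Real.pi * ‖p.1‖ ^ 2) : ℝ) : ℂ) *
      (((Real.exp (Real.pi * (p.2.1 ^ 2 + 4 * p.2.1 ^ 4)) * b p.2.1 : ℝ) : ℂ) *
        wt p.2.2)‖ := by
  rw [tubeTest, norm_mul, RCLike.norm_conj, norm_shiftedGaussian]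
  simp only [norm_mul, norm_real, Real.norm_eq_abs, Real.abs_exp]
  ring

theorem memLp_tubeTest {b : ℝ → ℝ} (hb : Continuous b) (hc : HasCompactSupport b)
    {wt : ℝ → ℝ} (hwt : Measurable wt) (hwt2 : MemLp wt 2 (volume.restrict (Ioi 0))) :
    MemLp (tubeTest b wt) 2 coordMeasure := by
  have h2 : MemLp (fun y => ((Real.exp (Real.pi * (y ^ 2 + 4 * y ^ 4)) * b y : ℝ) : ℂ)) 2 := by
    refine Continuous.memLp_of_hasCompactSupport (by fun_prop) ?_
    exact (HasCompactSupport.mul_left hc).comp_left ofReal_zero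
  have h3 : MemLp (fun v => (wt v : ℂ)) 2 ((volume : Measure ℝ).restrict (Ioi 0)) := hwt2.ofReal
  have := memLp_two_mul_prod memLp_gaussian (memLp_two_mul_prod h2 h3)
  exact this.congr_norm (aestronglyMeasurable_tubeTest hb hwt)
    (.of_forall fun p => (norm_tubeTest b wt p).symm)

theorem integrable_tubeTest {b : ℝ → ℝ} (hb : Continuous b) (hc : HasCompactSupport b)
    {wt : ℝ → ℝ} (hwt : Measurable wt) (hwt1 : Integrable wt (volume.restrict (Ioi 0))) :
    Integrable (tubeTest b wt) coordMeasure := by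
  have h1 : Integrable (fun q : ℂ => ((Real.exp (-Real.pi * ‖q‖ ^ 2) : ℝ) : ℂ)) := by
    have := (GaussianFourier.integrable_cexp_neg_mul_sq_norm_add (V := ℂ) (b := Real.pi)
      (by simp [Real.pi_pos]) 0 0)
    refine this.congr (.of_forall fun q => ?_)
    simp
  have h2 : Integrable (fun y => ((Real.exp (Real.pi * (y ^ 2 + 4 * y ^ 4)) * b y : ℝ) : ℂ)) := by
    refine Continuous.integrable_of_hasCompactSupport (by fun_prop) ?_
    exact (HasCompactSupport.mul_left hc).comp_left ofReal_zero
  have h3 : Integrable (fun v => (wt v : ℂ)) ((volume : Measure ℝ).restrict (Ioi 0)) := hwt1.ofReal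
  have := h1.mul_prod (h2.mul_prod h3)
  exact this.congr' (aestronglyMeasurable_tubeTest hb hwt)
    (.of_forall fun p => (norm_tubeTest b wt p).symm)

/-- Fubini in `v`: on almost every slice `F` is square-integrable, and the inner integral vanishes
by `integral_mul_shiftedGaussian`. -/
theorem integral_tubeTest_mul {n : ℕ} {F : ℂ × ℂ → ℂ} (hF : IsPolyanalytic 1 n F)
    (hF2 : MemLp F 2 siegelMeasure) {β : ℝ → ℝ} (hβ : ContDiff ℝ 1 β) (hβc : HasCompactSupport β)
    {wt : ℝ → ℝ} (hwt : Measurable wt) (hwt2 : MemLp wt 2 (volume.restrict (Ioi 0))) :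
    ∫ p, starRingEnd ℂ (tubeTest (deriv β) wt p) * F (siegelCoord p) ∂coordMeasure = 0 := by
  have hΦ : MemLp (F ∘ siegelCoord) 2 coordMeasure :=
    hF2.comp_measurePreserving measurePreserving_siegelCoord
  have hmp := measurePreserving_prodAssoc (volume : Measure ℂ) (volume : Measure ℝ)
    ((volume : Measure ℝ).restrict (Ioi 0))
  have hχ := memLp_tubeTest (hβ.continuous_deriv le_rfl) hβc.deriv hwt hwt2
  have hint : Integrable (fun p => starRingEnd ℂ (tubeTest (deriv β) wt p) * F (siegelCoord p))
      coordMeasure := hχ.star.integrable_mul hΦ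
  rw [coordMeasure, ← hmp.integral_comp' (f := MeasurableEquiv.prodAssoc)]
  have hint' := hmp.integrable_comp_of_integrable hint
  refine (integral_prod_symm _ hint').trans ?_
  have hΦ' := ae_memLp_two_slice (hΦ.comp_measurePreserving hmp)
  rw [← integral_zero ℝ ℂ (μ := (volume : Measure ℝ).restrict (Ioi 0))]
  refine integral_congr_ae ?_
  filter_upwards [hΦ', ae_restrict_mem measurableSet_Ioi] with v h2 hv
  have key := integral_mul_shiftedGaussian (φ := F ∘ sliceCoord v)
    ((hF.smooth.comp_contDiff (contDiff_sliceCoord v) (sliceCoord_mem hv)).of_le (by simp))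
    (tubeOp_comp_sliceCoord hF hv) h2 hβ hβc
  have e : ∀ z : ℂ × ℝ, starRingEnd ℂ (tubeTest (deriv β) wt (z.1, (z.2, v))) *
      F (siegelCoord (z.1, (z.2, v))) = (wt v : ℂ) *
        ((F ∘ sliceCoord v) z * (shiftedGaussian z * deriv β z.2)) := by
    intro z
    rw [tubeTest, map_mul, map_mul, conj_conj, conj_ofReal, conj_ofReal]
    simp only [Function.comp_apply, sliceCoord]
    ring
  refine (integral_congr_ae (.of_forall e)).trans ?_
  rw [integral_const_mul]
  exact mul_eq_zero_of_right _ key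

/-- Plancherel turns the weak equation into a statement about `siegelFourier f`. The transformed
test function is real, so no conjugate appears. -/
theorem integral_tubeTestFourier_mul {n : ℕ} {f : L2Siegel} (hf : f ∈ polyBergman 1 n)
    {β : ℝ → ℝ} (hβ : ContDiff ℝ 1 β) (hβc : HasCompactSupport β)
    {wt : ℝ → ℝ} (hwt : Measurable wt) (hwt1 : Integrable wt (volume.restrict (Ioi 0)))
    (hwt2 : MemLp wt 2 (volume.restrict (Ioi 0))) :
    ∫ p, tubeTestFourier (deriv β) wt p * siegelFourier f p ∂coordMeasure = 0 := by
  have h1 := integrable_tubeTest (hβ.continuous_deriv le_rfl) hβc.deriv hwt hwt1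
  have h2 := memLp_tubeTest (hβ.continuous_deriv le_rfl) hβc.deriv hwt hwt2
  have hW := partialFourierL2_toLp h1 h2
  rw [partialFourier_tubeTest] at hW
  let T : Lp ℂ 2 coordMeasure := h2.toLp _
  let Φ : L2Siegel →ₗᵢ[ℂ] Lp ℂ 2 coordMeasure :=
    Lp.compMeasurePreservingₗᵢ ℂ _ measurePreserving_siegelCoord
  have e1 : ∀ g : L2Siegel, ∫ p, tubeTestFourier (deriv β) wt p * siegelFourier g p ∂coordMeasure =
      inner ℂ T (Φ g) := by
    intro g
    refine Eq.trans ?_ ((partialFourierL2 ℂ ((volume : Measure ℝ).prod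
      ((volume : Measure ℝ).restrict (Ioi 0)))).inner_map_map T (Φ g))
    rw [L2.inner_def]
    refine integral_congr_ae ?_
    filter_upwards [hW] with p hp
    have hp' : (partialFourierL2 ℂ ((volume : Measure ℝ).prod
      ((volume : Measure ℝ).restrict (Ioi 0)))) T p = tubeTestFourier (deriv β) wt p := hp
    rw [hp', RCLike.inner_apply, mul_comm]
    have : starRingEnd ℂ (tubeTestFourier (deriv β) wt p) = tubeTestFourier (deriv β) wt p := by
      rw [tubeTestFourier, map_mul, map_mul, conj_ofReal, conj_ofReal, conj_ofReal]
    rw [this]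
    rfl
  rw [e1]
  -- Being orthogonal to a fixed vector is a closed condition, so it passes from smooth solutions to
  -- the closure without interior estimates.
  have hcl : IsClosed {g : L2Siegel | inner ℂ T (Φ g) = 0} :=
    isClosed_eq (continuous_const.inner Φ.continuous) continuous_const
  refine hcl.closure_subset_iff.2 (fun g hg => ?_) hf
  obtain ⟨F, hF, hgF⟩ := hg
  have hF2 : MemLp F 2 siegelMeasure := (Lp.memLp g).ae_eq hgF
  change inner ℂ T (Φ g) = 0
  rw [L2.inner_def, ← integral_tubeTest_mul hF hF2 hβ hβc hwt hwt2]
  refine integral_congr_ae ?_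
  filter_upwards [h2.coeFn_toLp, Lp.coeFn_compMeasurePreserving g measurePreserving_siegelCoord,
    measurePreserving_siegelCoord.quasiMeasurePreserving.ae_eq_comp hgF] with p a1 a2 a3
  rw [RCLike.inner_apply, mul_comm]
  have a2' : Φ g p = F (siegelCoord p) := a2.trans a3
  rw [a2', show T p = _ from a1]

end WeakFourierEquation

/-! ### Rectangles, Fourier uniqueness and du Bois-Reymond. -/

section Uniqueness

open FourierTransform RealInnerProductSpace SchwartzMap

/-- An integrable function on a product whose integrals over all rectangles vanish is zero. -/
theorem ae_eq_zero_of_forall_setIntegral_prod {α β : Type*} [MeasurableSpace α]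
    [MeasurableSpace β] {μ : Measure α} {ν : Measure β} [SFinite μ] [SFinite ν] {K : α × β → ℂ}
    (hK : Integrable K (μ.prod ν))
    (h : ∀ S T, MeasurableSet S → MeasurableSet T → ∫ z in S ×ˢ T, K z ∂(μ.prod ν) = 0) :
    K =ᵐ[μ.prod ν] 0 := by
  have h0 : ∫ z, K z ∂(μ.prod ν) = 0 := by
    have := h univ univ .univ .univ
    rwa [univ_prod_univ, setIntegral_univ] at this
  refine hK.ae_eq_zero_of_forall_setIntegral_eq_zero fun U hU _ => ?_
  refine MeasurableSpace.induction_on_inter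
    (C := fun U _ => ∫ z in U, K z ∂(μ.prod ν) = 0) generateFrom_prod.symm isPiSystem_prod
    ?_ ?_ ?_ ?_ U hU
  · simp
  · rintro _ ⟨S, hS, T, hT, rfl⟩
    exact h S T hS hT
  · intro T hT hT0
    rw [setIntegral_compl hT hK, h0, hT0, sub_zero]
  · intro T hd hT hT0
    rw [integral_iUnion hT hd hK.integrableOn]
    simp [hT0]

/-- Injectivity of the Fourier transform on `L¹`. -/
theorem ae_eq_zero_of_fourier_eq_zero {E : Type*} [NormedAddCommGroup E] [InnerProductSpace ℝ E]
    [FiniteDimensional ℝ E] [MeasurableSpace E] [BorelSpace E] {h : E → ℂ} (hi : Integrable h)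
    (h0 : ∀ s : E, ∫ κ, (Real.fourierChar (inner ℝ s κ) : ℂ) * h κ = 0) : h =ᵐ[volume] 0 := by
  have hF : ∀ s : E, 𝓕 h s = 0 := by
    intro s
    rw [Real.fourier_eq, ← h0 (-s)]
    refine integral_congr_ae (.of_forall fun κ => ?_)
    simp only [inner_neg_left, real_inner_comm s κ]
    rfl
  refine ae_eq_zero_of_integral_contDiff_smul_eq_zero hi.locallyIntegrable fun g hg hgc => ?_
  have hgc' : HasCompactSupport (Complex.ofRealCLM ∘ g) := hgc.comp_left rfl
  let G : 𝓢(E, ℂ) := hgc'.toSchwartzMap (Complex.ofRealCLM.contDiff.comp hg)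
  -- Writing the test function as a Fourier transform lets the transform be moved onto `h`, where it
  -- is zero.
  have hG : ∀ x, (g x : ℂ) = 𝓕 ((𝓕⁻ G : 𝓢(E, ℂ)) : E → ℂ) x := by
    intro x
    rw [← SchwartzMap.fourier_coe, FourierTransform.fourier_fourierInv_eq]
    rfl
  have := VectorFourier.integral_fourierIntegral_smul_eq_flip (μ := volume) (ν := volume)
    (L := innerₗ E) Real.continuous_fourierChar continuous_inner (𝓕⁻ G : 𝓢(E, ℂ)).integrable hi
  rw [flip_innerₗ] at this
  simp only [Complex.real_smul, hG]
  refine this.trans ?_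
  refine (integral_congr_ae (.of_forall fun x => ?_)).trans (integral_zero _ _)
  have e : VectorFourier.fourierIntegral Real.fourierChar volume (innerₗ E) h x = 0 := hF x
  simp only [e, smul_zero]

/-- A smooth compactly supported function with integral zero has a compactly supported
primitive. -/
theorem exists_primitive_of_integral_eq_zero {b : ℝ → ℝ} (hb : Continuous b)
    (hc : HasCompactSupport b) (h0 : ∫ y, b y = 0) :
    ∃ β : ℝ → ℝ, ContDiff ℝ 1 β ∧ HasCompactSupport β ∧ deriv β = b := by
  obtain ⟨M, hM⟩ := hc.isCompact.isBounded.subset_closedBall 0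
  have hz : ∀ y, M < |y| → b y = 0 := fun y hy => by
    refine image_eq_zero_of_notMem_tsupport fun h => ?_
    have := hM h
    rw [mem_closedBall_zero_iff, Real.norm_eq_abs] at this
    linarith
  have hi : Integrable b := hb.integrable_of_hasCompactSupport hc
  have hd : ∀ y, HasDerivAt (fun y => ∫ t in Iic y, b t) (b y) y := by
    intro y
    have e : (fun y => ∫ t in Iic y, b t) = fun y => (∫ t in Iic 0, b t) + ∫ t in (0)..y, b t := by
      ext y
      rw [intervalIntegral.integral_Iic_sub_Iic hi.integrableOn hi.integrableOn |>.symm]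
      ring
    rw [e]
    exact (hb.integral_hasStrictDerivAt 0 y).hasDerivAt.const_add _
  have hde : deriv (fun y => ∫ t in Iic y, b t) = b := funext fun y => (hd y).deriv
  refine ⟨fun y => ∫ t in Iic y, b t, ?_, ?_, hde⟩
  · rw [contDiff_one_iff_deriv, hde]
    exact ⟨fun y => (hd y).differentiableAt, hb⟩
  · refine HasCompactSupport.intro (isCompact_closedBall (0 : ℝ) M) fun y hy => ?_
    rw [mem_closedBall_zero_iff, Real.norm_eq_abs, not_le] at hy
    rcases le_total 0 y with h | h
    · rw [abs_of_nonneg h] at hy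
      rw [setIntegral_eq_integral_of_forall_compl_eq_zero, h0]
      intro t ht
      rw [mem_Iic, not_le] at ht
      exact hz t (by rw [abs_of_nonneg (by linarith)]; linarith)
    · rw [abs_of_nonpos h] at hy
      refine setIntegral_eq_zero_of_forall_eq_zero fun t ht => ?_
      rw [mem_Iic] at ht
      exact hz t (by rw [abs_of_nonpos (by linarith)]; linarith)

/-- The lemma of du Bois-Reymond with a parameter. -/
theorem exists_ae_eq_of_integral_deriv_eq_zero {α : Type*} [MeasurableSpace α] {μ : Measure α}
    [SFinite μ] {H : α × ℝ → ℂ}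
    (hi : ∀ b : ℝ → ℝ, Continuous b → HasCompactSupport b →
      Integrable (fun z => H z * b z.2) (μ.prod volume))
    (h : ∀ β : ℝ → ℝ, ContDiff ℝ 1 β → HasCompactSupport β →
      ∀ᵐ x ∂μ, ∫ y, H (x, y) * deriv β y = 0) :
    ∃ C : α → ℂ, AEStronglyMeasurable C μ ∧ ∀ᵐ z ∂(μ.prod volume), H z = C z.1 := by
  let ρ₀ : ContDiffBump (0 : ℝ) := ⟨1, 2, one_pos, one_lt_two⟩
  let ρ : ℝ → ℝ := ρ₀.normed volume
  have hρ1 : ∫ y, ρ y = 1 := ρ₀.integral_normed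
  have hρc : Continuous ρ := ρ₀.continuous_normed
  have hρs : HasCompactSupport ρ := ρ₀.hasCompactSupport_normed
  have hρi : Integrable ρ := hρc.integrable_of_hasCompactSupport hρs
  let C : α → ℂ := fun x => ∫ y, H (x, y) * ρ y
  have hCi : Integrable C μ := (hi ρ hρc hρs).integral_prod_left
  have hC : ∀ g : ℝ → ℝ, Continuous g → HasCompactSupport g →
      ∀ᵐ x ∂μ, ∫ y, H (x, y) * g y = (∫ y, (g y : ℂ)) * C x := by
    intro g hg hgc
    have hgi : Integrable g := hg.integrable_of_hasCompactSupport hgc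
    -- Subtracting `(∫ g) ρ` makes the integral zero, so the difference is an admissible derivative.
    obtain ⟨β, h1, h2, h3⟩ := exists_primitive_of_integral_eq_zero
      (b := fun y => g y - (∫ t, g t) * ρ y) (by fun_prop)
      (hgc.sub (HasCompactSupport.mul_left hρs))
      (by rw [integral_sub hgi (hρi.const_mul _), integral_const_mul, hρ1]; ring)
    filter_upwards [h β h1 h2, (hi g hg hgc).prod_right_ae, (hi ρ hρc hρs).prod_right_ae]
      with x hx i1 i2
    rw [h3] at hx
    have e : ∀ y, H (x, y) * ((g y - (∫ t, g t) * ρ y : ℝ) : ℂ) =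
        H (x, y) * g y - (∫ t, (g t : ℂ)) * (H (x, y) * ρ y) := by
      intro y
      rw [integral_complex_ofReal]
      push_cast
      ring
    simp only [e] at hx
    rw [integral_sub i1 (i2.const_mul _), integral_const_mul, sub_eq_zero] at hx
    exact hx
  refine ⟨C, hCi.1, ?_⟩
  -- On a bounded window of `y` both sides are integrable on the product, so they can be compared on
  -- rectangles.
  have hN : ∀ N : ℕ, ∀ᵐ z ∂(μ.prod volume), z.2 ∈ Icc (-N : ℝ) N → H z = C z.1 := by
    intro N
    have hIm : MeasurableSet (Icc (-N : ℝ) N) := measurableSet_Icc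
    let c : ContDiffBump (0 : ℝ) := ⟨N + 1, N + 2, by positivity, by linarith⟩
    have hc1 : ∀ y ∈ Icc (-N : ℝ) N, c y = 1 := fun y hy => by
      refine c.one_of_mem_closedBall ?_
      rw [mem_closedBall_zero_iff, Real.norm_eq_abs]
      exact (abs_le.2 ⟨hy.1, hy.2⟩).trans (by simp [c])
    have hHi : Integrable (fun z : α × ℝ => (univ ×ˢ Icc (-N : ℝ) N).indicator H z)
        (μ.prod volume) := by
      have := (hi c c.continuous c.hasCompactSupport).indicator (MeasurableSet.univ.prod hIm)
      refine this.congr (.of_forall fun z => ?_)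
      by_cases hz : z ∈ univ ×ˢ Icc (-N : ℝ) N
      · simp only [indicator_of_mem hz, hc1 z.2 hz.2, Complex.ofReal_one, mul_one]
      · simp only [indicator_of_notMem hz]
    have hCi' : Integrable (fun z : α × ℝ => (univ ×ˢ Icc (-N : ℝ) N).indicator
        (fun z => C z.1) z) (μ.prod volume) := by
      have h1 : Integrable (fun y : ℝ => (Icc (-N : ℝ) N).indicator (fun _ => (1 : ℂ)) y) :=
        (integrable_indicator_iff hIm).2 (integrableOn_const (by simp))
      refine (hCi.mul_prod h1).congr (.of_forall fun z => ?_)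
      by_cases hz : z.2 ∈ Icc (-N : ℝ) N
      · simp [indicator, hz]
      · simp [indicator, hz]
    -- The exceptional null set in `hC` depends on `g`. Integrating over `x ∈ S` first removes it,
    -- and then `g` may vary.
    have hsl : ∀ S, MeasurableSet S → ∀ᵐ y, y ∈ Icc (-N : ℝ) N → ∫ x in S, H (x, y) ∂μ =
        ∫ x in S, C x ∂μ := by
      intro S hS
      have hli : LocallyIntegrable (fun y => ∫ x in S, H (x, y) ∂μ) := by
        rw [locallyIntegrable_iff]
        intro k hk
        obtain ⟨R, hR⟩ := hk.isBounded.subset_closedBall 0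
        let r : ContDiffBump (0 : ℝ) := ⟨|R| + 1, |R| + 2, by positivity, by linarith⟩
        have h1 := (hi r r.continuous r.hasCompactSupport).restrict (s := S ×ˢ univ)
        rw [← Measure.prod_restrict, Measure.restrict_univ] at h1
        refine h1.integral_prod_right.integrableOn.congr_fun (s := k) (fun y hy => ?_) hk.measurableSet
        have : r y = 1 := r.one_of_mem_closedBall (Metric.closedBall_subset_closedBall
          (by simp only [r]; linarith [le_abs_self R]) (hR hy))
        simp [this]
      have hconst : LocallyIntegrable (fun _ : ℝ => ∫ x in S, C x ∂μ) := locallyIntegrable_const _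
      refine (ae_eq_of_integral_contDiff_smul_eq hli hconst fun g hg hgc => ?_).mono
        fun y hy _ => hy
      have hg' := hg.continuous
      have h1 := (hi g hg' hgc).restrict (s := S ×ˢ univ)
      rw [← Measure.prod_restrict, Measure.restrict_univ] at h1
      have h2 := integral_integral_swap (f := fun x y => H (x, y) * g y) h1
      have e1 : ∫ y, g y • ∫ x in S, H (x, y) ∂μ = ∫ y, ∫ x in S, H (x, y) * g y ∂μ := by
        refine integral_congr_ae (.of_forall fun y => ?_)
        simp only [integral_mul_const]
        rw [Complex.real_smul, mul_comm]
      rw [e1, ← h2]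
      have e2 : ∫ x in S, (∫ y, H (x, y) * g y) ∂μ = ∫ x in S, (∫ y, (g y : ℂ)) * C x ∂μ :=
        integral_congr_ae (ae_restrict_of_ae (hC g hg' hgc))
      rw [e2, integral_const_mul, integral_smul_const, integral_complex_ofReal, Complex.real_smul]
    have key := ae_eq_zero_of_forall_setIntegral_prod (hHi.sub hCi') fun S T hS hT => by
      have hd := (hHi.sub hCi').restrict (s := S ×ˢ T)
      rw [← Measure.prod_restrict] at hd ⊢
      refine (integral_prod_symm _ hd).trans ?_
      refine (integral_congr_ae (ae_restrict_of_ae ?_)).trans (integral_zero _ _)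
      have i1 := (hHi.restrict (s := S ×ˢ univ))
      rw [← Measure.prod_restrict, Measure.restrict_univ] at i1
      filter_upwards [hsl S hS, i1.prod_left_ae] with y hy i2
      by_cases hyN : y ∈ Icc (-N : ℝ) N
      · have hm : ∀ x, (x, y) ∈ (univ : Set α) ×ˢ Icc (-N : ℝ) N := fun x => ⟨mem_univ _, hyN⟩
        have e : ∀ x, (univ ×ˢ Icc (-N : ℝ) N).indicator H (x, y) = H (x, y) := fun x =>
          indicator_of_mem (hm x) _
        have e' : ∀ x, (univ ×ˢ Icc (-N : ℝ) N).indicator (fun z : α × ℝ => C z.1) (x, y) = C x :=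
          fun x => indicator_of_mem (hm x) _
        simp only [Pi.sub_apply, e, e'] at i2 ⊢
        rw [integral_sub i2 hCi.restrict, hy hyN, sub_self]
      · have hnot : ∀ x, (x, y) ∉ (univ : Set α) ×ˢ Icc (-N : ℝ) N := fun x hx => hyN hx.2
        simp [Pi.sub_apply, indicator_of_notMem (hnot _)]
    filter_upwards [key] with z hz hzN
    have hm : z ∈ (univ : Set α) ×ˢ Icc (-N : ℝ) N := ⟨mem_univ _, hzN⟩
    simp only [Pi.sub_apply, indicator_of_mem hm, Pi.zero_apply, sub_eq_zero] at hz
    exact hz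
  filter_upwards [ae_all_iff.2 hN] with z hz
  obtain ⟨N, hN'⟩ := exists_nat_ge |z.2|
  exact hz N ⟨(abs_le.1 hN').1, (abs_le.1 hN').2⟩

end Uniqueness

/-! ### The form of the transformed functions. -/

section Structure

/-- The measure on the parameters `(κ, v)`. -/
noncomputable def paramMeasure : Measure (ℂ × ℝ) :=
  (volume : Measure ℂ).prod ((volume : Measure ℝ).restrict (Ioi 0))

instance : SFinite paramMeasure := by unfold paramMeasure; infer_instance

instance : SFinite coordMeasure := by unfold coordMeasure; infer_instance

/-- The reordering `((κ, v), y) ↦ (κ, (y, v))`. -/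
noncomputable def reorder : (ℂ × ℝ) × ℝ ≃ᵐ ℂ × (ℝ × ℝ) :=
  MeasurableEquiv.prodAssoc.trans ((MeasurableEquiv.refl ℂ).prodCongr MeasurableEquiv.prodComm)

@[simp] theorem reorder_apply (z : (ℂ × ℝ) × ℝ) : reorder z = (z.1.1, (z.2, z.1.2)) := rfl

theorem measurePreserving_reorder :
    MeasurePreserving reorder (paramMeasure.prod volume) coordMeasure :=
  ((MeasurePreserving.id (volume : Measure ℂ)).prod (Measure.measurePreserving_swap
    (μ := (volume : Measure ℝ).restrict (Ioi 0)) (ν := (volume : Measure ℝ)))).comp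
    (measurePreserving_prodAssoc (volume : Measure ℂ) ((volume : Measure ℝ).restrict (Ioi 0))
      (volume : Measure ℝ))

/-- The exponent `2 π (η y + 2 ξ y²)`, for `κ = η + i ξ`. -/
noncomputable def tubePhase (κ : ℂ) (y : ℝ) : ℝ := 2 * Real.pi * (y * κ.re + 2 * y ^ 2 * κ.im)

theorem memLp_tubeTestFourier {b : ℝ → ℝ} (hb : Continuous b) (hc : HasCompactSupport b)
    {wt : ℝ → ℝ} (hwt : Measurable wt) (hwt1 : Integrable wt (volume.restrict (Ioi 0)))
    (hwt2 : MemLp wt 2 (volume.restrict (Ioi 0))) :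
    MemLp (tubeTestFourier b wt) 2 coordMeasure := by
  rw [← partialFourier_tubeTest]
  exact memLp_partialFourier (integrable_tubeTest hb hc hwt hwt1) (memLp_tubeTest hb hc hwt hwt2)

theorem integrable_tubeTestFourier_mul {b : ℝ → ℝ} (hb : Continuous b) (hc : HasCompactSupport b)
    {wt : ℝ → ℝ} (hwt : Measurable wt) (hwt1 : Integrable wt (volume.restrict (Ioi 0)))
    (hwt2 : MemLp wt 2 (volume.restrict (Ioi 0))) (F : Lp ℂ 2 coordMeasure) :
    Integrable (fun p => tubeTestFourier b wt p * F p) coordMeasure :=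
  (memLp_tubeTestFourier hb hc hwt hwt1 hwt2).integrable_mul (Lp.memLp F)

theorem memLp_exp_neg_two : MemLp (fun v => Real.exp (-v)) 2 (volume.restrict (Ioi 0)) := by
  rw [memLp_two_iff_integrable_sq (by fun_prop)]
  have := integrableOn_exp_mul_Ioi (a := -2) (by norm_num) 0
  refine this.congr (.of_forall fun v => ?_)
  simp only [← Real.exp_nat_mul]
  congr 1; push_cast; ring

theorem integrable_exp_neg : Integrable (fun v => Real.exp (-v)) (volume.restrict (Ioi 0)) :=
  exp_neg_integrableOn_Ioi 0 one_pos |>.congr (.of_forall fun v => by simp)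

/-- Applying the integrated identity to all Heisenberg translates of `f` inserts every character of
`κ`, so Fourier uniqueness localises it at almost every `κ`. Varying the weight in `v` localises it
in `v`. -/
theorem ae_integral_tube_eq_zero {n : ℕ} {f : L2Siegel} (hf : f ∈ polyBergman 1 n)
    {β : ℝ → ℝ} (hβ : ContDiff ℝ 1 β) (hβc : HasCompactSupport β) :
    ∀ᵐ x ∂paramMeasure, ∫ y, tubeTestFourier (deriv β) (fun v => Real.exp (-v)) (reorder (x, y)) *
      siegelFourier f (reorder (x, y)) = 0 := by
  have hb := hβ.continuous_deriv le_rfl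
  have hbc := hβc.deriv
  have hm : Measurable fun v : ℝ => Real.exp (-v) := by fun_prop
  have hi := integrable_tubeTestFourier_mul hb hbc hm integrable_exp_neg memLp_exp_neg_two
    (siegelFourier f)
  have hi' := measurePreserving_reorder.integrable_comp_of_integrable hi
  refine ae_eq_zero_of_forall_setIntegral_prod (μ := volume)
    (ν := (volume : Measure ℝ).restrict (Ioi 0)) hi'.integral_prod_left fun A B hA hB => ?_
  -- The factor `exp(-v)` only keeps the weight in `L¹ ∩ L²` of the half-line; the arbitrary set `B`
  -- gives the localisation in `v`.
  let wt : ℝ → ℝ := B.indicator fun v => Real.exp (-v)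
  have hwt : Measurable wt := hm.indicator hB
  have hwt1 : Integrable wt (volume.restrict (Ioi 0)) := integrable_exp_neg.indicator hB
  have hwt2 : MemLp wt 2 (volume.restrict (Ioi 0)) := memLp_exp_neg_two.indicator hB
  have hj := measurePreserving_reorder.integrable_comp_of_integrable
    (integrable_tubeTestFourier_mul hb hbc hwt hwt1 hwt2 (siegelFourier f))
  have hj1 := hj.integral_prod_left
  have hj2 := Integrable.integral_prod_left (μ := (volume : Measure ℂ))
    (ν := (volume : Measure ℝ).restrict (Ioi 0)) hj1
  have hzero := ae_eq_zero_of_fourier_eq_zero hj2 fun s => by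
    have h1 := integral_tubeTestFourier_mul (compMeasurePreserving_heisenberg_mem s hf) hβ hβc hwt
      hwt1 hwt2
    have hk : Integrable (fun p : ℂ × (ℝ × ℝ) => (Real.fourierChar (inner ℝ s p.1) : ℂ) *
        (tubeTestFourier (deriv β) wt p * siegelFourier f p)) coordMeasure := by
      refine (integrable_tubeTestFourier_mul hb hbc hwt hwt1 hwt2 (siegelFourier
        (Lp.compMeasurePreservingₗᵢ ℂ _ (measurePreserving_heisenberg s) f))).congr ?_
      filter_upwards [siegelFourier_heisenberg s f] with p hp
      rw [hp]; ring
    have h2 : ∫ p : ℂ × (ℝ × ℝ), (Real.fourierChar (inner ℝ s p.1) : ℂ) *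
        (tubeTestFourier (deriv β) wt p * siegelFourier f p) ∂coordMeasure = 0 := by
      rw [← h1]
      refine integral_congr_ae ?_
      filter_upwards [siegelFourier_heisenberg s f] with p hp
      rw [hp]; ring
    rw [← measurePreserving_reorder.integral_comp'] at h2
    have hk' := measurePreserving_reorder.integrable_comp_of_integrable hk
    have h3 := (integral_prod _ hk').symm.trans h2
    have h4 := (integral_prod (μ := (volume : Measure ℂ))
      (ν := (volume : Measure ℝ).restrict (Ioi 0)) _ hk'.integral_prod_left).symm.trans h3
    rw [← h4]
    refine integral_congr_ae (.of_forall fun κ => ?_)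
    simp only [Function.comp_apply, reorder_apply, ← integral_const_mul]
  have e : ∀ κ v, ∫ y, tubeTestFourier (deriv β) wt (reorder ((κ, v), y)) *
      siegelFourier f (reorder ((κ, v), y)) = B.indicator (fun v => ∫ y,
      tubeTestFourier (deriv β) (fun v => Real.exp (-v)) (reorder ((κ, v), y)) *
      siegelFourier f (reorder ((κ, v), y))) v := by
    intro κ v
    by_cases hv : v ∈ B
    · rw [indicator_of_mem hv]
      simp [tubeTestFourier, wt, hv]
    · rw [indicator_of_notMem hv]
      simp [tubeTestFourier, wt, hv]
  have hr := (Integrable.restrict (s := A ×ˢ B) hi'.integral_prod_left)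
  rw [paramMeasure, ← Measure.prod_restrict] at hr
  rw [← Measure.prod_restrict]
  refine (integral_prod _ hr).trans ?_
  refine (integral_congr_ae (ae_restrict_of_ae ?_)).trans (integral_zero _ _)
  filter_upwards [hzero] with κ hκ
  simp only [Function.comp_apply, Pi.zero_apply, e] at hκ ⊢
  rw [integral_indicator hB] at hκ
  exact hκ

/-- The transform multiplied by `exp(tubePhase)` has zero weak derivative in `y`, hence does not
depend on `y`. The factor `E` is the positive, `y`-independent part of the test function and is
divided out at the end. -/
theorem siegelFourier_structure {n : ℕ} {f : L2Siegel} (hf : f ∈ polyBergman 1 n) :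
    ∃ C : ℂ × ℝ → ℂ, AEStronglyMeasurable C paramMeasure ∧ ∀ᵐ z ∂(paramMeasure.prod volume),
      siegelFourier f (reorder z) = Real.exp (-tubePhase z.1.1 z.2) * C z.1 := by
  have hm : Measurable fun v : ℝ => Real.exp (-v) := by fun_prop
  let E : ℂ × ℝ → ℝ := fun x => Real.exp (-Real.pi * ‖x.1‖ ^ 2 - x.2)
  have e : ∀ (b : ℝ → ℝ) (z : (ℂ × ℝ) × ℝ), (Real.exp (tubePhase z.1.1 z.2) * E z.1 : ℂ) *
      siegelFourier f (reorder z) * b z.2 = tubeTestFourier b (fun v => Real.exp (-v)) (reorder z) *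
        siegelFourier f (reorder z) := by
    intro b z
    have : Real.exp (2 * Real.pi * (z.2 * z.1.1.re + 2 * z.2 ^ 2 * z.1.1.im) -
        Real.pi * ‖z.1.1‖ ^ 2) * Real.exp (-z.1.2) = Real.exp (tubePhase z.1.1 z.2) * E z.1 := by
      simp only [E, tubePhase, ← Real.exp_add]
      congr 1; ring
    have h' := congrArg (fun t : ℝ => (t : ℂ)) this
    simp only [Complex.ofReal_mul] at h'
    rw [← h', tubeTestFourier]
    simp only [reorder_apply]
    ring
  obtain ⟨C, hC, h⟩ := exists_ae_eq_of_integral_deriv_eq_zero (μ := paramMeasure)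
    (H := fun z => (Real.exp (tubePhase z.1.1 z.2) * E z.1 : ℂ) * siegelFourier f (reorder z))
    (fun b hb hbc => by
      simp only [e]
      exact measurePreserving_reorder.integrable_comp_of_integrable (integrable_tubeTestFourier_mul
        hb hbc hm integrable_exp_neg memLp_exp_neg_two (siegelFourier f)))
    (fun β hβ hβc => by
      filter_upwards [ae_integral_tube_eq_zero hf hβ hβc] with x hx
      rw [← hx]
      refine integral_congr_ae (.of_forall fun y => ?_)
      exact e (deriv β) (x, y))
  refine ⟨fun x => (E x : ℂ)⁻¹ * C x, ?_, ?_⟩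
  · refine AEStronglyMeasurable.mul (Continuous.aestronglyMeasurable ?_) hC
    refine (Complex.continuous_ofReal.comp (by fun_prop)).inv₀ fun x => ?_
    exact Complex.ofReal_ne_zero.2 (Real.exp_ne_zero _)
  · filter_upwards [h] with z hz
    have h1 : (E z.1 : ℂ) ≠ 0 := Complex.ofReal_ne_zero.2 (Real.exp_ne_zero _)
    rw [← hz, Real.exp_neg, Complex.ofReal_inv]
    have h2 : (Real.exp (tubePhase z.1.1 z.2) : ℂ) ≠ 0 :=
      Complex.ofReal_ne_zero.2 (Real.exp_ne_zero _)
    field_simp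

end Structure

/-! ### Gaussian averages of a symbol. -/

section SymbolAverage

open ProbabilityTheory ComplexConjugate

/-- The point `m + σ c` for the mean `m = -η / (4 ξ)` and the standard deviation
`σ = (16 π ξ)^{-1/2}` attached to `κ = η + i ξ`. -/
noncomputable def tubePoint (κ : ℂ) (c : ℝ) : ℝ :=
  -κ.re / (4 * κ.im) + (√(16 * Real.pi * κ.im))⁻¹ * c

theorem measurable_tubePoint : Measurable fun z : ℂ × ℝ => tubePoint z.1 z.2 := by
  unfold tubePoint
  fun_prop

/-- The average of `a` over the normal distribution with mean `-η / (4 ξ)` and variance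
`1 / (16 π ξ)`. -/
noncomputable def symbolAverage (a : ℝ → ℂ) (κ : ℂ) : ℂ :=
  ∫ c, a (tubePoint κ c) ∂gaussianReal 0 1

theorem measurable_symbolAverage {a : ℝ → ℂ} (ha : Measurable a) :
    Measurable (symbolAverage a) := by
  have : StronglyMeasurable fun z : ℂ × ℝ => a (tubePoint z.1 z.2) :=
    (ha.comp measurable_tubePoint).stronglyMeasurable
  exact this.integral_prod_right.measurable

theorem norm_symbolAverage_le {a : ℝ → ℂ} {B : ℝ} (hB : ∀ y, ‖a y‖ ≤ B) (κ : ℂ) :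
    ‖symbolAverage a κ‖ ≤ B := by
  refine (norm_integral_le_of_norm_le_const (.of_forall fun c => hB _)).trans_eq ?_
  simp

/-- Completing the square in `4π(ηy + 2ξy²)`: this fixes the mean and the variance used in
`tubePoint`. -/
theorem two_mul_tubePhase_tubePoint {κ : ℂ} (hκ : 0 < κ.im) (c : ℝ) :
    2 * tubePhase κ (tubePoint κ c) = c ^ 2 / 2 - Real.pi * κ.re ^ 2 / (2 * κ.im) := by
  have h : (√(16 * Real.pi * κ.im)) ^ 2 = 16 * Real.pi * κ.im := Real.sq_sqrt (by positivity)
  have h0 : √(16 * Real.pi * κ.im) ≠ 0 := by positivity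
  have h1 : κ.im ≠ 0 := hκ.ne'
  have h2 : ((√(16 * Real.pi * κ.im))⁻¹) ^ 2 = (16 * Real.pi * κ.im)⁻¹ := by rw [inv_pow, h]
  unfold tubePhase tubePoint
  generalize (√(16 * Real.pi * κ.im))⁻¹ = w at h2 ⊢
  have h3 : w ^ 2 * (16 * Real.pi * κ.im) = 1 := by
    rw [h2, inv_mul_cancel₀ (by positivity)]
  field_simp
  linear_combination (16 * κ.im * c ^ 2) * h3

theorem integral_mul_exp_tubePhase {κ : ℂ} (hκ : 0 < κ.im) (a : ℝ → ℂ) :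
    ∫ y, a y * (Real.exp (-(2 * tubePhase κ y)) : ℂ) =
      symbolAverage a κ * ∫ y, (Real.exp (-(2 * tubePhase κ y)) : ℂ) := by
  have hs : 0 < (√(16 * Real.pi * κ.im))⁻¹ := by positivity
  obtain ⟨K, hK⟩ : ∃ K : ℂ, ∀ a : ℝ → ℂ, ∫ y, a y * (Real.exp (-(2 * tubePhase κ y)) : ℂ) =
      K * symbolAverage a κ := by
    refine ⟨((√(16 * Real.pi * κ.im))⁻¹ * Real.exp (Real.pi * κ.re ^ 2 / (2 * κ.im)) *
      √(2 * Real.pi) : ℝ), fun a => ?_⟩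
    have h1 := Measure.integral_comp_mul_left (fun y => a (-κ.re / (4 * κ.im) + y) *
      (Real.exp (-(2 * tubePhase κ (-κ.re / (4 * κ.im) + y))) : ℂ)) (√(16 * Real.pi * κ.im))⁻¹
    rw [integral_add_left_eq_self (fun y => a y * (Real.exp (-(2 * tubePhase κ y)) : ℂ)),
      inv_inv, abs_of_pos (by positivity)] at h1
    have h2 : ∫ y, a y * (Real.exp (-(2 * tubePhase κ y)) : ℂ) = ((√(16 * Real.pi * κ.im))⁻¹ : ℝ) •
        ∫ c, a (tubePoint κ c) * (Real.exp (-(2 * tubePhase κ (tubePoint κ c))) : ℂ) := by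
      simp only [tubePoint]
      rw [h1, smul_smul, inv_mul_cancel₀ (by positivity), one_smul]
    rw [h2, symbolAverage, integral_gaussianReal_eq_integral_smul one_ne_zero,
      Complex.real_smul, ← integral_const_mul, ← integral_const_mul]
    refine integral_congr_ae (.of_forall fun c => ?_)
    simp only [two_mul_tubePhase_tubePoint hκ, gaussianPDFReal, Complex.real_smul]
    rw [neg_sub, sub_eq_add_neg, Real.exp_add]
    have : √(2 * Real.pi) ≠ 0 := by positivity
    have h3 : (√(2 * Real.pi) : ℂ) ≠ 0 := by exact_mod_cast this
    simp only [NNReal.coe_one, mul_one, sub_zero, Complex.ofReal_mul, Complex.ofReal_inv, neg_div]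
    field_simp
  -- The case `a = 1` identifies `K` with the total mass, which need not be evaluated.
  have h1 := hK 1
  have h2 : symbolAverage 1 κ = 1 := by simp [symbolAverage]
  simp only [Pi.one_apply, one_mul] at h1
  rw [hK a, h1, h2, mul_one, mul_comm]

end SymbolAverage

/-! ### The transforms live on `ξ > 0`. -/

section Support

/-- On the half-line where `yη ≤ 0` the phase is nonpositive, so the function is at least `c` on a
set of infinite measure. -/
theorem not_integrable_exp_tubePhase {κ : ℂ} (hκ : κ.im ≤ 0) {c : ℝ} (hc : 0 < c) :
    ¬ Integrable fun y => Real.exp (-(2 * tubePhase κ y)) * c := by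
  intro h
  have key : ∀ s : Set ℝ, MeasurableSet s → volume s = ⊤ → (∀ y ∈ s, y * κ.re ≤ 0) → False := by
    intro s hs hv hy
    have h1 : IntegrableOn (fun _ : ℝ => c) s := by
      refine Integrable.mono' (h.integrableOn (s := s)) aestronglyMeasurable_const ?_
      refine (ae_restrict_iff' hs).2 (.of_forall fun y hys => ?_)
      rw [Real.norm_of_nonneg hc.le]
      refine le_mul_of_one_le_left hc.le (Real.one_le_exp ?_)
      have : y * κ.re + 2 * y ^ 2 * κ.im ≤ 0 := by
        have := mul_nonpos_of_nonneg_of_nonpos (by positivity : 0 ≤ 2 * y ^ 2) hκ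
        linarith [hy y hys]
      unfold tubePhase
      have := mul_nonpos_of_nonneg_of_nonpos (by positivity : 0 ≤ 2 * Real.pi) this
      linarith
    rw [integrableOn_const_iff (by simp)] at h1
    rcases h1 with h1 | h1
    · exact hc.ne' (enorm_eq_zero.1 h1)
    · exact absurd hv h1.ne
  rcases le_total 0 κ.re with h0 | h0
  · exact key (Iio 0) measurableSet_Iio (by simp) fun y hy =>
      mul_nonpos_of_nonpos_of_nonneg (le_of_lt hy) h0
  · exact key (Ioi 0) measurableSet_Ioi (by simp) fun y hy =>
      mul_nonpos_of_nonneg_of_nonpos (le_of_lt hy) h0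

theorem siegelFourier_ae_eq_zero {n : ℕ} {f : L2Siegel} (hf : f ∈ polyBergman 1 n) :
    ∀ᵐ p ∂coordMeasure, p.1.im ≤ 0 → siegelFourier f p = 0 := by
  obtain ⟨C, hC, h⟩ := siegelFourier_structure hf
  have h1 : Integrable (fun z => ‖siegelFourier f (reorder z)‖ ^ 2) (paramMeasure.prod volume) :=
    measurePreserving_reorder.integrable_comp_of_integrable
      (memLp_two_iff_integrable_sq_norm (Lp.aestronglyMeasurable _)|>.1 (Lp.memLp (siegelFourier f)))
  have h2 : ∀ᵐ z ∂(paramMeasure.prod volume), z.1.1.im ≤ 0 → siegelFourier f (reorder z) = 0 := by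
    have h3 : ∀ᵐ x ∂paramMeasure, x.1.im ≤ 0 → C x = 0 := by
      filter_upwards [h1.prod_right_ae, Measure.ae_ae_of_ae_prod h] with x hx hx' h0
      by_contra hne
      refine not_integrable_exp_tubePhase h0 (c := ‖C x‖ ^ 2) (by positivity) (hx.congr ?_)
      filter_upwards [hx'] with y hy
      rw [hy, norm_mul, Complex.norm_real, Real.norm_of_nonneg (Real.exp_pos _).le, mul_pow,
        ← Real.exp_nat_mul]
      congr 2
      push_cast; ring
    filter_upwards [h, Measure.quasiMeasurePreserving_fst.ae h3] with z hz hz' h0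
    rw [hz, hz' h0, mul_zero]
  have := (measurePreserving_reorder.symm).quasiMeasurePreserving.ae h2
  filter_upwards [this] with p hp
  rw [reorder.apply_symm_apply] at hp
  exact hp

end Support

/-! ### Replacing `a(y)` by its average. -/

section SymbolIdentity

open ComplexConjugate

theorem integrable_siegelFourier_mul_conj (f g : L2Siegel) :
    Integrable (fun p => siegelFourier f p * conj (siegelFourier g p)) coordMeasure :=
  (Lp.memLp _).integrable_mul (Lp.memLp _).star

/-- At fixed `(κ, v)` with `ξ > 0` the product of the two transforms is the same Gaussian in `y`
times a constant, so integrating `a(y)` against it only sees the average. For `ξ ≤ 0` both sides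
vanish. -/
theorem integral_symbol_siegelFourier {n : ℕ} {f g : L2Siegel} (hf : f ∈ polyBergman 1 n)
    (hg : g ∈ polyBergman 1 n) {a : ℝ → ℂ} (ha : Measurable a) {B : ℝ} (hB : ∀ y, ‖a y‖ ≤ B) :
    ∫ p, a p.2.1 * (siegelFourier f p * conj (siegelFourier g p)) ∂coordMeasure =
      ∫ p, symbolAverage a p.1 * (siegelFourier f p * conj (siegelFourier g p)) ∂coordMeasure := by
  have hi := integrable_siegelFourier_mul_conj f g
  have h1 : Integrable (fun p : ℂ × (ℝ × ℝ) => a p.2.1 *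
      (siegelFourier f p * conj (siegelFourier g p))) coordMeasure :=
    hi.bdd_mul (ha.comp (by fun_prop : Measurable fun p : ℂ × (ℝ × ℝ) => p.2.1)).aestronglyMeasurable
      (.of_forall fun p => hB _)
  have h2 : Integrable (fun p : ℂ × (ℝ × ℝ) => symbolAverage a p.1 *
      (siegelFourier f p * conj (siegelFourier g p))) coordMeasure :=
    hi.bdd_mul ((measurable_symbolAverage ha).comp measurable_fst).aestronglyMeasurable
      (.of_forall fun p => norm_symbolAverage_le hB _)
  obtain ⟨C, -, hC⟩ := siegelFourier_structure hf
  obtain ⟨D, -, hD⟩ := siegelFourier_structure hg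
  have h0 := measurePreserving_reorder.quasiMeasurePreserving.ae (siegelFourier_ae_eq_zero hf)
  rw [← measurePreserving_reorder.integral_comp', ← measurePreserving_reorder.integral_comp']
  refine (integral_prod _ (measurePreserving_reorder.integrable_comp_of_integrable h1)).trans
    (Eq.trans ?_ (integral_prod _ (measurePreserving_reorder.integrable_comp_of_integrable h2)).symm)
  refine integral_congr_ae ?_
  filter_upwards [Measure.ae_ae_of_ae_prod hC, Measure.ae_ae_of_ae_prod hD,
    Measure.ae_ae_of_ae_prod h0] with x hx hx' h0
  rcases le_or_gt x.1.im 0 with hκ | hκ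
  · refine integral_congr_ae ?_
    filter_upwards [h0] with y hy
    have := hy hκ
    simp only [Function.comp_apply, this, zero_mul, mul_zero]
  · have e : ∀ b : ℝ → ℂ, ∫ y, b y * (siegelFourier f (reorder (x, y)) *
        conj (siegelFourier g (reorder (x, y)))) =
        (∫ y, b y * (Real.exp (-(2 * tubePhase x.1 y)) : ℂ)) * (C x * conj (D x)) := by
      intro b
      rw [← integral_mul_const]
      refine integral_congr_ae ?_
      filter_upwards [hx, hx'] with y hy hy'
      have : (Real.exp (-(2 * tubePhase x.1 y)) : ℂ) =
          Real.exp (-tubePhase x.1 y) * Real.exp (-tubePhase x.1 y) := by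
        rw [← Complex.ofReal_mul, ← Real.exp_add]; congr 2; ring
      rw [hy, hy', this, map_mul, Complex.conj_ofReal]
      ring
    have e1 := e a
    have e2 := e fun _ => symbolAverage a x.1
    rw [integral_mul_exp_tubePhase hκ] at e1
    rw [integral_const_mul _ (fun y => (Real.exp (-(2 * tubePhase x.1 y)) : ℂ))] at e2
    exact e1.trans e2.symm

end SymbolIdentity

/-! ### The image is a module over functions of `κ`. -/

section Module

open ComplexConjugate

/-- The image of `A²_{(1, n)}(D₂)` under the partial Fourier transform. -/
noncomputable def polyBergmanImage (n : ℕ) : Submodule ℂ (Lp ℂ 2 coordMeasure) :=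
  (polyBergman 1 n).map siegelFourier.toLinearMap

instance (n : ℕ) : CompleteSpace (polyBergmanImage n) :=
  siegelFourier.completeSpace_map (polyBergman 1 n)

theorem siegelFourier_mem_image {n : ℕ} {f : L2Siegel} (hf : f ∈ polyBergman 1 n) :
    siegelFourier f ∈ polyBergmanImage n := ⟨f, hf, rfl⟩

/-- `G` is orthogonal to all translates of `f`, so the Fourier integrals of `κ ↦ ∫ f̂ Ḡ dw` all
vanish, and so does this function. Multiplying it by `γ` changes nothing. -/
theorem integral_mul_fst_eq_zero {n : ℕ} {f : L2Siegel} (hf : f ∈ polyBergman 1 n)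
    {G : Lp ℂ 2 coordMeasure} (hG : G ∈ (polyBergmanImage n)ᗮ) {γ : ℂ → ℂ} (hγ : Measurable γ)
    {B : ℝ} (hB : ∀ κ, ‖γ κ‖ ≤ B) :
    ∫ p, γ p.1 * (siegelFourier f p * conj (G p)) ∂coordMeasure = 0 := by
  have hi : Integrable (fun p => siegelFourier f p * conj (G p)) coordMeasure :=
    (Lp.memLp _).integrable_mul (Lp.memLp _).star
  have fub : ∀ {c : ℂ → ℂ}, Measurable c → (∃ B : ℝ, ∀ κ, ‖c κ‖ ≤ B) →
      ∫ p, c p.1 * (siegelFourier f p * conj (G p)) ∂coordMeasure =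
        ∫ κ, c κ * ∫ w, siegelFourier f (κ, w) * conj (G (κ, w))
          ∂((volume : Measure ℝ).prod (volume.restrict (Ioi 0))) := by
    rintro c hc ⟨B, hB⟩
    have h1 : Integrable (fun p : ℂ × (ℝ × ℝ) => c p.1 * (siegelFourier f p * conj (G p)))
        coordMeasure :=
      hi.bdd_mul (hc.comp measurable_fst).aestronglyMeasurable (.of_forall fun p => hB _)
    refine (integral_prod _ h1).trans (integral_congr_ae (.of_forall fun κ => ?_))
    exact integral_const_mul (c κ) fun w => siegelFourier f (κ, w) * conj (G (κ, w))
  have hzero := ae_eq_zero_of_fourier_eq_zero (hi.integral_prod_left) fun s => by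
    have hm : Measurable fun κ : ℂ => (Real.fourierChar (inner ℝ s κ) : ℂ) := by fun_prop
    rw [← fub hm ⟨1, fun κ => (Circle.norm_coe _).le⟩]
    have h := (Submodule.mem_orthogonal _ _).1 hG _
      (siegelFourier_mem_image (compMeasurePreserving_heisenberg_mem s hf))
    rw [← inner_conj_symm, map_eq_zero_iff _ (RingHom.injective _), L2.inner_def] at h
    rw [← h]
    refine integral_congr_ae ?_
    filter_upwards [siegelFourier_heisenberg s f] with p hp
    rw [hp]
    simp only [RCLike.inner_apply]
    ring
  rw [fub hγ ⟨B, hB⟩, ← integral_zero ℂ ℂ]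
  refine integral_congr_ae ?_
  filter_upwards [hzero] with κ hκ
  rw [hκ, Pi.zero_apply, mul_zero]

theorem mulL2_mem_image {n : ℕ} {c : Lp ℂ ⊤ coordMeasure} {γ : ℂ → ℂ} (hγ : Measurable γ)
    {B : ℝ} (hB : ∀ κ, ‖γ κ‖ ≤ B) (hc : c =ᵐ[coordMeasure] fun p => γ p.1)
    {F : Lp ℂ 2 coordMeasure} (hF : F ∈ polyBergmanImage n) :
    mulL2 c F ∈ polyBergmanImage n := by
  obtain ⟨f, hf, rfl⟩ := hF
  rw [← Submodule.orthogonal_orthogonal (polyBergmanImage n), Submodule.mem_orthogonal]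
  intro G hG
  rw [L2.inner_def, ← integral_mul_fst_eq_zero hf hG hγ hB]
  refine integral_congr_ae ?_
  filter_upwards [hc, coeFn_mulL2 c (siegelFourier f)] with p hp hp'
  simp only [RCLike.inner_apply]
  erw [hp', hp]
  ring_nf

end Module

/-! ### The Fourier transform of `(u + it)⁻⁸`. -/

section LaplaceTransform

theorem integrableOn_pow_mul_exp_neg_mul (k : ℕ) {r : ℂ} (hr : 0 < r.re) :
    IntegrableOn (fun t : ℝ => (t : ℂ) ^ k * Complex.exp (-(r * t))) (Ioi 0) := by
  have h := integrableOn_rpow_mul_exp_neg_mul_rpow (s := k) (p := 1) (b := r.re)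
    (by have := k.cast_nonneg (α := ℝ); linarith) one_pos hr
  refine Integrable.mono' h (by fun_prop) ?_
  refine (ae_restrict_iff' measurableSet_Ioi).2 (.of_forall fun t ht => ?_)
  rw [norm_mul, norm_pow, Complex.norm_real, Real.norm_of_nonneg (le_of_lt ht), Complex.norm_exp,
    Real.rpow_natCast, Real.rpow_one]
  simp

theorem tendsto_pow_mul_exp_neg_mul (k : ℕ) {r : ℂ} (hr : 0 < r.re) :
    Tendsto (fun t : ℝ => (t : ℂ) ^ k * Complex.exp (-(r * t))) atTop (𝓝 0) := by
  rw [tendsto_zero_iff_norm_tendsto_zero]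
  refine (tendsto_rpow_mul_exp_neg_mul_atTop_nhds_zero k r.re hr).congr' ?_
  filter_upwards [eventually_gt_atTop 0] with t ht
  rw [norm_mul, norm_pow, Complex.norm_real, Real.norm_of_nonneg (le_of_lt ht), Complex.norm_exp,
    Real.rpow_natCast]
  simp

theorem integral_pow_mul_exp_neg_mul (k : ℕ) {r : ℂ} (hr : 0 < r.re) :
    ∫ t : ℝ in Ioi 0, (t : ℂ) ^ k * Complex.exp (-(r * t)) = k.factorial / r ^ (k + 1) := by
  have hr0 : r ≠ 0 := by rintro rfl; simp at hr
  have hd : ∀ (j : ℕ) (t : ℝ), HasDerivAt (fun t : ℝ => (t : ℂ) ^ j * Complex.exp (-(r * t)))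
      (j * (t : ℂ) ^ (j - 1) * Complex.exp (-(r * t)) + (t : ℂ) ^ j * (Complex.exp (-(r * t)) * -r))
      t := by
    intro j t
    have h1 : HasDerivAt (fun t : ℝ => (t : ℂ)) 1 t := Complex.ofRealCLM.hasDerivAt
    have h2 := (h1.const_mul r).neg.cexp
    rw [mul_one] at h2
    have h3 := h1.pow j
    rw [mul_one] at h3
    exact h3.mul h2
  have hc : ∀ j : ℕ, Continuous fun t : ℝ => (t : ℂ) ^ j * Complex.exp (-(r * t)) := by
    intro j; fun_prop
  induction k with
  | zero =>
    have h := integral_Ioi_of_hasDerivAt_of_tendsto (a := 0) (hc 0).continuousWithinAt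
      (fun t _ => hd 0 t) (by
        have := (integrableOn_pow_mul_exp_neg_mul 0 hr).mul_const (-r)
        refine this.congr (.of_forall fun t => ?_)
        simp) (tendsto_pow_mul_exp_neg_mul 0 hr)
    simp only [Nat.cast_zero, zero_mul, zero_add, pow_zero, one_mul, Complex.ofReal_zero, mul_zero,
      neg_zero, Complex.exp_zero, zero_sub, integral_mul_const] at h ⊢
    rw [Nat.factorial_zero, Nat.cast_one, pow_one, eq_div_iff hr0]
    linear_combination -h
  | succ k ih =>
    have i1 := integrableOn_pow_mul_exp_neg_mul k hr
    have i2 := integrableOn_pow_mul_exp_neg_mul (k + 1) hr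
    have e : ∀ t : ℝ, ((k + 1 : ℕ) : ℂ) * (t : ℂ) ^ (k + 1 - 1) * Complex.exp (-(r * t)) +
        (t : ℂ) ^ (k + 1) * (Complex.exp (-(r * t)) * -r) =
        ((k + 1 : ℕ) : ℂ) * ((t : ℂ) ^ k * Complex.exp (-(r * t))) +
        -r * ((t : ℂ) ^ (k + 1) * Complex.exp (-(r * t))) := by
      intro t; rw [Nat.add_sub_cancel]; ring
    have h := integral_Ioi_of_hasDerivAt_of_tendsto (a := 0) (hc (k + 1)).continuousWithinAt
      (fun t _ => hd (k + 1) t) (by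
        simp only [e]
        exact (i1.const_mul _).add (i2.const_mul _)) (tendsto_pow_mul_exp_neg_mul (k + 1) hr)
    simp only [e] at h
    rw [integral_add (i1.const_mul _) (i2.const_mul _), integral_const_mul, integral_const_mul,
      ih] at h
    simp only [Complex.ofReal_zero, ne_eq, Nat.succ_ne_zero, not_false_eq_true, zero_pow, zero_mul,
      sub_zero] at h
    rw [Nat.factorial_succ, Nat.cast_mul]
    have h4 : r * ∫ t : ℝ in Ioi 0, (t : ℂ) ^ (k + 1) * Complex.exp (-(r * t)) =
        ((k + 1 : ℕ) : ℂ) * (k.factorial / r ^ (k + 1)) := by linear_combination -h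
    have hp : r ^ (k + 1) ≠ 0 := pow_ne_zero _ hr0
    rw [eq_div_iff (pow_ne_zero _ hr0), pow_succ, mul_comm (r ^ (k + 1)) r, ← mul_assoc, mul_comm _ r, h4]
    field_simp

-- Fourier inversion at the continuity point `ξ` of `s⁷ exp(-2πts)` on `s > 0`. Its inverse
-- transform is `7! / (2π(t - iu))⁸`, and `(t - iu)⁸ = (u + it)⁸` because `(-i)⁸ = 1`.
open FourierTransform in
theorem integral_fourierChar_mul_inv_pow {t ξ : ℝ} (ht : 1 ≤ t) (hξ : 0 < ξ) :
    ∫ u : ℝ, (Real.fourierChar (-(u * ξ)) : ℂ) * (((u : ℂ) + t * Complex.I) ^ 8)⁻¹ =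
      ((2 * Real.pi) ^ 8 / (Nat.factorial 7) * (ξ ^ 7 * Real.exp (-(2 * Real.pi * t * ξ))) : ℝ) := by
  let g : ℝ → ℂ := (Ioi 0).indicator fun s : ℝ =>
    (s : ℂ) ^ 7 * Complex.exp (-((2 * Real.pi * t : ℝ) * s))
  have hp := Real.pi_pos
  have hb : 0 < 2 * Real.pi * t := by positivity
  have hgi : Integrable g := (integrable_indicator_iff measurableSet_Ioi).2
    (integrableOn_pow_mul_exp_neg_mul 7 (r := (2 * Real.pi * t : ℝ)) (by simpa using hb))
  have hinv : ∀ u : ℝ, 𝓕⁻ g u =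
      (Nat.factorial 7 / (2 * Real.pi) ^ 8 : ℂ) * (((u : ℂ) + t * Complex.I) ^ 8)⁻¹ := by
    intro u
    have hr : 0 < (2 * Real.pi * (t - u * Complex.I) : ℂ).re := by simpa using hb
    have h := integral_pow_mul_exp_neg_mul 7 hr
    have e8 : (2 * Real.pi * (t - u * Complex.I) : ℂ) ^ (7 + 1) =
        (2 * Real.pi) ^ 8 * ((u : ℂ) + t * Complex.I) ^ 8 := by
      have : (t - u * Complex.I : ℂ) = -Complex.I * (u + t * Complex.I) := by
        linear_combination (t : ℂ) * Complex.I_mul_I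
      rw [this, mul_pow _ (-Complex.I * _), mul_pow (-Complex.I)]
      have : (-Complex.I) ^ (7 + 1) = 1 := by
        rw [show 7 + 1 = 2 * 4 from rfl, pow_mul]; simp; norm_num
      rw [this]; ring
    rw [e8] at h
    rw [Real.fourierInv_eq, ← div_eq_mul_inv, div_div, ← h, ← integral_indicator measurableSet_Ioi]
    refine integral_congr_ae (.of_forall fun s => ?_)
    simp only [g, indicator]
    split_ifs with hs
    · rw [Circle.smul_def, Real.fourierChar_apply, smul_eq_mul, mul_left_comm, ← Complex.exp_add]
      congr 2
      simp only [RCLike.inner_apply, conj_trivial]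
      push_cast
      ring
    · simp
  have hpi : (2 * Real.pi : ℂ) ^ 8 ≠ 0 := by
    have : (2 * Real.pi) ^ 8 ≠ 0 := by positivity
    exact_mod_cast this
  have hf7 : (Nat.factorial 7 : ℂ) ≠ 0 := by exact_mod_cast Nat.factorial_ne_zero 7
  have hne : ∀ u : ℝ, (u : ℂ) + t * Complex.I ≠ 0 := by
    intro u h
    have := congrArg Complex.im h
    simp at this
    linarith
  have hint : Integrable fun u : ℝ => (((u : ℂ) + t * Complex.I) ^ 8)⁻¹ := by
    refine Integrable.mono' integrable_inv_one_add_sq (Continuous.aestronglyMeasurable ?_)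
      (.of_forall fun u => ?_)
    · exact Continuous.inv₀ (by fun_prop) fun u => pow_ne_zero _ (hne u)
    · rw [norm_inv, norm_pow]
      have h1 : ‖(u : ℂ) + t * Complex.I‖ ^ 2 = u ^ 2 + t ^ 2 := by
        rw [← Complex.normSq_eq_norm_sq, Complex.normSq_add_mul_I]
      have h2 : 1 + u ^ 2 ≤ u ^ 2 + t ^ 2 := by nlinarith
      refine inv_anti₀ (by positivity) ?_
      rw [show 8 = 2 * 4 from rfl, pow_mul, h1]
      exact h2.trans (le_self_pow₀ (by nlinarith [sq_nonneg u]) (by norm_num))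
  have hInv : 𝓕⁻ g = fun u : ℝ => (Nat.factorial 7 / (2 * Real.pi) ^ 8 : ℂ) *
      (((u : ℂ) + t * Complex.I) ^ 8)⁻¹ := funext hinv
  have hF : Integrable (𝓕 g) := by
    have h1 : Integrable (𝓕⁻ g) := by rw [hInv]; exact hint.const_mul _
    have h2 : 𝓕 g = fun w => 𝓕⁻ g (-w) := by
      ext w
      rw [Real.fourierInv_eq_fourier_neg, neg_neg]
    rw [h2]
    exact h1.comp_neg
  have hcont : ContinuousAt g ξ := by
    have : g =ᶠ[𝓝 ξ] fun s : ℝ => (s : ℂ) ^ 7 * Complex.exp (-((2 * Real.pi * t : ℝ) * s)) := by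
      filter_upwards [Ioi_mem_nhds hξ] with s hs
      exact indicator_of_mem hs _
    refine ContinuousAt.congr ?_ this.symm
    fun_prop
  have key := hgi.fourier_fourierInv_eq hF hcont
  rw [hInv, Real.fourier_real_eq] at key
  simp only [Circle.smul_def, smul_eq_mul] at key
  have e : ∀ u : ℝ, (Real.fourierChar (-(u * ξ)) : ℂ) * ((Nat.factorial 7 / (2 * Real.pi) ^ 8 : ℂ) *
      (((u : ℂ) + t * Complex.I) ^ 8)⁻¹) = (Nat.factorial 7 / (2 * Real.pi) ^ 8 : ℂ) *
      ((Real.fourierChar (-(u * ξ)) : ℂ) * (((u : ℂ) + t * Complex.I) ^ 8)⁻¹) := fun u => by ring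
  simp only [e] at key
  rw [integral_const_mul, show g ξ = (ξ : ℂ) ^ 7 * Complex.exp (-((2 * Real.pi * t : ℝ) * ξ)) from
    indicator_of_mem hξ _] at key
  push_cast at key ⊢
  rw [← key]
  generalize ∫ u : ℝ, (Real.fourierChar (-(u * ξ)) : ℂ) * (((u : ℂ) + t * Complex.I) ^ 8)⁻¹ = J
  field_simp

end LaplaceTransform

/-! ### A function whose transform has no zeros for `ξ > 0`. -/

section Kernel

/-- Holomorphic functions are killed by both `∂̄` operators. At `n = 0` the second equation would
read `f = 0`, whence the hypothesis on `n`. -/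
theorem isPolyanalytic_of_differentiableOn {f : ℂ × ℂ → ℂ} {n : ℕ} (hn : 1 ≤ n)
    (hf : ContDiffOn ℂ ∞ f siegelDomain) : IsPolyanalytic 1 n f := by
  have hd : ∀ ζ ∈ siegelDomain, ∀ v : ℂ × ℂ,
      fderiv ℝ f ζ (Complex.I • v) = Complex.I * fderiv ℝ f ζ v := by
    intro ζ hζ v
    have h := (hf.differentiableOn (by simp)).differentiableAt (isOpen_siegelDomain.mem_nhds hζ)
    rw [(h.hasFDerivAt.restrictScalars ℝ).fderiv]
    simp
  have h1 : EqOn (dbar₁ f) 0 siegelDomain := by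
    intro ζ hζ
    have := hd ζ hζ (1, 0)
    rw [Prod.smul_mk, smul_eq_mul, mul_one, smul_zero] at this
    rw [dbar₁, this, Pi.zero_apply, ← mul_assoc, Complex.I_mul_I]
    ring
  have h2 : EqOn (dbar₂ f) 0 siegelDomain := by
    intro ζ hζ
    have := hd ζ hζ (0, 1)
    rw [Prod.smul_mk, smul_zero, smul_eq_mul, mul_one] at this
    rw [dbar₂, this, Pi.zero_apply, ← mul_assoc, Complex.I_mul_I]
    ring
  refine ⟨hf.restrict_scalars ℝ, fun ζ hζ => ?_, fun ζ hζ => ?_⟩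
  · simp [dbarTwisted, h1 hζ, h2 hζ]
  · obtain ⟨k, rfl⟩ := Nat.exists_eq_add_of_le' hn
    rw [Function.iterate_succ_apply, (isLinearLocal_dbar₂.iterate k).congr _ _ h2 hζ]
    exact (isPolyanalytic_zero 1 k).eq₂ ζ hζ

/-- The function `(ζ₂ + i)⁻⁸`. -/
noncomputable def invPow (ζ : ℂ × ℂ) : ℂ := ((ζ.2 + Complex.I) ^ 8)⁻¹

theorem im_pos_of_mem {ζ : ℂ × ℂ} (h : ζ ∈ siegelDomain) : ‖ζ.1‖ ^ 2 < ζ.2.im := by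
  rw [siegelDomain, mem_ofPred_eq] at h
  linarith

theorem add_I_ne_zero {z : ℂ} (h : 0 ≤ z.im) : z + Complex.I ≠ 0 := by
  intro h'
  have := congrArg Complex.im h'
  simp at this
  linarith

theorem contDiffOn_invPow : ContDiffOn ℂ ∞ invPow siegelDomain := by
  refine ContDiffOn.inv (by fun_prop) fun ζ hζ => pow_ne_zero _ (add_I_ne_zero ?_)
  exact ((sq_nonneg _).trans_lt (im_pos_of_mem hζ)).le

theorem measurable_invPow : Measurable invPow := by
  unfold invPow
  fun_prop

/-- The exponent `8` supplies four factors `|ζ₂ + i|²`, one for each real coordinate. In the domain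
`|ζ₁|² < Im ζ₂`, so each factor dominates `1 +` the square of any coordinate. -/
theorem norm_invPow_le {ζ : ℂ × ℂ} (h : ζ ∈ siegelDomain) : ‖invPow ζ‖ ≤
    ((1 + ζ.1.re ^ 2)⁻¹ * (1 + ζ.1.im ^ 2)⁻¹) * ((1 + ζ.2.re ^ 2)⁻¹ * (1 + ζ.2.im ^ 2)⁻¹) := by
  have h1 := im_pos_of_mem h
  rw [← Complex.normSq_eq_norm_sq, Complex.normSq_apply] at h1
  have h2 : ‖ζ.2 + Complex.I‖ ^ 2 = ζ.2.re ^ 2 + (ζ.2.im + 1) ^ 2 := by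
    rw [← Complex.normSq_eq_norm_sq, Complex.normSq_apply]
    simp; ring
  rw [invPow, norm_inv, norm_pow, ← mul_inv, ← mul_inv, ← mul_inv]
  refine inv_anti₀ (by positivity) ?_
  rw [show 8 = 2 * 4 from rfl, pow_mul, h2]
  have h0 : 0 ≤ ζ.2.im := by nlinarith [mul_self_nonneg ζ.1.re, mul_self_nonneg ζ.1.im]
  set N := ζ.2.re ^ 2 + (ζ.2.im + 1) ^ 2 with hN
  have e1 : 1 + ζ.1.re ^ 2 ≤ N := by nlinarith [mul_self_nonneg ζ.1.im, sq_nonneg ζ.2.re]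
  have e2 : 1 + ζ.1.im ^ 2 ≤ N := by nlinarith [mul_self_nonneg ζ.1.re, sq_nonneg ζ.2.re]
  have e3 : 1 + ζ.2.re ^ 2 ≤ N := by nlinarith
  have e4 : 1 + ζ.2.im ^ 2 ≤ N := by nlinarith [sq_nonneg ζ.2.re]
  calc _ ≤ (N * N) * (N * N) := by gcongr
    _ = N ^ 4 := by ring

theorem integrable_inv_one_add_sq_complex :
    Integrable fun z : ℂ => (1 + z.re ^ 2)⁻¹ * (1 + z.im ^ 2)⁻¹ :=
  Complex.volume_preserving_equiv_real_prod.integrable_comp_of_integrable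
    (integrable_inv_one_add_sq.mul_prod integrable_inv_one_add_sq)

theorem integrable_invPow : Integrable invPow siegelMeasure := by
  have h : Integrable (fun ζ : ℂ × ℂ => ((1 + ζ.1.re ^ 2)⁻¹ * (1 + ζ.1.im ^ 2)⁻¹) *
      ((1 + ζ.2.re ^ 2)⁻¹ * (1 + ζ.2.im ^ 2)⁻¹)) :=
    integrable_inv_one_add_sq_complex.mul_prod integrable_inv_one_add_sq_complex
  refine Integrable.mono' (h.restrict (s := siegelDomain))
    measurable_invPow.aestronglyMeasurable ?_
  exact (ae_restrict_iff' isOpen_siegelDomain.measurableSet).2 (.of_forall fun ζ => norm_invPow_le)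

theorem memLp_two_invPow : MemLp invPow 2 siegelMeasure := by
  rw [memLp_two_iff_integrable_sq_norm measurable_invPow.aestronglyMeasurable]
  refine Integrable.mono' integrable_invPow.norm (by
    exact (measurable_invPow.norm.pow_const 2).aestronglyMeasurable) ?_
  refine (ae_restrict_iff' isOpen_siegelDomain.measurableSet).2 (.of_forall fun ζ hζ => ?_)
  have h1 : ‖invPow ζ‖ ≤ 1 := by
    refine (norm_invPow_le hζ).trans ?_
    rw [← mul_inv, ← mul_inv, ← mul_inv]
    have h : ∀ t : ℝ, 1 ≤ 1 + t ^ 2 := fun t => by nlinarith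
    exact inv_le_one_of_one_le₀ (one_le_mul_of_one_le_of_one_le
      (one_le_mul_of_one_le_of_one_le (h _) (h _)) (one_le_mul_of_one_le_of_one_le (h _) (h _)))
  rw [Real.norm_of_nonneg (by positivity)]
  exact pow_le_of_le_one (norm_nonneg _) h1 two_ne_zero

/-- The integral in `p` is a positive multiple of a phase times `exp(-2π(1 + v + x² + y²)ξ)`. The
remaining integral in `x` is the Fourier transform of a Gaussian, which never vanishes. -/
theorem integral_fourierChar_mul_invPow {κ : ℂ} (hκ : 0 < κ.im) {y v : ℝ} (hv : 0 < v)
    (hi : Integrable fun q => invPow (siegelCoord (q, (y, v)))) :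
    ∫ q, (Real.fourierChar (-inner ℝ q κ) : ℂ) * invPow (siegelCoord (q, (y, v))) ≠ 0 := by
  have hi' : Integrable fun q => (Real.fourierChar (-inner ℝ q κ) : ℂ) *
      invPow (siegelCoord (q, (y, v))) := by
    refine hi.bdd_mul (c := 1) (Continuous.aestronglyMeasurable (by fun_prop))
      (.of_forall fun q => (Circle.norm_coe _).le)
  have hR := Complex.volume_preserving_equiv_real_prod.symm
  rw [← hR.integral_comp']
  have h1 := integral_prod _ (hR.integrable_comp_of_integrable hi')
  have h2 : ∀ x : ℝ, ∫ p : ℝ, (Real.fourierChar (-inner ℝ (⟨x, p⟩ : ℂ) κ) : ℂ) *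
      invPow (siegelCoord (⟨x, p⟩, (y, v))) =
      ((2 * Real.pi) ^ 8 / (Nat.factorial 7) * κ.im ^ 7 *
        Real.exp (-(2 * Real.pi * (1 + v + y ^ 2) * κ.im)) : ℝ) *
      (Complex.exp (Complex.I * (-(2 * Real.pi * (κ.re + 2 * y * κ.im)) : ℝ) * x) *
      Complex.exp (-(2 * Real.pi * κ.im : ℝ) * x ^ 2)) := by
    intro x
    have h3 := integral_fourierChar_mul_inv_pow (t := 1 + v + x ^ 2 + y ^ 2) (ξ := κ.im)
      (by nlinarith [sq_nonneg x, sq_nonneg y]) hκ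
    -- The shift accounts for `Re ζ₂ = p - 2xy`.
    rw [← integral_sub_right_eq_self _ (2 * x * y)] at h3
    have h4 : ∀ p : ℝ, (Real.fourierChar (-inner ℝ (⟨x, p⟩ : ℂ) κ) : ℂ) *
        invPow (siegelCoord (⟨x, p⟩, (y, v))) =
        Complex.exp (Complex.I * (-(2 * Real.pi * (κ.re + 2 * y * κ.im)) : ℝ) * x) *
        ((Real.fourierChar (-((p - 2 * x * y) * κ.im)) : ℂ) * ((((p - 2 * x * y : ℝ) : ℂ) +
          (1 + v + x ^ 2 + y ^ 2 : ℝ) * Complex.I) ^ 8)⁻¹) := by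
      intro p
      rw [← mul_assoc]
      congr 1
      · rw [Real.fourierChar_apply, Real.fourierChar_apply, ← Complex.exp_add]
        congr 1
        simp only [Complex.inner]
        simp
        ring
      · simp only [invPow, siegelCoord]
        congr 2
        apply Complex.ext <;> simp [-Complex.ofReal_pow] <;> ring
    simp only [h4]
    have h6 : Real.exp (-(2 * Real.pi * (1 + v + x ^ 2 + y ^ 2) * κ.im)) =
        Real.exp (-(2 * Real.pi * (1 + v + y ^ 2) * κ.im)) *
          Real.exp (-(2 * Real.pi * κ.im) * x ^ 2) := by
      rw [← Real.exp_add]; congr 1; ring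
    rw [integral_const_mul, h3, h6]
    push_cast
    ring
  have h5 : ∫ x : ℝ, ∫ p : ℝ, (Real.fourierChar (-inner ℝ (⟨x, p⟩ : ℂ) κ) : ℂ) *
      invPow (siegelCoord (⟨x, p⟩, (y, v))) ≠ 0 := by
    simp only [h2]
    rw [integral_const_mul, fourierIntegral_gaussian (b := (2 * Real.pi * κ.im : ℝ))
      (by simpa using by positivity)]
    have hp := Real.pi_pos
    refine mul_ne_zero (Complex.ofReal_ne_zero.2 (by positivity))
      (mul_ne_zero ?_ (Complex.exp_ne_zero _))
    rw [Complex.cpow_ne_zero_iff_of_exponent_ne_zero (by norm_num)]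
    refine div_ne_zero (Complex.ofReal_ne_zero.2 hp.ne') (Complex.ofReal_ne_zero.2 (by positivity))
  exact fun h => h5 (h1.symm.trans h)

theorem exists_siegelFourier_ne_zero {n : ℕ} (hn : 1 ≤ n) : ∃ f ∈ polyBergman 1 n,
    ∀ᵐ p ∂coordMeasure, 0 < p.1.im → siegelFourier f p ≠ 0 := by
  refine ⟨memLp_two_invPow.toLp invPow, Submodule.le_topologicalClosure _
    ⟨invPow, isPolyanalytic_of_differentiableOn hn contDiffOn_invPow, memLp_two_invPow.coeFn_toLp⟩,
    ?_⟩
  have h1 : Integrable (invPow ∘ siegelCoord) coordMeasure :=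
    measurePreserving_siegelCoord.integrable_comp_of_integrable integrable_invPow
  have h2 : ∀ᵐ p ∂coordMeasure, Integrable fun q => invPow (siegelCoord (q, p.2)) :=
    Measure.quasiMeasurePreserving_snd.ae h1.prod_left_ae
  have h3 : ∀ᵐ p ∂coordMeasure, 0 < p.2.2 :=
    Measure.quasiMeasurePreserving_snd.ae (Measure.quasiMeasurePreserving_snd.ae
      (ae_restrict_mem measurableSet_Ioi))
  filter_upwards [siegelFourier_toLp integrable_invPow memLp_two_invPow, h2, h3] with p hp hi hv h0
  rw [hp, partialFourier_eq]
  exact integral_fourierChar_mul_invPow h0 hv hi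

end Kernel

/-! ### Rays parametrised by `[-∞, ∞]`. -/

section Rays

open ProbabilityTheory

/-- An order isomorphism of `[-∞, ∞]` with `[0, 1]`. -/
noncomputable def erealOrderIso : EReal ≃o Icc (0 : ℝ) 1 :=
  EReal.expOrderIso.trans ENNReal.orderIsoUnitIntervalBirational

/-- An order embedding of `[-∞, ∞]` into `ℝ` with image `[-1, 1]`. -/
noncomputable def slope (x : EReal) : ℝ := 2 * (erealOrderIso x : ℝ) - 1

theorem continuous_slope : Continuous slope := by
  have := erealOrderIso.continuous
  unfold slope
  fun_prop

theorem strictMono_slope : StrictMono slope := by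
  intro x y h
  have : (erealOrderIso x : ℝ) < erealOrderIso y := erealOrderIso.strictMono h
  unfold slope
  linarith

theorem abs_slope_le (x : EReal) : |slope x| ≤ 1 := by
  have := (erealOrderIso x).2
  rw [abs_le, slope]
  constructor <;> linarith [this.1, this.2]

/-- The point of `[-∞, ∞]` with slope `u ∈ [-1, 1]`. -/
noncomputable def ofSlope (u : ℝ) : EReal :=
  erealOrderIso.symm (projIcc 0 1 zero_le_one ((u + 1) / 2))

theorem continuous_ofSlope : Continuous ofSlope :=
  erealOrderIso.symm.continuous.comp (continuous_projIcc.comp (by fun_prop))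

theorem slope_ofSlope {u : ℝ} (hu : |u| ≤ 1) : slope (ofSlope u) = u := by
  rw [abs_le] at hu
  rw [slope, ofSlope, OrderIso.apply_symm_apply, projIcc_of_mem _ ⟨by linarith, by linarith⟩]
  ring

/-- The second coordinate of the ray with slope `x`, as a function of the parameter `c`. -/
noncomputable def ray (x : EReal) (c : ℝ) : ℝ := slope x + (1 - |slope x|) * c

theorem continuous_ray : Continuous fun z : EReal × ℝ => ray z.1 z.2 := by
  have := continuous_slope
  unfold ray
  fun_prop

theorem continuous_ray_right (x : EReal) : Continuous (ray x) := by
  unfold ray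
  fun_prop

theorem monotone_ray (x : EReal) : Monotone (ray x) := by
  intro c d h
  have := mul_le_mul_of_nonneg_left h (sub_nonneg.2 (abs_slope_le x))
  simpa [ray] using this

instance : NullSingletonClass (gaussianReal 0 1) := nullSingletonClass_gaussianReal one_ne_zero

/-- A ray has at most one zero; for slope `±1` it is the constant `±1`. -/
theorem ae_ray_ne_zero (x : EReal) : ∀ᵐ c ∂gaussianReal 0 1, ray x c ≠ 0 := by
  have h : ∀ᵐ c ∂gaussianReal 0 1, c ≠ -slope x / (1 - |slope x|) := by
    simp [ae_iff]
  filter_upwards [h] with c hc h0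
  rw [ray] at h0
  rcases eq_or_ne (1 - |slope x|) 0 with h1 | h1
  · rw [h1, zero_mul, add_zero] at h0
    rw [h0] at h1
    simp at h1
  · exact hc (by rw [eq_div_iff h1]; linarith)

/-- The point `-w / (1 - |w|)` is where the ray of slope `w` crosses zero; rays of smaller slope are
still negative there. -/
theorem ray_neg {x : EReal} {w : ℝ} (hw : |w| < 1) (h : slope x < w) :
    ray x (-w / (1 - |w|)) < 0 := by
  have h1 : 0 < 1 - |w| := by linarith
  have h2 := abs_slope_le x
  rw [ray, mul_div_assoc', ← sub_neg_eq_add, ← neg_div, sub_neg, lt_div_iff₀ h1]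
  rcases abs_cases w with ⟨e, h3⟩ | ⟨e, h3⟩ <;> rcases abs_cases (slope x) with ⟨e', h4⟩ | ⟨e', h4⟩ <;>
    rw [e] at hw ⊢ <;> rw [e'] at h2 ⊢ <;> nlinarith

theorem ray_pos {x : EReal} {w : ℝ} (hw : |w| < 1) (h : w < slope x) :
    0 < ray x (-w / (1 - |w|)) := by
  have h1 : 0 < 1 - |w| := by linarith
  have h2 := abs_slope_le x
  rw [ray, mul_div_assoc', ← sub_neg_eq_add, ← neg_div, sub_pos, div_lt_iff₀ h1]
  rcases abs_cases w with ⟨e, h3⟩ | ⟨e, h3⟩ <;> rcases abs_cases (slope x) with ⟨e', h4⟩ | ⟨e', h4⟩ <;>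
    rw [e] at hw ⊢ <;> rw [e'] at h2 ⊢
  · nlinarith
  · nlinarith
  · rcases h4.eq_or_lt with h0 | h0
    · rw [← h0]; linarith
    · nlinarith
  · nlinarith

/-- The probability that the ray with slope `x` lies in the upper half plane. -/
noncomputable def upperMass (x : EReal) : ℝ := (gaussianReal 0 1).real {c | 0 < ray x c}

theorem strictMono_upperMass : StrictMono upperMass := by
  intro x y h
  -- The crossing point is infinite for slope `±1`. Two intermediate slopes keep both comparison
  -- points finite, and the Gaussian mass between them makes the inequality strict.
  obtain ⟨w, hw1, hw2⟩ := exists_between (strictMono_slope h)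
  obtain ⟨w', hw1', hw2'⟩ := exists_between hw2
  have b1 := abs_le.1 (abs_slope_le x)
  have b2 := abs_le.1 (abs_slope_le y)
  have hw : |w| < 1 := abs_lt.2 ⟨by linarith, by linarith⟩
  have hw' : |w'| < 1 := abs_lt.2 ⟨by linarith, by linarith⟩
  set c := -w / (1 - |w|)
  set c' := -w' / (1 - |w'|)
  have hc : c' < c := by
    have e1 := ray_neg (x := ofSlope w) hw' (by rwa [slope_ofSlope hw.le])
    have e2 : ray (ofSlope w) c = 0 := by
      rw [ray, slope_ofSlope hw.le]
      have : 1 - |w| ≠ 0 := by linarith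
      simp only [c]
      field_simp
      ring
    by_contra hlt
    have := monotone_ray (ofSlope w) (not_lt.1 hlt)
    linarith
  have s1 : {t | 0 < ray x t} ⊆ Ioi c := by
    intro t ht
    by_contra hlt
    have := monotone_ray x (not_lt.1 hlt)
    have := ray_neg (x := x) hw hw1
    have : 0 < ray x t := ht
    linarith
  have s2 : Ioi c ∪ Ioc c' c ⊆ {t | 0 < ray y t} := by
    intro t ht
    have ht' : c' < t := by
      rcases ht with ht | ht
      · exact hc.trans ht
      · exact ht.1
    have := monotone_ray y ht'.le
    exact (ray_pos hw' hw2').trans_le this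
  have hpos : 0 < (gaussianReal 0 1).real (Ioc c' c) := by
    rw [measureReal_def, ENNReal.toReal_pos_iff]
    refine ⟨pos_iff_ne_zero.2 fun h0 => ?_, measure_lt_top _ _⟩
    have := gaussianReal_absolutelyContinuous' 0 one_ne_zero h0
    rw [Real.volume_Ioc, ENNReal.ofReal_eq_zero] at this
    linarith
  calc upperMass x ≤ (gaussianReal 0 1).real (Ioi c) := measureReal_mono s1
    _ < (gaussianReal 0 1).real (Ioi c) + (gaussianReal 0 1).real (Ioc c' c) := by linarith
    _ = (gaussianReal 0 1).real (Ioi c ∪ Ioc c' c) := by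
        rw [measureReal_union _ measurableSet_Ioc]
        exact disjoint_left.2 fun t h1 h2 => not_lt.2 h2.2 h1
    _ ≤ upperMass y := measureReal_mono s2

end Rays

/-! ### Symbols with a jump at `0`, evaluated along rays. -/

section OneSided

/-- The continuous extension of `a` from `(0, ∞]` to `[-∞, ∞]` that is constant on `[-∞, 0]`. -/
noncomputable def rightExt (a : EReal → ℂ) (t : EReal) : ℂ :=
  if t ≤ 0 then limUnder (𝓝[>] 0) a else a t

/-- The continuous extension of `a` from `[-∞, 0)` to `[-∞, ∞]` that is constant on `[0, ∞]`. -/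
noncomputable def leftExt (a : EReal → ℂ) (t : EReal) : ℂ :=
  if 0 ≤ t then limUnder (𝓝[<] 0) a else a t

variable {a : EReal → ℂ}

theorem IsPC.continuous_rightExt (ha : IsPC a) : Continuous (rightExt a) := by
  rw [continuous_iff_continuousAt]
  intro t
  rcases lt_trichotomy t 0 with h | h | h
  · refine (continuousAt_const (y := limUnder (𝓝[>] 0) a)).congr ?_
    filter_upwards [Iio_mem_nhds h] with s hs
    rw [rightExt, if_pos (le_of_lt hs)]
  · subst h
    rw [continuousAt_iff_continuous_left'_right']
    have e : rightExt a 0 = limUnder (𝓝[>] 0) a := if_pos le_rfl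
    constructor <;> rw [ContinuousWithinAt, e]
    · refine tendsto_const_nhds.congr' ?_
      filter_upwards [self_mem_nhdsWithin] with s hs
      rw [rightExt, if_pos (le_of_lt hs)]
    · refine (tendsto_nhds_limUnder ha.right).congr' ?_
      filter_upwards [self_mem_nhdsWithin] with s hs
      rw [rightExt, if_neg (not_le.2 hs)]
  · refine (ha.continuousOn.continuousAt (isOpen_compl_singleton.mem_nhds h.ne')).congr ?_
    filter_upwards [Ioi_mem_nhds h] with s hs
    rw [rightExt, if_neg (not_le.2 hs)]

theorem IsPC.continuous_leftExt (ha : IsPC a) : Continuous (leftExt a) := by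
  rw [continuous_iff_continuousAt]
  intro t
  rcases lt_trichotomy t 0 with h | h | h
  · refine (ha.continuousOn.continuousAt (isOpen_compl_singleton.mem_nhds h.ne)).congr ?_
    filter_upwards [Iio_mem_nhds h] with s hs
    rw [leftExt, if_neg (not_le.2 hs)]
  · subst h
    rw [continuousAt_iff_continuous_left'_right']
    have e : leftExt a 0 = limUnder (𝓝[<] 0) a := if_pos le_rfl
    constructor <;> rw [ContinuousWithinAt, e]
    · refine (tendsto_nhds_limUnder ha.left).congr' ?_
      filter_upwards [self_mem_nhdsWithin] with s hs
      rw [leftExt, if_neg (not_le.2 hs)]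
    · refine tendsto_const_nhds.congr' ?_
      filter_upwards [self_mem_nhdsWithin] with s hs
      rw [leftExt, if_pos (le_of_lt hs)]
  · refine (continuousAt_const (y := limUnder (𝓝[<] 0) a)).congr ?_
    filter_upwards [Ioi_mem_nhds h] with s hs
    rw [leftExt, if_pos (le_of_lt hs)]

/-- The value of `a` at `r c`, where `0 c` is read as `0⁺` or `0⁻` according to the sign of `c`. -/
noncomputable def rayValue (a : EReal → ℂ) (r : ℝ≥0∞) (c : ℝ) : ℂ :=
  if 0 < c then rightExt a (r * c) else leftExt a (r * c)

theorem rayValue_of_ne_zero {r : ℝ≥0∞} (hr : r ≠ 0) {c : ℝ} (hc : c ≠ 0) :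
    rayValue a r c = a (r * c) := by
  have hr' : (0 : EReal) < r := by
    rw [← EReal.coe_ennreal_zero]
    exact EReal.coe_ennreal_lt_coe_ennreal_iff.2 (pos_iff_ne_zero.2 hr)
  rcases lt_or_gt_of_ne hc with h | h
  · have : (r * c : EReal) < 0 := EReal.mul_neg_iff.2 (Or.inl ⟨hr', by exact_mod_cast h⟩)
    rw [rayValue, if_neg (not_lt.2 h.le), leftExt, if_neg (not_le.2 this)]
  · have : (0 : EReal) < r * c := EReal.mul_pos_iff.2 (Or.inl ⟨hr', by exact_mod_cast h⟩)
    rw [rayValue, if_pos h, rightExt, if_neg (not_le.2 this)]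

/-- The sign of `c` is locally constant, so only one of the two continuous extensions is involved.
The product `r·c` is continuous even at `r = 0` and `r = ∞`, because `c` is finite and nonzero. -/
theorem IsPC.continuousAt_rayValue (ha : IsPC a) (r : ℝ≥0∞) {c : ℝ} (hc : c ≠ 0) :
    ContinuousAt (fun z : ℝ≥0∞ × ℝ => rayValue a z.1 z.2) (r, c) := by
  have hm : ContinuousAt (fun z : ℝ≥0∞ × ℝ => (z.1 * z.2 : EReal)) (r, c) := by
    have h1 : ContinuousAt (fun z : EReal × EReal => z.1 * z.2) ((r : EReal), (c : EReal)) :=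
      EReal.continuousAt_mul (Or.inr (EReal.coe_ne_bot c)) (Or.inr (EReal.coe_ne_top c))
        (Or.inr (EReal.coe_eq_zero.not.2 hc)) (Or.inr (EReal.coe_eq_zero.not.2 hc))
    have h2 : ContinuousAt (fun z : ℝ≥0∞ × ℝ => ((z.1 : EReal), (z.2 : EReal))) (r, c) :=
      ((continuous_coe_ennreal_ereal.comp continuous_fst).prodMk
        (continuous_coe_real_ereal.comp continuous_snd)).continuousAt
    exact ContinuousAt.comp (f := fun z : ℝ≥0∞ × ℝ => ((z.1 : EReal), (z.2 : EReal))) h1 h2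
  rcases lt_or_gt_of_ne hc with h | h
  · refine ((ha.continuous_leftExt.continuousAt).comp hm).congr ?_
    filter_upwards [(isOpen_Iio.preimage continuous_snd).mem_nhds (show (r, c) ∈ _ from h)] with z hz
    exact (if_neg (not_lt.2 (le_of_lt hz))).symm
  · refine ((ha.continuous_rightExt.continuousAt).comp hm).congr ?_
    filter_upwards [(isOpen_Ioi.preimage continuous_snd).mem_nhds (show (r, c) ∈ _ from h)] with z hz
    exact (if_pos hz).symm

theorem IsPC.measurable_rayValue (ha : IsPC a) (r : ℝ≥0∞) : Measurable (rayValue a r) := by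
  refine measurable_of_continuousOn_compl_singleton 0 fun c hc => ?_
  exact (ContinuousAt.comp (f := fun c : ℝ => (r, c)) (ha.continuousAt_rayValue r hc)
    (by fun_prop)).continuousWithinAt

theorem IsPC.exists_norm_rayValue_le (ha : IsPC a) : ∃ C : ℝ, ∀ r c, ‖rayValue a r c‖ ≤ C := by
  obtain ⟨C, hC⟩ := isCompact_univ.exists_bound_of_continuousOn ha.continuous_rightExt.continuousOn
  obtain ⟨D, hD⟩ := isCompact_univ.exists_bound_of_continuousOn ha.continuous_leftExt.continuousOn
  refine ⟨max C D, fun r c => ?_⟩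
  rw [rayValue]
  split_ifs
  · exact (hC _ (mem_univ _)).trans (le_max_left _ _)
  · exact (hD _ (mem_univ _)).trans (le_max_right _ _)

end OneSided

/-! ### Continuity of the averaged symbol on `Π̄`. -/

section GaussSymbol

open ProbabilityTheory

/-- The average of `a` over the Gaussian distributions parametrized by `Π̄`. -/
noncomputable def gaussSymbol (a : EReal → ℂ) (p : PiBar) : ℂ :=
  ∫ c, rayValue a p.2⁻¹ (ray p.1 c) ∂gaussianReal 0 1

variable {a : EReal → ℂ}

theorem IsPC.measurable_rayValue_ray (ha : IsPC a) (x : EReal) (r : ℝ≥0∞) :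
    Measurable fun c => rayValue a r (ray x c) :=
  (ha.measurable_rayValue r).comp (continuous_ray_right x).measurable

theorem IsPC.continuous_gaussSymbol (ha : IsPC a) : Continuous (gaussSymbol a) := by
  obtain ⟨C, hC⟩ := ha.exists_norm_rayValue_le
  rw [continuous_iff_continuousAt]
  intro p
  refine continuousAt_of_dominated (bound := fun _ => C)
    (.of_forall fun q => (ha.measurable_rayValue_ray _ _).aestronglyMeasurable)
    (.of_forall fun q => .of_forall fun c => hC _ _) (integrable_const _) ?_
  filter_upwards [ae_ray_ne_zero p.1] with c hc
  have h : ContinuousAt (fun q : PiBar => (q.2⁻¹, ray q.1 c)) p := by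
    refine Continuous.continuousAt (.prodMk (by fun_prop) ?_)
    exact continuous_ray.comp (f := fun q : PiBar => (q.1, c)) (by fun_prop)
  exact ContinuousAt.comp (f := fun q : PiBar => (q.2⁻¹, ray q.1 c))
    (ha.continuousAt_rayValue p.2⁻¹ hc) h

end GaussSymbol

/-! ### The averaged symbols separate points. -/

section Separation

open ProbabilityTheory

theorem rayValue_continuousMap (a : C(EReal, ℂ)) (r : ℝ≥0∞) {c : ℝ} (hc : c ≠ 0) :
    rayValue a r c = a (r * c) := by
  rcases eq_or_ne r 0 with rfl | hr
  · rw [rayValue, EReal.coe_ennreal_zero, zero_mul, rightExt, leftExt, if_pos le_rfl, if_pos le_rfl]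
    have : (𝓝[>] (0 : EReal)).NeBot := nhdsGT_neBot_of_exists_gt ⟨1, zero_lt_one⟩
    have : (𝓝[<] (0 : EReal)).NeBot := nhdsLT_neBot_of_exists_lt ⟨⊥, EReal.bot_lt_zero⟩
    have h1 : limUnder (𝓝[>] (0 : EReal)) a = a 0 :=
      (a.continuous.continuousWithinAt (s := Ioi 0)).tendsto.limUnder_eq
    have h2 : limUnder (𝓝[<] (0 : EReal)) a = a 0 :=
      (a.continuous.continuousWithinAt (s := Iio 0)).tendsto.limUnder_eq
    rw [h1, h2, ite_self]
  · exact rayValue_of_ne_zero hr hc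

theorem gaussSymbol_continuousMap (a : C(EReal, ℂ)) (p : PiBar) :
    gaussSymbol a p = ∫ c, a ((p.2⁻¹ : ℝ≥0∞) * (ray p.1 c : EReal)) ∂gaussianReal 0 1 := by
  refine integral_congr_ae ?_
  filter_upwards [ae_ray_ne_zero p.1] with c hc
  exact rayValue_continuousMap a _ hc

theorem gaussSymbol_top (a : C(EReal, ℂ)) (x : EReal) : gaussSymbol a (x, ⊤) = a 0 := by
  simp [gaussSymbol_continuousMap]

/-- The symbol `t ↦ slope |t|`. -/
noncomputable def absSymbol : C(EReal, ℂ) where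
  toFun t := slope (max t (-t))
  continuous_toFun := by
    have := continuous_slope
    fun_prop

theorem absSymbol_mul (r : ℝ≥0∞) (c : ℝ) :
    absSymbol (r * c) = slope ((r * ENNReal.ofReal |c| : ℝ≥0∞) : EReal) := by
  simp only [absSymbol, ContinuousMap.coe_mk]
  have hr : (0 : EReal) ≤ r := EReal.coe_ennreal_nonneg r
  congr 2
  rw [EReal.coe_ennreal_mul, EReal.coe_ennreal_ofReal, max_eq_left (abs_nonneg c)]
  rcases le_total 0 c with hc | hc
  · have h : (0 : EReal) ≤ r * c := EReal.mul_nonneg hr (by exact_mod_cast hc)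
    rw [abs_of_nonneg hc, max_eq_left ((EReal.neg_le_zero.2 h).trans h)]
  · have h : (0 : EReal) ≤ -(r * c) := by
      rw [← mul_neg]
      exact EReal.mul_nonneg hr (EReal.neg_nonneg.2 (by exact_mod_cast hc))
    rw [abs_of_nonpos hc, EReal.coe_neg, mul_neg, max_eq_right ((EReal.neg_nonneg.1 h).trans h)]

theorem gaussSymbol_absSymbol (x : EReal) (ρ : ℝ≥0∞) : gaussSymbol absSymbol (x, ρ) =
    (∫ c, slope ((ρ⁻¹ * ENNReal.ofReal |ray x c| : ℝ≥0∞) : EReal) ∂gaussianReal 0 1 : ℝ) := by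
  simp only [gaussSymbol_continuousMap, absSymbol_mul]
  exact integral_ofReal

theorem integrable_slope_comp {f : ℝ → EReal} (hf : Measurable f) :
    Integrable (fun c => slope (f c)) (gaussianReal 0 1) :=
  Integrable.of_bound (continuous_slope.measurable.comp hf).aestronglyMeasurable 1
    (.of_forall fun _ => abs_slope_le _)

/-- For almost every `c` the integrand is strictly increasing in `ρ⁻¹`, including the values `0` and
`∞`; hence so is its average. -/
theorem gaussSymbol_absSymbol_ne (x : EReal) {ρ ρ' : ℝ≥0∞} (h : ρ ≠ ρ') :
    gaussSymbol absSymbol (x, ρ) ≠ gaussSymbol absSymbol (x, ρ') := by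
  wlog hlt : ρ < ρ' generalizing ρ ρ'
  · exact (this h.symm (lt_of_le_of_ne (not_lt.1 hlt) h.symm)).symm
  have hr : ρ'⁻¹ < ρ⁻¹ := ENNReal.inv_lt_inv.2 hlt
  rw [gaussSymbol_absSymbol, gaussSymbol_absSymbol, Ne, Complex.ofReal_inj]
  intro heq
  have hm : ∀ r : ℝ≥0∞, Measurable fun c => ((r * ENNReal.ofReal |ray x c| : ℝ≥0∞) : EReal) := by
    intro r
    have := (continuous_ray_right x).measurable
    exact measurable_coe_ennreal_ereal.comp (by fun_prop)
  have hlt : ∀ᵐ c ∂gaussianReal 0 1, slope ((ρ'⁻¹ * ENNReal.ofReal |ray x c| : ℝ≥0∞) : EReal) <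
      slope ((ρ⁻¹ * ENNReal.ofReal |ray x c| : ℝ≥0∞) : EReal) := by
    filter_upwards [ae_ray_ne_zero x] with c hc
    refine strictMono_slope (EReal.coe_ennreal_lt_coe_ennreal_iff.2 ?_)
    exact ENNReal.mul_lt_mul_left (by simpa using hc) ENNReal.ofReal_ne_top hr
  have := (integral_eq_iff_of_ae_le (integrable_slope_comp (hm _)) (integrable_slope_comp (hm _))
    (hlt.mono fun _ hc => hc.le)).1 heq.symm
  obtain ⟨c, h1, h2⟩ := (hlt.and this).exists
  exact h1.ne h2

/-- The indicator function of `(0, ∞]`. -/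
noncomputable def signSymbol (t : EReal) : ℂ := if 0 < t then 1 else 0

theorem tendsto_signSymbol_right : Tendsto signSymbol (𝓝[>] 0) (𝓝 1) := by
  refine tendsto_const_nhds.congr' ?_
  filter_upwards [self_mem_nhdsWithin] with s hs
  exact (if_pos hs).symm

theorem tendsto_signSymbol_left : Tendsto signSymbol (𝓝[<] 0) (𝓝 0) := by
  refine tendsto_const_nhds.congr' ?_
  filter_upwards [self_mem_nhdsWithin] with s hs
  exact (if_neg (not_lt.2 (le_of_lt hs))).symm

theorem isPC_signSymbol : IsPC signSymbol where
  continuousOn t ht := by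
    refine ContinuousAt.continuousWithinAt ?_
    rcases lt_or_gt_of_ne ht with h | h
    · refine (continuousAt_const (y := (0 : ℂ))).congr ?_
      filter_upwards [Iio_mem_nhds h] with s hs
      exact (if_neg (not_lt.2 (le_of_lt hs))).symm
    · refine (continuousAt_const (y := (1 : ℂ))).congr ?_
      filter_upwards [Ioi_mem_nhds h] with s hs
      exact (if_pos hs).symm
  left := ⟨0, tendsto_signSymbol_left⟩
  right := ⟨1, tendsto_signSymbol_right⟩

/-- Independence of `r`, even at `r = 0`, lets this symbol detect the slope on the edge `ρ = ∞` as
well. -/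
theorem rayValue_signSymbol (r : ℝ≥0∞) (c : ℝ) :
    rayValue signSymbol r c = if 0 < c then 1 else 0 := by
  have : (𝓝[>] (0 : EReal)).NeBot := nhdsGT_neBot_of_exists_gt ⟨1, zero_lt_one⟩
  have : (𝓝[<] (0 : EReal)).NeBot := nhdsLT_neBot_of_exists_lt ⟨⊥, EReal.bot_lt_zero⟩
  have h1 : ∀ t, rightExt signSymbol t = 1 := by
    intro t
    rw [rightExt]
    split_ifs with h
    · exact tendsto_signSymbol_right.limUnder_eq
    · exact if_pos (not_le.1 h)
  have h2 : ∀ t, leftExt signSymbol t = 0 := by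
    intro t
    rw [leftExt]
    split_ifs with h
    · exact tendsto_signSymbol_left.limUnder_eq
    · exact if_neg (not_lt.2 (not_le.1 h).le)
  rw [rayValue, h1, h2]

theorem integral_ite_ray (x : EReal) :
    ∫ c, (if 0 < ray x c then 1 else 0 : ℂ) ∂gaussianReal 0 1 = upperMass x := by
  have hm : MeasurableSet {c | 0 < ray x c} :=
    (isOpen_lt continuous_const (continuous_ray_right x)).measurableSet
  have := integral_indicator_const (μ := gaussianReal 0 1) (1 : ℂ) hm
  simp only [indicator, mem_ofPred_eq] at this
  rw [this, upperMass]
  simp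

theorem gaussSymbol_signSymbol (p : PiBar) : gaussSymbol signSymbol p = upperMass p.1 := by
  simp only [gaussSymbol, rayValue_signSymbol, integral_ite_ray]

/-- Continuous functions that increase to the indicator function of `(0, ∞]`. -/
noncomputable def rampSymbol (k : ℕ) : C(EReal, ℂ) where
  toFun t := (min 1 (k * max (slope t - slope 0) 0) : ℝ)
  continuous_toFun := by
    have := continuous_slope
    fun_prop

theorem norm_rampSymbol_le (k : ℕ) (t : EReal) : ‖rampSymbol k t‖ ≤ 1 := by
  simp only [rampSymbol, ContinuousMap.coe_mk]
  rw [Complex.norm_real, Real.norm_of_nonneg (by positivity)]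
  exact min_le_left _ _

theorem tendsto_rampSymbol (t : EReal) :
    Tendsto (fun k => rampSymbol k t) atTop (𝓝 (signSymbol t)) := by
  rcases lt_or_ge 0 t with h | h
  · have h1 : 0 < slope t - slope 0 := sub_pos.2 (strictMono_slope h)
    refine tendsto_const_nhds.congr' ?_
    obtain ⟨K, hK⟩ := exists_nat_ge (1 / (slope t - slope 0))
    filter_upwards [eventually_ge_atTop K] with k hk
    have h2 : 1 ≤ k * max (slope t - slope 0) 0 := by
      rw [max_eq_left h1.le, ← div_le_iff₀ h1]
      exact hK.trans (by exact_mod_cast hk)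
    simp [rampSymbol, signSymbol, h, min_eq_left h2]
  · refine tendsto_const_nhds.congr fun k => ?_
    have h1 : slope t - slope 0 ≤ 0 := sub_nonpos.2 (strictMono_slope.monotone h)
    simp [rampSymbol, signSymbol, not_lt.2 h, max_eq_right h1]

/-- Replaces the discontinuous sign symbol when only continuous symbols are allowed. At `ρ = ∞` it
would fail, since all the averages there equal the value at `0`. -/
theorem tendsto_gaussSymbol_rampSymbol {p : PiBar} (hp : p.2 ≠ ⊤) :
    Tendsto (fun k => gaussSymbol (rampSymbol k) p) atTop (𝓝 (upperMass p.1)) := by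
  rw [← gaussSymbol_signSymbol]
  have hr : p.2⁻¹ ≠ 0 := ENNReal.inv_ne_zero.2 hp
  refine tendsto_integral_of_dominated_convergence (fun _ => 1)
    (fun k => ((isPC_continuousMap _).measurable_rayValue_ray _ _).aestronglyMeasurable)
    (integrable_const _) (fun k => ?_) ?_
  · filter_upwards [ae_ray_ne_zero p.1] with c hc
    rw [rayValue_of_ne_zero hr hc]
    exact norm_rampSymbol_le _ _
  · filter_upwards [ae_ray_ne_zero p.1] with c hc
    simp only [rayValue_of_ne_zero hr hc]
    exact tendsto_rampSymbol _

/-- The symbol of `T_a` as a continuous function on `Π̄`. -/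
noncomputable def piBarSymbol (a : EReal → ℂ) (ha : IsPC a) : C(PiBar, ℂ) :=
  ⟨gaussSymbol a, ha.continuous_gaussSymbol⟩

theorem exists_piBarSymbol_ne {p q : PiBar} (h : p ≠ q) :
    ∃ (a : EReal → ℂ) (ha : IsPC a), piBarSymbol a ha p ≠ piBarSymbol a ha q := by
  obtain ⟨x, ρ⟩ := p
  obtain ⟨x', ρ'⟩ := q
  by_cases hx : x = x'
  · subst hx
    exact ⟨absSymbol, isPC_continuousMap _, gaussSymbol_absSymbol_ne x fun h' => h (by rw [h'])⟩
  · refine ⟨signSymbol, isPC_signSymbol, fun h' => hx (strictMono_upperMass.injective ?_)⟩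
    have h' : gaussSymbol signSymbol (x, ρ) = gaussSymbol signSymbol (x', ρ') := h'
    rw [gaussSymbol_signSymbol, gaussSymbol_signSymbol] at h'
    exact Complex.ofReal_inj.1 h'

/-- The symbol of `T_a` for continuous `a` as a continuous function on the triangle. -/
noncomputable def triangleSymbol (a : C(EReal, ℂ)) : C(Triangle, ℂ) where
  toFun := Quotient.lift (gaussSymbol a) <| by
    rintro ⟨x, ρ⟩ ⟨x', ρ'⟩ (h | ⟨h, h'⟩)
    · rw [h]
    · obtain rfl : ρ = ⊤ := h
      obtain rfl : ρ' = ⊤ := h'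
      rw [gaussSymbol_top, gaussSymbol_top]
  continuous_toFun := (isPC_continuousMap a).continuous_gaussSymbol.quotient_lift _

theorem triangleSymbol_mk (a : C(EReal, ℂ)) (p : PiBar) :
    triangleSymbol a (Quotient.mk collapseTop p) = gaussSymbol a p := rfl

/-- `absSymbol` separates the collapsed point from the rest. Away from it, equality of all averages
passes to the limit of the ramps, so the slopes agree; then `absSymbol` distinguishes `ρ`. -/
theorem exists_triangleSymbol_ne {p q : Triangle} (h : p ≠ q) :
    ∃ a : C(EReal, ℂ), triangleSymbol a p ≠ triangleSymbol a q := by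
  induction p using Quotient.inductionOn with | _ p
  induction q using Quotient.inductionOn with | _ q
  simp only [triangleSymbol_mk]
  obtain ⟨x, ρ⟩ := p
  obtain ⟨x', ρ'⟩ := q
  by_contra! hall
  have h1 := hall absSymbol
  by_cases hρ : ρ = ⊤
  · subst hρ
    by_cases hρ' : ρ' = ⊤
    · subst hρ'
      exact h (Quotient.sound (Or.inr ⟨rfl, rfl⟩))
    · rw [gaussSymbol_top, ← gaussSymbol_top absSymbol x'] at h1
      exact gaussSymbol_absSymbol_ne x' (Ne.symm hρ') h1
  by_cases hρ' : ρ' = ⊤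
  · subst hρ'
    rw [gaussSymbol_top, ← gaussSymbol_top absSymbol x] at h1
    exact gaussSymbol_absSymbol_ne x hρ h1
  have h2 := tendsto_gaussSymbol_rampSymbol (p := (x, ρ)) hρ
  have h3 := tendsto_gaussSymbol_rampSymbol (p := (x', ρ')) hρ'
  simp only [hall] at h2
  have h4 : x = x' := strictMono_upperMass.injective
    (Complex.ofReal_inj.1 (tendsto_nhds_unique h2 h3))
  subst h4
  refine gaussSymbol_absSymbol_ne x (fun h' => h ?_) h1
  rw [h']

end Separation

/-! ### The half-plane `ξ > 0` as the interior of `Π̄`. -/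

section Parameter

open ProbabilityTheory

/-- The scale `|m| + σ`, where `m = -η / (4 ξ)` and `σ = (16 π ξ)^{-1/2}`. -/
noncomputable def tubeScale (κ : ℂ) : ℝ := |-κ.re / (4 * κ.im)| + (√(16 * Real.pi * κ.im))⁻¹

/-- The point of `Π̄` attached to `κ = η + i ξ`. -/
noncomputable def tubeParam (κ : ℂ) : PiBar :=
  (ofSlope (-κ.re / (4 * κ.im) / tubeScale κ), (ENNReal.ofReal (tubeScale κ))⁻¹)

theorem measurable_tubeParam : Measurable tubeParam := by
  have h : Measurable tubeScale := by unfold tubeScale; fun_prop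
  exact (continuous_ofSlope.measurable.comp (by fun_prop)).prodMk (by fun_prop)

theorem tubeScale_pos {κ : ℂ} (hκ : 0 < κ.im) : 0 < tubeScale κ := by
  have := Real.pi_pos
  unfold tubeScale
  positivity

theorem continuousOn_tubeParam : ContinuousOn tubeParam {κ | 0 < κ.im} := by
  have h0 : ∀ κ ∈ {κ : ℂ | 0 < κ.im}, 4 * κ.im ≠ 0 := fun κ (hκ : 0 < κ.im) => by positivity
  have h1 : ∀ κ ∈ {κ : ℂ | 0 < κ.im}, √(16 * Real.pi * κ.im) ≠ 0 :=
    fun κ (hκ : 0 < κ.im) => by have := Real.pi_pos; positivity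
  have hm : ContinuousOn (fun κ : ℂ => -κ.re / (4 * κ.im)) {κ | 0 < κ.im} :=
    ContinuousOn.div (by fun_prop) (by fun_prop) h0
  have hs : ContinuousOn tubeScale {κ | 0 < κ.im} :=
    hm.abs.add (ContinuousOn.inv₀ (by fun_prop) h1)
  refine ContinuousOn.prodMk (continuous_ofSlope.comp_continuousOn
    (hm.div hs fun κ hκ => (tubeScale_pos hκ).ne')) ?_
  exact continuous_inv.comp_continuousOn (ENNReal.continuous_ofReal.comp_continuousOn hs)

theorem abs_mean_div_tubeScale_le {κ : ℂ} (hκ : 0 < κ.im) :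
    |-κ.re / (4 * κ.im) / tubeScale κ| ≤ 1 := by
  rw [abs_div, abs_of_pos (tubeScale_pos hκ), div_le_one (tubeScale_pos hκ)]
  exact le_add_of_nonneg_right (by positivity)

/-- With `r = |m| + σ` and `u = m/r` one has `r(1 - |u|) = σ`, so `r(u + (1 - |u|)c) = m + σc`. -/
theorem tubeScale_mul_ray {κ : ℂ} (hκ : 0 < κ.im) (c : ℝ) :
    tubeScale κ * ray (tubeParam κ).1 c = tubePoint κ c := by
  have h := tubeScale_pos hκ
  rw [ray, tubeParam, slope_ofSlope (abs_mean_div_tubeScale_le hκ), abs_div, abs_of_pos h, tubePoint,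
    mul_add, mul_div_cancel₀ _ h.ne', ← mul_assoc, mul_sub, mul_div_cancel₀ _ h.ne']
  simp [tubeScale]

theorem gaussSymbol_tubeParam {a : EReal → ℂ} {κ : ℂ} (hκ : 0 < κ.im) :
    gaussSymbol a (tubeParam κ) = symbolAverage (fun y => a y) κ := by
  have h := tubeScale_pos hκ
  refine integral_congr_ae ?_
  filter_upwards [ae_ray_ne_zero (tubeParam κ).1] with c hc
  have e : (tubeParam κ).2⁻¹ = ENNReal.ofReal (tubeScale κ) := inv_inv _
  rw [e, rayValue_of_ne_zero (by simpa using h) hc, EReal.coe_ennreal_ofReal, max_eq_left h.le,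
    ← EReal.coe_mul, tubeScale_mul_ray hκ]

theorem exists_tubeParam_eq {x : EReal} (hx : x ∈ Ioo ⊥ ⊤) {ρ : ℝ≥0∞} (hρ : ρ ∈ Ioo 0 ⊤) :
    ∃ κ : ℂ, 0 < κ.im ∧ tubeParam κ = (x, ρ) := by
  have hu : |slope x| < 1 := by
    have h1 := strictMono_slope hx.1
    have h2 := strictMono_slope hx.2
    have h3 := abs_le.1 (abs_slope_le ⊥)
    have h4 := abs_le.1 (abs_slope_le ⊤)
    exact abs_lt.2 ⟨by linarith, by linarith⟩
  have hpi := Real.pi_pos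
  set r : ℝ := ρ⁻¹.toReal with hr
  have hr0 : 0 < r := ENNReal.toReal_pos (ENNReal.inv_ne_zero.2 hρ.2.ne) (ENNReal.inv_ne_top.2 hρ.1.ne')
  set s : ℝ := r * (1 - |slope x|) with hs
  have hs0 : 0 < s := mul_pos hr0 (by linarith)
  have hξ : 0 < (16 * Real.pi * s ^ 2)⁻¹ := by positivity
  -- Solves `m = r·slope x` and `σ = s = r(1 - |slope x|)` for `ξ = 1/(16πσ²)` and `η = -4ξm`.
  refine ⟨⟨-(4 * (16 * Real.pi * s ^ 2)⁻¹ * (r * slope x)), (16 * Real.pi * s ^ 2)⁻¹⟩, hξ, ?_⟩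
  have e1 : (√(16 * Real.pi * (16 * Real.pi * s ^ 2)⁻¹))⁻¹ = s := by
    rw [mul_inv, ← mul_assoc, mul_inv_cancel₀ (by positivity), one_mul, Real.sqrt_inv, inv_inv,
      Real.sqrt_sq hs0.le]
  have e2 : -(-(4 * (16 * Real.pi * s ^ 2)⁻¹ * (r * slope x))) / (4 * (16 * Real.pi * s ^ 2)⁻¹) =
      r * slope x := by
    rw [neg_neg, mul_div_cancel_left₀ _ (by positivity)]
  have e3 : tubeScale ⟨-(4 * (16 * Real.pi * s ^ 2)⁻¹ * (r * slope x)), (16 * Real.pi * s ^ 2)⁻¹⟩ =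
      r := by
    simp only [tubeScale]
    rw [e1, e2, abs_mul, abs_of_pos hr0, hs]
    ring
  simp only [tubeParam, e3]
  rw [e2, mul_div_cancel_left₀ _ hr0.ne', hr, ENNReal.ofReal_toReal (ENNReal.inv_ne_top.2 hρ.1.ne'),
    inv_inv]
  congr 1
  exact strictMono_slope.injective (slope_ofSlope hu.le)

theorem eq_zero_of_comp_tubeParam {γ : C(PiBar, ℂ)} (h : ∀ κ : ℂ, 0 < κ.im → γ (tubeParam κ) = 0) :
    γ = 0 := by
  have h1 : EqOn γ (0 : C(PiBar, ℂ)) (Ioo ⊥ ⊤ ×ˢ Ioo 0 ⊤) := by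
    rintro ⟨x, ρ⟩ ⟨hx, hρ⟩
    obtain ⟨κ, hκ, e⟩ := exists_tubeParam_eq hx hρ
    rw [← e, h κ hκ]
    rfl
  have h2 := h1.closure γ.continuous (0 : C(PiBar, ℂ)).continuous
  rw [closure_prod_eq, closure_Ioo bot_ne_top, closure_Ioo ENNReal.zero_ne_top] at h2
  ext p
  exact h2 ⟨⟨bot_le, le_top⟩, ⟨zero_le, le_top⟩⟩

end Parameter

/-! ### Functional calculus by functions of `κ`, and the Toeplitz operators in it. -/

section SymbolOperator

open ComplexConjugate InnerProductSpace

/-- The partial Fourier transform on `A²_{(1, n)}(D₂)`. -/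
noncomputable def bergmanFourier (n : ℕ) : polyBergman 1 n →ₗᵢ[ℂ] Lp ℂ 2 coordMeasure :=
  siegelFourier.comp (polyBergman 1 n).subtypeₗᵢ

theorem memLp_comp_tubeParam (γ : C(PiBar, ℂ)) :
    MemLp (fun p : ℂ × (ℝ × ℝ) => γ (tubeParam p.1)) ⊤ coordMeasure :=
  memLp_top_of_bound ((γ.continuous.measurable.comp
    (measurable_tubeParam.comp measurable_fst)).aestronglyMeasurable) ‖γ‖
    (.of_forall fun _ => γ.norm_coe_le_norm _)

/-- The operator on `A²_{(1, n)}(D₂)` that the partial Fourier transform turns into multiplication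
by `γ`, regarded as a function of `κ`. -/
noncomputable def symbolOperator (n : ℕ) (γ : C(PiBar, ℂ)) :
    polyBergman 1 n →L[ℂ] polyBergman 1 n :=
  (bergmanFourier n).toContinuousLinearMap.adjoint ∘L
    mulL2 ((memLp_comp_tubeParam γ).toLp _) ∘L (bergmanFourier n).toContinuousLinearMap

variable {n : ℕ}

/-- By `mulL2_mem_image` the product already lies in the image, so the adjoint of the isometry
merely inverts it. No compression takes place, which is why the map is multiplicative. -/
theorem bergmanFourier_symbolOperator (γ : C(PiBar, ℂ)) (f : polyBergman 1 n) :
    bergmanFourier n (symbolOperator n γ f) =ᵐ[coordMeasure]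
      fun p => γ (tubeParam p.1) * bergmanFourier n f p := by
  have hc := (memLp_comp_tubeParam γ).coeFn_toLp
  obtain ⟨g, hg, e⟩ := mulL2_mem_image (n := n)
    (γ.continuous.measurable.comp measurable_tubeParam) (fun κ => γ.norm_coe_le_norm _) hc
    (siegelFourier_mem_image f.2)
  have h1 : mulL2 ((memLp_comp_tubeParam γ).toLp _) (bergmanFourier n f) =
    bergmanFourier n ⟨g, hg⟩ := e.symm
  have h2 : symbolOperator n γ f = ⟨g, hg⟩ := by
    refine ext_inner_left ℂ fun k => ?_
    rw [symbolOperator, ContinuousLinearMap.comp_apply, ContinuousLinearMap.adjoint_inner_right,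
      ContinuousLinearMap.comp_apply]
    simp only [LinearIsometry.coe_toContinuousLinearMap]
    rw [h1, LinearIsometry.inner_map_map]
  rw [h2, ← h1]
  filter_upwards [coeFn_mulL2 ((memLp_comp_tubeParam γ).toLp _) (bergmanFourier n f), hc] with p hp hp'
  rw [hp, hp']

theorem eq_symbolOperator {γ : C(PiBar, ℂ)} {T : polyBergman 1 n →L[ℂ] polyBergman 1 n}
    (h : ∀ f, bergmanFourier n (T f) =ᵐ[coordMeasure]
      fun p => γ (tubeParam p.1) * bergmanFourier n f p) : T = symbolOperator n γ :=
  ContinuousLinearMap.ext fun f => (bergmanFourier n).injective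
    (Lp.ext ((h f).trans (bergmanFourier_symbolOperator γ f).symm))

theorem inner_symbolOperator (γ : C(PiBar, ℂ)) (f g : polyBergman 1 n) :
    inner ℂ g (symbolOperator n γ f) = ∫ p, γ (tubeParam p.1) *
      (bergmanFourier n f p * conj (bergmanFourier n g p)) ∂coordMeasure := by
  rw [← (bergmanFourier n).inner_map_map, L2.inner_def]
  refine integral_congr_ae ?_
  filter_upwards [bergmanFourier_symbolOperator γ f] with p hp
  rw [hp, RCLike.inner_apply]
  ring

/-- The `*`-homomorphism `γ ↦ symbolOperator n γ`. -/
noncomputable def symbolHom (n : ℕ) :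
    C(PiBar, ℂ) →⋆ₐ[ℂ] (polyBergman 1 n →L[ℂ] polyBergman 1 n) where
  toFun := symbolOperator n
  map_one' := (eq_symbolOperator fun f => .of_forall fun p => by simp).symm
  map_mul' γ δ := (eq_symbolOperator fun f => by
    filter_upwards [bergmanFourier_symbolOperator γ (symbolOperator n δ f),
      bergmanFourier_symbolOperator δ f] with p h1 h2
    rw [mul_apply_eq_comp, h1, h2, ContinuousMap.mul_apply, mul_assoc]).symm
  map_zero' := (eq_symbolOperator fun f => by
    rw [zero_apply, map_zero]
    filter_upwards [Lp.coeFn_zero ℂ 2 coordMeasure] with p hp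
    rw [hp, ContinuousMap.zero_apply, zero_mul, Pi.zero_apply]).symm
  map_add' γ δ := (eq_symbolOperator fun f => by
    rw [add_apply, map_add]
    filter_upwards [bergmanFourier_symbolOperator γ f, bergmanFourier_symbolOperator δ f,
      Lp.coeFn_add (bergmanFourier n (symbolOperator n γ f))
        (bergmanFourier n (symbolOperator n δ f))] with p h1 h2 h3
    rw [h3, Pi.add_apply, h1, h2, ContinuousMap.add_apply, add_mul]).symm
  commutes' c := (eq_symbolOperator fun f => by
    have h : algebraMap ℂ (polyBergman 1 n →L[ℂ] polyBergman 1 n) c f = c • f := rfl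
    rw [h, map_smul]
    filter_upwards [Lp.coeFn_smul c (bergmanFourier n f)] with p h1
    rw [h1, Pi.smul_apply, smul_eq_mul, algebraMap_apply, smul_eq_mul, mul_one]).symm
  map_star' γ := by
    rw [ContinuousLinearMap.star_eq_adjoint, ContinuousLinearMap.eq_adjoint_iff]
    intro f g
    rw [inner_symbolOperator, ← inner_conj_symm, inner_symbolOperator, ← integral_conj]
    refine integral_congr_ae (.of_forall fun p => ?_)
    simp only [ContinuousMap.star_apply, map_mul, RCLike.star_def, Complex.conj_conj]
    ring

/-- Testing on the function with nonvanishing transform shows that `γ ∘ tubeParam` vanishes almost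
everywhere on `ξ > 0`. Continuity makes this everywhere, and the interior of `Π̄` is dense. -/
theorem symbolHom_injective (hn : 1 ≤ n) : Function.Injective (symbolHom n) := by
  rw [injective_iff_map_eq_zero]
  intro γ hγ
  obtain ⟨f, hf, hne⟩ := exists_siegelFourier_ne_zero hn
  have h1 := bergmanFourier_symbolOperator γ ⟨f, hf⟩
  have h2 : symbolOperator n γ = 0 := hγ
  rw [h2, zero_apply, map_zero] at h1
  have h3 : ∀ᵐ p ∂coordMeasure, 0 < p.1.im → γ (tubeParam p.1) = 0 := by
    filter_upwards [h1, hne, Lp.coeFn_zero ℂ 2 coordMeasure] with p h4 h5 h6 h7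
    rw [h6] at h4
    exact (mul_eq_zero.1 h4.symm).resolve_right (h5 h7)
  have h4 : ∀ᵐ κ : ℂ, 0 < κ.im → γ (tubeParam κ) = 0 := by
    filter_upwards [Measure.ae_ae_of_ae_prod h3] with κ hκ h0
    have : NeZero ((volume : Measure ℝ).prod (volume.restrict (Ioi (0 : ℝ)))) := by
      refine ⟨fun h => ?_⟩
      have h' := congrArg (fun m => m (univ ×ˢ univ)) h
      simp only [Measure.prod_prod] at h'
      simp at h'
    obtain ⟨w, hw⟩ := hκ.exists
    exact hw h0
  have hopen : IsOpen {κ : ℂ | 0 < κ.im} := isOpen_lt continuous_const Complex.continuous_im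
  refine eq_zero_of_comp_tubeParam fun κ hκ => ?_
  exact Measure.eqOn_open_of_ae_eq (μ := volume) (f := fun κ => γ (tubeParam κ)) (g := fun _ => 0)
    ((ae_restrict_iff' hopen.measurableSet).2 h4) hopen
    (γ.continuous.comp_continuousOn continuousOn_tubeParam) continuousOn_const hκ

/-- The projection disappears in matrix elements between vectors of the space. There `a(y)` may be
replaced by its average over the Gaussian attached to `κ`, which is `gaussSymbol a (tubeParam κ)`.
-/
theorem toeplitzIm_eq_symbolHom {a : EReal → ℂ} (ha : IsPC a) :
    toeplitzIm n a ha = symbolHom n (piBarSymbol a ha) := by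
  ext1 f
  refine ext_inner_left ℂ fun g => ?_
  obtain ⟨B, hB⟩ := ha.bounded
  have hm : Measurable fun y : ℝ => a y := ha.measurable.comp measurable_coe_real_ereal
  refine Eq.trans ?_ (inner_symbolOperator (piBarSymbol a ha) f g).symm
  have h1 : inner ℂ g (toeplitzIm n a ha f) = inner ℂ (g : L2Siegel)
      (mulOperator (ha.memLp_imSymbol.toLp (imSymbol a)) f) :=
    Submodule.inner_orthogonalProjectionOnto_eq_of_mem_left g _
  rw [h1, ← siegelFourier.inner_map_map, L2.inner_def]
  have h2 := integral_symbol_siegelFourier f.2 g.2 hm fun y => hB y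
  have h3 : ∫ p, symbolAverage (fun y => a y) p.1 *
      (siegelFourier f p * conj (siegelFourier g p)) ∂coordMeasure =
      ∫ p, piBarSymbol a ha (tubeParam p.1) *
        (siegelFourier f p * conj (siegelFourier g p)) ∂coordMeasure := by
    refine integral_congr_ae ?_
    filter_upwards [siegelFourier_ae_eq_zero f.2] with p hp
    rcases le_or_gt p.1.im 0 with h0 | h0
    · rw [hp h0, zero_mul, mul_zero, mul_zero]
    · rw [← gaussSymbol_tubeParam h0]
      rfl
  refine Eq.trans ?_ (h2.trans h3)
  refine integral_congr_ae ?_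
  filter_upwards [siegelFourier_mulOperator _ (fun y => a y) ha.memLp_imSymbol.coeFn_toLp f] with p hp
  rw [hp, RCLike.inner_apply]
  ring

end SymbolOperator

/-! ### Generated C*-algebras through Stone–Weierstrass. -/

section Generated

variable {H : Type*} [NormedAddCommGroup H] [InnerProductSpace ℂ H] [CompleteSpace H]
  {K : Type*} [TopologicalSpace K] [CompactSpace K]

/-- An injective `*`-homomorphism of C*-algebras is isometric, hence a closed map, so it commutes
with taking the closed star subalgebra generated. Upstairs that subalgebra is everything, by
Stone–Weierstrass. -/
theorem generatedAlgebra_image_eq_range (φ : C(K, ℂ) →⋆ₐ[ℂ] (H →L[ℂ] H))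
    (hφ : Function.Injective φ) {s : Set C(K, ℂ)}
    (hs : ∀ p q : K, p ≠ q → ∃ γ ∈ s, γ p ≠ γ q) : generatedAlgebra (φ '' s) = φ.range := by
  have hi : Isometry φ := NonUnitalStarAlgHom.isometry φ hφ
  have hsep : (StarAlgebra.adjoin ℂ s).SeparatesPoints := by
    intro p q hpq
    obtain ⟨γ, hγ, hne⟩ := hs p q hpq
    exact ⟨γ, ⟨γ, StarAlgebra.subset_adjoin ℂ s hγ, rfl⟩, hne⟩
  rw [generatedAlgebra, ← StarAlgHom.map_adjoin, StarSubalgebra.topologicalClosure_map _ _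
    hi.isClosedEmbedding.isClosedMap hi.continuous,
    ContinuousMap.starSubalgebra_topologicalClosure_eq_top_of_separatesPoints _ hsep]
  refine SetLike.coe_injective ?_
  rw [StarSubalgebra.coe_map, StarSubalgebra.coe_top, image_univ]
  rfl

theorem exists_isometric_starAlgEquiv (φ : C(K, ℂ) →⋆ₐ[ℂ] (H →L[ℂ] H))
    (hφ : Function.Injective φ) {s : Set C(K, ℂ)}
    (hs : ∀ p q : K, p ≠ q → ∃ γ ∈ s, γ p ≠ γ q) {S : Set (H →L[ℂ] H)} (hS : S = φ '' s) :
    ∃ Φ : generatedAlgebra S ≃⋆ₐ[ℂ] C(K, ℂ), Isometry Φ := by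
  rw [hS, generatedAlgebra_image_eq_range φ hφ hs]
  refine ⟨(StarAlgEquiv.ofInjective φ hφ).symm, ?_⟩
  have hi : Isometry (StarAlgEquiv.ofInjective φ hφ) :=
    fun x y => NonUnitalStarAlgHom.isometry φ hφ x y
  exact hi.right_inv (StarAlgEquiv.ofInjective φ hφ).apply_symm_apply

end Generated

/-- The `*`-homomorphism `C(△) → C(Π̄)` given by the quotient map. -/
noncomputable def trianglePullback : C(Triangle, ℂ) →⋆ₐ[ℂ] C(PiBar, ℂ) :=
  ContinuousMap.compStarAlgHom' ℂ ℂ ⟨Quotient.mk collapseTop, continuous_quotient_mk'⟩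

theorem trianglePullback_injective : Function.Injective trianglePullback := by
  intro γ δ h
  ext p
  induction p using Quotient.inductionOn with | _ p
  exact DFunLike.congr_fun h p

theorem trianglePullback_triangleSymbol (a : C(EReal, ℂ)) :
    trianglePullback (triangleSymbol a) = piBarSymbol a (isPC_continuousMap a) := rfl

end SiegelToeplitz

theorem mainTheorem8 (n : ℕ) (hn : 1 ≤ n) :
    (∃ Φ : SiegelToeplitz.toeplitzAlgebraC n ≃⋆ₐ[ℂ] C(SiegelToeplitz.Triangle, ℂ), Isometry Φ) ∧
      Nonempty (SiegelToeplitz.toeplitzAlgebraPC n ≃⋆ₐ[ℂ] C(SiegelToeplitz.PiBar, ℂ)) := by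
  open SiegelToeplitz in
  constructor
  -- Averages of continuous symbols factor through the quotient, so the homomorphism is restricted
  -- to functions pulled back from `△`.
  · refine exists_isometric_starAlgEquiv ((symbolHom n).comp trianglePullback)
      ((symbolHom_injective hn).comp trianglePullback_injective) (s := range triangleSymbol)
      (fun p q h => ?_) ?_
    · obtain ⟨a, ha⟩ := exists_triangleSymbol_ne h
      exact ⟨_, ⟨a, rfl⟩, ha⟩
    · ext T
      simp only [mem_ofPred_eq, mem_image, mem_range, exists_exists_eq_and]
      refine exists_congr fun a => ?_
      rw [toeplitzIm_eq_symbolHom, StarAlgHom.comp_apply, trianglePullback_triangleSymbol]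
      exact eq_comm
  · have h : {T | ∃ (a : EReal → ℂ) (ha : IsPC a), T = toeplitzIm n a ha} =
        symbolHom n '' {γ | ∃ (a : EReal → ℂ) (ha : IsPC a), piBarSymbol a ha = γ} := by
      ext T
      constructor
      · rintro ⟨a, ha, rfl⟩
        exact ⟨_, ⟨a, ha, rfl⟩, (toeplitzIm_eq_symbolHom ha).symm⟩
      · rintro ⟨_, ⟨a, ha, rfl⟩, rfl⟩
        exact ⟨a, ha, (toeplitzIm_eq_symbolHom ha).symm⟩
    obtain ⟨Φ, -⟩ := exists_isometric_starAlgEquiv (symbolHom n) (symbolHom_injective hn)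
      (fun p q hpq => by
        obtain ⟨a, ha, hne⟩ := exists_piBarSymbol_ne hpq
        exact ⟨_, ⟨a, ha, rfl⟩, hne⟩) h
    exact ⟨Φ⟩
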